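/- **Setting.** There are $n\ge 1$ nodes; $\mathcal H$ is the set of honest nodes, $|\mathcal H|\ge(1-\delta)n$ with $0\le\delta\le\delta_{\max}<1/2$. Let $f_i(x)=\mathbb E_{\xi\sim\mathcal D_i}F(x,\xi)$ and $f=\frac1{|\mathcal H|}\sum_{i\in\mathcal H}f_i$ on $\mathbb R^d$. For $i\in\mathcal H$ the $f_i$ are differentiable, bounded below and $L$-smooth ($L>0$), and $\frac1{|\mathcal H|}\sum_{i\in\mathcal H}\|\nabla f_i(x)-\nabla f(x)\|^2\le\zeta^2$ for all $x$. $F$ is Borel and continuously differentiable in $x$, and for $i\in\mathcal H$, $\xi\sim\mathcal D_i$, the stochastic gradient $\nabla F(x,\xi)$ is unbiased for $\nabla f_i(x)$ with variance at most $\sigma^2$; all samples are independent. The (Borel) aggregator $\mathsf A$ satisfies $\|\mathsf A(w)-\bar w\|^2\le\frac{\rho\delta}{|\mathcal H|}\sum_{i\in\mathcal H}\|w_i-\bar w\|^2$ for all $w_1,\dots,w_n\in\mathbb R^d$, where $\bar w=\frac1{|\mathcal H|}\sum_{i\in\mathcal H}w_i$ and $\rho\ge0$. In every round the Byzantine nodes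 ($i\notin\mathcal H$) send arbitrary vectors, which may depend on all samples drawn so far (those of this round included) and on private randomness independent of the samples. One oracle query means that every honest node computes one stochastic gradient. **Byrd-Nester** (start $x^0=y^0$, batch sizes $m_0,m$, parameters $\alpha,\beta,\theta,\eta$). Honest nodes send $s_i^0=\frac1{m_0}\sum_{l\le m_0}\nabla F(y^0,\xi_i^{l})$, and $\hat s^0=\mathsf A(\{s_i^0\})$. For $t=1,\dots,T$ honest nodes send $g_i^{t-1}=\frac1m\sum_{l\le m}\nabla F(y^{t-1},\xi_i^{(t-1,l)})$ and $s_i^t=\beta s_i^{t-1}+\theta g_i^{t-1}$ (with fresh samples), and the server sets $s^t=\beta\hat s^{t-1}+\theta\mathsf A(\{g_i^{t-1}\})$, $\hat s^t=(1-\alpha)s^t+\alpha\mathsf A(\{s_i^t\})$, $x^t=x^{t-1}-\eta\hat s^t$, $y^t=x^t+\beta(x^t-x^{t-1})$. The output is $x^T$, and $m_0+mT$ queries are made. **Byrd-reNester** (for an $M$-smooth, $\mu$-strongly convex objective with minimizer $z^*$, start $z(0)$, accuracy $\epsilon'$). With $\kappa=M/\mu$, $R=\|z(0)-z^*\|$ and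 $\epsilon_1^2=\frac{32}\mu\big(3\rho\delta(1+\frac1{(1-\delta)n})+\frac1{(1-\delta)n}\big)\sigma^2$, for $p=1,\dots,P=\max\{\lceil\log_2\frac{4M\epsilon_1^2}{\epsilon'^2}\rceil,1\}$ let $z(p)$ be the output of Byrd-Nester started at $z(p-1)$ with $m_0=m=2^{p-1}$ and $T=T(p)$, where $T(1)=\min\{\lceil2\sqrt\kappa\log\frac{2MR^2}{\epsilon_1^2}\rceil,\lceil2\sqrt\kappa\log\frac{4M^2R^2}{\epsilon'^2}\rceil\}$ (the first entry is $+\infty$ if $\epsilon_1=0$; a negative value means $0$) and $T(p)=\lceil2\sqrt\kappa\log8\rceil$ for $p\ge2$. The output is $z(P)$. **Inexact proximal point method.** From $\varkappa^0$ with $\Delta=f(\varkappa^0)-\inf f>0$, for $\gamma=1,\dots,\Gamma=\lceil32L\Delta\epsilon^{-2}\rceil$ let $\varkappa^\gamma$ be the output of Byrd-reNester, started at $\varkappa^{\gamma-1}$, on the surrogate with $f_i^\gamma(z)=f_i(z)+L\|z-\varkappa^{\gamma-1}\|^2$, $i\in\mathcal H$ (so $M=3L$, $\mu=L$), with $\epsilon'=\sqrt{3/20}\,\epsilon$,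 $\eta=\frac1{3L}$, $\alpha=0$, $\beta=\frac{\sqrt3-1}{\sqrt3+1}$, $\theta=1$. The output is $\tilde x=\varkappa^{\gamma'}$ with $\gamma'$ uniform on $\{1,\dots,\Gamma\}$, independent of the run. **Theorem.** For every $\epsilon>0$ the output satisfies $$\mathbb E\|\nabla f(\tilde x)\|\le16\sqrt5\,\rho^{1/2}\delta^{1/2}\zeta+\epsilon .$$ Moreover there is an absolute constant $C$ such that, whenever $\epsilon\le L\Delta$ and $2\epsilon^2\le L\Delta$, the total number $K$ of oracle queries satisfies $$\mathbb E[K]\le C\left(\frac{L\Delta\rho\delta\sigma^2}{\epsilon^4}+\frac{L\Delta\sigma^2}{(1-\delta)n\epsilon^4}+\frac{L\Delta}{\epsilon^2}\log\frac{L\Delta(1+\rho\delta\zeta^2)}{\epsilon^2}\right).$$ -/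

import Mathlib

open MeasureTheory ProbabilityTheory
open scoped BigOperators Gradient

noncomputable section

namespace ByzantineRobust

/-- The space `ℝ^k` with its Euclidean norm. -/
abbrev Vec (k : ℕ) : Type := EuclideanSpace ℝ (Fin k)

/-- The average of `w` over the index set `H`. -/
def honestMean {V : Type*} [AddCommGroup V] [Module ℝ V] {n : ℕ} (H : Finset (Fin n))
    (w : Fin n → V) : V :=
  (H.card : ℝ)⁻¹ • ∑ i ∈ H, w i

/-- The data of a distributed stochastic problem on `n` nodes: the set `H` of honest nodes, the
sample loss `F x ξ`, and the data distribution `D i` of node `i`. -/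
structure Problem (n d q : ℕ) where
  H : Finset (Fin n)
  F : Vec d → Vec q → ℝ
  D : Fin n → Measure (Vec q)

namespace Problem

variable {n d q : ℕ}

/-- `f_i(x) = 𝔼_{ξ ∼ D_i} F(x, ξ)`. -/
def localObj (p : Problem n d q) (i : Fin n) (x : Vec d) : ℝ :=
  ∫ ξ, p.F x ξ ∂(p.D i)

/-- `f(x) = (1 / |H|) ∑_{i ∈ H} f_i(x)`. -/
def obj (p : Problem n d q) (x : Vec d) : ℝ :=
  honestMean p.H (fun i => p.localObj i x)

/-- The problem with sample loss `F(z, ξ) + L ‖z - c‖²`; its local objectives are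
`f_i(z) + L ‖z - c‖²`. -/
def surrogate (p : Problem n d q) (L : ℝ) (c : Vec d) : Problem n d q where
  H := p.H
  F := fun z ξ => p.F z ξ + L * ‖z - c‖ ^ 2
  D := p.D

/-- The function class: honest local objectives are differentiable, bounded below and `L`-smooth,
the objective is continuously differentiable, and the gradient dissimilarity is at most `ζ²`. -/
structure IsSmoothHeterogeneous (p : Problem n d q) (L ζ : ℝ) : Prop where
  contDiff_obj : ContDiff ℝ 1 p.obj
  differentiable : ∀ i ∈ p.H, Differentiable ℝ (p.localObj i)
  bddBelow : ∀ i ∈ p.H, BddBelow (Set.range (p.localObj i))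
  smooth : ∀ i ∈ p.H, ∀ x y, ‖∇ (p.localObj i) x - ∇ (p.localObj i) y‖ ≤ L * ‖x - y‖
  dissimilarity : ∀ x,
    (p.H.card : ℝ)⁻¹ * ∑ i ∈ p.H, ‖∇ (p.localObj i) x - ∇ p.obj x‖ ^ 2 ≤ ζ ^ 2

/-- The stochastic gradient oracle class: `F` is Borel, continuously differentiable in `x`, and
`∇F(x, ξ)` with `ξ ∼ D_i`, `i ∈ H`, is an unbiased estimator of `∇f_i(x)` with variance at
most `σ²`. -/
structure IsUnbiasedOracle (p : Problem n d q) (σ : ℝ) : Prop where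
  measurable : Measurable (fun v : Vec d × Vec q => p.F v.1 v.2)
  contDiff : ∀ ξ, ContDiff ℝ 1 (fun x => p.F x ξ)
  integrable : ∀ i ∈ p.H, ∀ x, Integrable (p.F x) (p.D i)
  integrable_grad : ∀ i ∈ p.H, ∀ x, Integrable (fun ξ => ∇ (fun z => p.F z ξ) x) (p.D i)
  unbiased : ∀ i ∈ p.H, ∀ x, ∫ ξ, ∇ (fun z => p.F z ξ) x ∂(p.D i) = ∇ (p.localObj i) x
  integrable_sq : ∀ i ∈ p.H, ∀ x,
    Integrable (fun ξ => ‖∇ (fun z => p.F z ξ) x - ∇ (p.localObj i) x‖ ^ 2) (p.D i)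
  variance : ∀ i ∈ p.H, ∀ x,
    ∫ ξ, ‖∇ (fun z => p.F z ξ) x - ∇ (p.localObj i) x‖ ^ 2 ∂(p.D i) ≤ σ ^ 2

end Problem

/-- `A` is `ρ`-robust for the honest set `H` and the estimated Byzantine fraction `δ`. -/
def IsRobustAggregator {n d : ℕ} (H : Finset (Fin n)) (δ ρ : ℝ)
    (A : (Fin n → Vec d) → Vec d) : Prop :=
  ∀ w : Fin n → Vec d,
    ‖A w - honestMean H w‖ ^ 2 ≤ ρ * δ / (H.card : ℝ) * ∑ i ∈ H, ‖w i - honestMean H w‖ ^ 2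

/-! ### Byrd-Nester -/

/-- The parameters `α, β, θ, η` of Byrd-Nester. -/
structure StepParams where
  α : ℝ
  β : ℝ
  θ : ℝ
  η : ℝ

/-- The state of Byrd-Nester: `x^t`, `y^t`, the server's `ŝ^t`, the messages `s_i^t`, and the number
of oracle queries made so far (one query: every honest node computes one stochastic gradient). -/
structure NesterState (n d : ℕ) where
  x : Vec d
  y : Vec d
  sHat : Vec d
  s : Fin n → Vec d
  queries : ℕ

variable {n d q : ℕ}

/-- The mini-batch stochastic gradient `(1/m) ∑_{l < m} ∇F(y, ξ_l)`. -/
def miniBatch (F : Vec d → Vec q → ℝ) (m : ℕ) (ξ : ℕ → Vec q) (y : Vec d) : Vec d :=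
  (m : ℝ)⁻¹ • ∑ l ∈ Finset.range m, ∇ (fun z => F z (ξ l)) y

/-- Byrd-Nester from `x⁰ = y⁰`, along one realization of the samples (`ξ t i l` is sample `l` of
node `i` in round `t`) and of the two Byzantine messages `bG t i`, `bS t i` in round `t`. Round `0`
is the initialization with batch size `m₀`, round `t ≥ 1` is the `t`-th iteration. -/
def byrdNester (p : Problem n d q) (A : (Fin n → Vec d) → Vec d) (c : StepParams) (m₀ m : ℕ)
    (ξ : ℕ → Fin n → ℕ → Vec q) (bG bS : ℕ → Fin n → Vec d) (x₀ : Vec d) :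
    ℕ → NesterState n d
  | 0 =>
    let s : Fin n → Vec d := fun i => if i ∈ p.H then miniBatch p.F m₀ (ξ 0 i) x₀ else bS 0 i
    { x := x₀, y := x₀, sHat := A s, s := s, queries := m₀ }
  | t + 1 =>
    let st := byrdNester p A c m₀ m ξ bG bS x₀ t
    let g : Fin n → Vec d := fun i =>
      if i ∈ p.H then miniBatch p.F m (ξ (t + 1) i) st.y else bG (t + 1) i
    let s : Fin n → Vec d := fun i =>
      if i ∈ p.H then c.β • st.s i + c.θ • g i else bS (t + 1) i
    let sServer : Vec d := c.β • st.sHat + c.θ • A g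
    let sHat : Vec d := (1 - c.α) • sServer + c.α • A s
    let x : Vec d := st.x - c.η • sHat
    { x := x, y := x + c.β • (x - st.x), sHat := sHat, s := s, queries := st.queries + m }

/-! ### Byrd-reNester -/

/-- The constants that determine the schedule of Byrd-reNester: smoothness `M` and strong convexity
`μ` of the objective, target accuracy `ε`, and `ρ`, `δ`, `σ`. -/
structure RestartParams where
  M : ℝ
  μ : ℝ
  ε : ℝ
  ρ : ℝ
  δ : ℝ
  σ : ℝ

namespace RestartParams

/-- `ε(1)² = (32/μ) (3ρδ(1 + 1/((1-δ)n)) + 1/((1-δ)n)) σ²`. -/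
def epsOneSq (r : RestartParams) (n : ℕ) : ℝ :=
  32 / r.μ * (3 * r.ρ * r.δ * (1 + 1 / ((1 - r.δ) * n)) + 1 / ((1 - r.δ) * n)) * r.σ ^ 2

/-- The number of stages `P = max {⌈log₂ (4 M ε(1)² / ε²)⌉, 1}` (which is `1` if `ε(1) = 0`). -/
def stages (r : RestartParams) (n : ℕ) : ℕ :=
  max ⌈Real.logb 2 (4 * r.M * r.epsOneSq n / r.ε ^ 2)⌉₊ 1

/-- The number of iterations `T(1)` of the first stage,
`min {⌈2√κ log (2MR²/ε(1)²)⌉, ⌈2√κ log (4M²R²/ε²)⌉}` with `κ = M/μ`; the first entry is `+∞` if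
`ε(1) = 0`, and a nonpositive value means no iteration. -/
def firstLength (r : RestartParams) (n : ℕ) (R : ℝ) : ℕ :=
  let b : ℕ := ⌈2 * √(r.M / r.μ) * Real.log (4 * r.M ^ 2 * R ^ 2 / r.ε ^ 2)⌉₊
  if r.epsOneSq n = 0 then b
  else min ⌈2 * √(r.M / r.μ) * Real.log (2 * r.M * R ^ 2 / r.epsOneSq n)⌉₊ b

/-- The number of iterations `T(p)` of stage `p ≥ 1`. -/
def length (r : RestartParams) (n : ℕ) (R : ℝ) (p : ℕ) : ℕ :=
  if p = 1 then r.firstLength n R else ⌈2 * √(r.M / r.μ) * Real.log 8⌉₊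

end RestartParams

/-- The distance from `z` to the set of minimizers of `φ`. -/
def distArgmin (φ : Vec d → ℝ) (z : Vec d) : ℝ :=
  Metric.infDist z {w | IsMinOn φ Set.univ w}

/-- The point `z(p)` after `p` stages of Byrd-reNester from `z(0)`, with the number of oracle
queries. Stage `p` runs Byrd-Nester from `z(p-1)` for `T(p)` iterations with batch sizes
`m₀ = m = 2^(p-1)`. The samples and Byzantine messages of stage `p` are `ξ p`, `bG p`, `bS p`. -/
def byrdReNester (p : Problem n d q) (A : (Fin n → Vec d) → Vec d) (c : StepParams)
    (r : RestartParams) (ξ : ℕ → ℕ → Fin n → ℕ → Vec q) (bG bS : ℕ → ℕ → Fin n → Vec d)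
    (z₀ : Vec d) : ℕ → Vec d × ℕ
  | 0 => (z₀, 0)
  | k + 1 =>
    let prev := byrdReNester p A c r ξ bG bS z₀ k
    let T := r.length n (distArgmin p.obj z₀) (k + 1)
    let st := byrdNester p A c (2 ^ k) (2 ^ k) (ξ (k + 1)) (bG (k + 1)) (bS (k + 1)) prev.1 T
    (st.x, prev.2 + st.queries)

/-! ### The inexact proximal point method -/

/-- The point `ϰ^γ` after `γ` calls of Byrd-reNester, with the number of oracle queries. Call `γ`
runs all the stages of Byrd-reNester on the surrogate centred at `ϰ^(γ-1)`, starting there. -/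
def proxPoint (p : Problem n d q) (A : (Fin n → Vec d) → Vec d) (c : StepParams)
    (r : RestartParams) (L : ℝ) (ξ : ℕ → ℕ → ℕ → Fin n → ℕ → Vec q)
    (bG bS : ℕ → ℕ → ℕ → Fin n → Vec d) (x₀ : Vec d) : ℕ → Vec d × ℕ
  | 0 => (x₀, 0)
  | γ + 1 =>
    let prev := proxPoint p A c r L ξ bG bS x₀ γ
    let out := byrdReNester (p.surrogate L prev.1) A c r (ξ (γ + 1)) (bG (γ + 1)) (bS (γ + 1))
      prev.1 (r.stages n)
    (out.1, prev.2 + out.2)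

/-! ### Randomness -/

/-- Rounds `(γ, p, t)` (call `γ`, stage `p`, round `t` of Byrd-Nester) in chronological, that is
lexicographic, order. -/
abbrev Round : Type := ℕ ×ₗ (ℕ ×ₗ ℕ)

/-- Round `t` of stage `p` of call `γ`. -/
def mkRound (γ p t : ℕ) : Round := toLex (γ, toLex (p, t))

/-- The σ-algebra generated by the samples of the honest nodes in the rounds in `S`. -/
abbrev sampleSigma {Ω : Type*} (H : Finset (Fin n)) (ξ : Round → Fin n → ℕ → Ω → Vec q)
    (S : Set Round) : MeasurableSpace Ω :=
  ⨆ k ∈ S, ⨆ i ∈ H, ⨆ l : ℕ, MeasurableSpace.comap (ξ k i l) inferInstance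

/-- Sampling and Byzantine behaviour. The honest samples are independent over all rounds, honest
nodes and batch positions, and distributed as `D i` at node `i`. In each round, the Byzantine nodes
send arbitrary vectors, which may depend on all honest samples up to and including that round, and
on randomness `𝒰` of their own that is independent of the samples. -/
structure IsExecution {Ω : Type*} (𝒰 : MeasurableSpace Ω) [mΩ : MeasurableSpace Ω]
    (P : Measure Ω) (p : Problem n d q) (ξ : Round → Fin n → ℕ → Ω → Vec q)
    (bG bS : Round → Fin n → Ω → Vec d) : Prop where
  measurable_sample : ∀ k, ∀ i ∈ p.H, ∀ l, Measurable (ξ k i l)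
  law_sample : ∀ k, ∀ i ∈ p.H, ∀ l, P.map (ξ k i l) = p.D i
  indep_sample :
    iIndepFun (fun (j : Round × {i // i ∈ p.H} × ℕ) => ξ j.1 j.2.1.1 j.2.2) P
  private_le : 𝒰 ≤ mΩ
  private_indep : Indep 𝒰 (sampleSigma p.H ξ Set.univ) P
  adapted_G : ∀ k, ∀ i ∉ p.H, Measurable[𝒰 ⊔ sampleSigma p.H ξ (Set.Iic k)] (bG k i)
  adapted_S : ∀ k, ∀ i ∉ p.H, Measurable[𝒰 ⊔ sampleSigma p.H ξ (Set.Iic k)] (bS k i)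

/-- The proximal point method as a random process: `ϰ^γ` and the number of queries after `γ`
calls, on the outcome `ω`. -/
def proxProcess {Ω : Type*} (p : Problem n d q) (A : (Fin n → Vec d) → Vec d) (c : StepParams)
    (r : RestartParams) (L : ℝ) (ξ : Round → Fin n → ℕ → Ω → Vec q)
    (bG bS : Round → Fin n → Ω → Vec d) (x₀ : Vec d) (γ : ℕ) (ω : Ω) : Vec d × ℕ :=
  proxPoint p A c r L (fun γ k t i l => ξ (mkRound γ k t) i l ω)
    (fun γ k t i => bG (mkRound γ k t) i ω) (fun γ k t i => bS (mkRound γ k t) i ω) x₀ γ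

end ByzantineRobust

end

noncomputable section

namespace ByzantineRobust

variable {n d q : ℕ}

/-! The method is a perturbed proximal point iteration. Adding L‖z - c‖² turns curvature in [-L, L]
into curvature in [L, 3L], so every call solves a strongly convex problem of condition number 3. If
a call centred at c ends at z with suboptimality g, then f(z) + L‖z - c‖² ≤ f(c) + g
(`objGap_add_le`) and ‖∇f(z)‖² ≤ 12Lg + 8L · L‖z - c‖² (`norm_gradient_sq_le`). Telescoping over Γ
calls bounds the average of 𝔼‖∇f‖² by 20L · sup 𝔼g + 8LΔ/Γ.

It therefore suffices that 𝔼g ≤ 3ε²/(80L) + 64ρδζ²/L for each call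
(`lintegral_proxGap_restartRun_le`). With α = 0, Byrd-Nester is Nesterov's method driven by an
inexact gradient, the aggregate. With exact gradients a Lyapunov function contracts by 1 - 1/√3
(`exact_step`). Absorbing the gradient error by Young's inequality costs a factor 3/2 and leaves the
contraction 7/10 plus an additive error (`inexact_step`). The first step is separate, because y⁰ =
x⁰ although the momentum already starts at ŝ⁰ (`first_step`).

Robustness bounds the gradient error by a function of the honest samples and the query point
(`norm_aggregate_sub_proxGrad_sq_le`). Byzantine nodes thus act only through the query point, which
is determined by the past, while the fresh samples are independent of that past. Hence the expected
error is at most `errorBound`, whatever the adversary does (`lintegral_mul_batchError_le`). Its σ²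
part halves when the batch doubles, and each later stage shrinks the previous gap to a quarter, so
the restarts converge geometrically to a floor of order ρδζ²/L.

The number of queries of a call is a deterministic function of the distance R from its starting
point to the minimizer. The later stages cost O(2^P), that is O(Lε₁²/ε²). The first costs O(log R²),
and R² is controlled by the objective gap, whose expectation the telescoping bounds. The tangent
line of the logarithm (`log_le_log_add_div`) then gives the expected cost (`integral_queries_le`).
-/

theorem norm_sub_sq_le_add_mul {V : Type*} [SeminormedAddCommGroup V] {s : ℝ}
    (hs : 0 < s) (a b : V) :
    ‖a - b‖ ^ 2 ≤ (1 + s) * ‖a‖ ^ 2 + (1 + s⁻¹) * ‖b‖ ^ 2 := by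
  have h1 : ‖a - b‖ ≤ ‖a‖ + ‖b‖ := norm_sub_le a b
  have h2 : 0 ≤ s⁻¹ * (s * ‖a‖ - ‖b‖) ^ 2 := by positivity
  have h3 : s⁻¹ * (s * ‖a‖ - ‖b‖) ^ 2 = s * ‖a‖ ^ 2 - 2 * ‖a‖ * ‖b‖ + s⁻¹ * ‖b‖ ^ 2 := by
    field_simp
    ring
  nlinarith [norm_nonneg (a - b)]

theorem norm_add_sq_le_two_mul {V : Type*} [SeminormedAddCommGroup V] (a b : V) :
    ‖a + b‖ ^ 2 ≤ 2 * ‖a‖ ^ 2 + 2 * ‖b‖ ^ 2 := by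
  have := norm_sub_sq_le_add_mul one_pos a (-b)
  rw [sub_neg_eq_add, norm_neg] at this
  norm_num at this
  exact this

/-! ### Functions between two quadratics -/

section Optimization

variable {E : Type*} [NormedAddCommGroup E] [InnerProductSpace ℝ E]

/-- `f`, with gradient `g`, lies between its quadratic models of curvatures `μ` and `M`. -/
structure HasQuadraticBounds (f : E → ℝ) (g : E → E) (μ M : ℝ) : Prop where
  lower : ∀ x y, f x + inner ℝ (g x) (y - x) + μ / 2 * ‖y - x‖ ^ 2 ≤ f y
  upper : ∀ x y, f y ≤ f x + inner ℝ (g x) (y - x) + M / 2 * ‖y - x‖ ^ 2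

/-- On the segment from x to y the remainder has derivative at most L‖y - x‖² t in absolute value;
the mean value inequality compares it with the primitive of that bound. -/
theorem abs_sub_linear_le_of_lipschitz_gradient [CompleteSpace E] {f : E → ℝ} {g : E → E} {L : ℝ}
    (hf : ∀ x, HasGradientAt f (g x) x) (hg : ∀ x y, ‖g x - g y‖ ≤ L * ‖x - y‖) (x y : E) :
    |f y - f x - inner ℝ (g x) (y - x)| ≤ L / 2 * ‖y - x‖ ^ 2 := by
  let h : ℝ → ℝ := fun t => f (x + t • (y - x)) - f x - t * inner ℝ (g x) (y - x)
  have hline : ∀ t : ℝ, HasDerivAt (fun t : ℝ => x + t • (y - x)) (y - x) t := by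
    intro t
    simpa using ((hasDerivAt_id t).smul_const (y - x)).const_add x
  have hh : ∀ t : ℝ, HasDerivAt h (inner ℝ (g (x + t • (y - x)) - g x) (y - x)) t := by
    intro t
    have h1 := ((hf (x + t • (y - x))).hasFDerivAt).comp_hasDerivAt t (hline t)
    have h2 := (h1.sub_const (f x)).sub ((hasDerivAt_id t).mul_const (inner ℝ (g x) (y - x)))
    refine h2.congr_deriv ?_
    simp [inner_sub_left]
  have hB : ∀ t : ℝ, HasDerivAt (fun t : ℝ => L / 2 * ‖y - x‖ ^ 2 * t ^ 2)
      (L * ‖y - x‖ ^ 2 * t) t := by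
    intro t
    refine ((hasDerivAt_pow 2 t).const_mul (L / 2 * ‖y - x‖ ^ 2)).congr_deriv ?_
    push_cast
    ring
  have key := image_norm_le_of_norm_deriv_right_le_deriv_boundary (f := h) (a := 0) (b := 1)
    (fun t _ => (hh t).continuousAt.continuousWithinAt) (fun t _ => (hh t).hasDerivWithinAt)
    (B := fun t : ℝ => L / 2 * ‖y - x‖ ^ 2 * t ^ 2) (by simp [h]) hB
    (fun t ht => by
      refine (norm_inner_le_norm _ _).trans ?_
      have h3 := hg (x + t • (y - x)) x
      rw [add_sub_cancel_left, norm_smul, Real.norm_of_nonneg ht.1] at h3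
      nlinarith [norm_nonneg (y - x), mul_le_mul_of_nonneg_right h3 (norm_nonneg (y - x))])
    (Set.right_mem_Icc.2 zero_le_one)
  simpa [h] using key

namespace HasQuadraticBounds

variable {f : E → ℝ} {g : E → E} {μ M : ℝ}

/-- A gradient step of length 1/M lowers f by at least ‖g x‖²/(2M), and it cannot go below m. -/
theorem norm_sq_le (h : HasQuadraticBounds f g μ M) (hM : 0 < M) {m : ℝ} (hm : ∀ x, m ≤ f x)
    (x : E) : ‖g x‖ ^ 2 ≤ 2 * M * (f x - m) := by
  have h1 := h.upper x (x - M⁻¹ • g x)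
  have h2 := hm (x - M⁻¹ • g x)
  rw [show x - M⁻¹ • g x - x = -(M⁻¹ • g x) by abel, norm_neg, inner_neg_right,
    real_inner_smul_right, real_inner_self_eq_norm_sq, norm_smul, mul_pow, Real.norm_eq_abs,
    sq_abs] at h1
  have h3 : M / 2 * (M⁻¹ ^ 2 * ‖g x‖ ^ 2) = M⁻¹ * ‖g x‖ ^ 2 / 2 := by field_simp
  have h4 : M⁻¹ * ‖g x‖ ^ 2 ≤ 2 * (f x - m) := by linarith
  calc ‖g x‖ ^ 2 = M * (M⁻¹ * ‖g x‖ ^ 2) := by field_simp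
    _ ≤ M * (2 * (f x - m)) := by gcongr
    _ = _ := by ring

theorem gradient_eq_zero (h : HasQuadraticBounds f g μ M) (hM : 0 < M) {z : E}
    (hz : ∀ x, f z ≤ f x) : g z = 0 := by
  have := h.norm_sq_le hM hz z
  rw [sub_self, mul_zero] at this
  simpa using le_antisymm this (sq_nonneg _)

theorem le_sub_of_isMin (h : HasQuadraticBounds f g μ M) (hM : 0 < M) {z : E}
    (hz : ∀ x, f z ≤ f x) (x : E) : μ / 2 * ‖x - z‖ ^ 2 ≤ f x - f z := by
  have := h.lower z x
  rw [h.gradient_eq_zero hM hz, inner_zero_left] at this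
  linarith

theorem sub_le_of_isMin (h : HasQuadraticBounds f g μ M) (hM : 0 < M) {z : E}
    (hz : ∀ x, f z ≤ f x) (x : E) : f x - f z ≤ M / 2 * ‖x - z‖ ^ 2 := by
  have := h.upper z x
  rw [h.gradient_eq_zero hM hz, inner_zero_left] at this
  linarith

/-- The quadratic term of the lower model at 0 dominates the linear one once ‖x‖ ≥ 2‖g 0‖/μ, so f ≥
f 0 outside a compact ball. -/
theorem exists_isMin [ProperSpace E] (h : HasQuadraticBounds f g μ M) (hμ : 0 < μ)
    (hf : Continuous f) : ∃ z, ∀ x, f z ≤ f x := by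
  refine hf.exists_forall_le' 0 ?_
  filter_upwards [(tendsto_norm_cocompact_atTop (E := E)).eventually_ge_atTop (2 / μ * ‖g 0‖)]
    with x hx
  have h1 := h.lower 0 x
  rw [sub_zero] at h1
  have h2 : -(‖g 0‖ * ‖x‖) ≤ inner ℝ (g 0) x := (abs_le.1 (abs_real_inner_le_norm _ _)).1
  have h3 : ‖g 0‖ ≤ μ / 2 * ‖x‖ := by
    have := mul_le_mul_of_nonneg_left hx (by positivity : 0 ≤ μ / 2)
    rwa [← mul_assoc, show μ / 2 * (2 / μ) = 1 by field_simp, one_mul] at this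
  nlinarith [mul_le_mul_of_nonneg_right h3 (norm_nonneg x)]

end HasQuadraticBounds

/-! ### One step of the accelerated method at condition number 3 -/

/-- The Lyapunov function of Nesterov's method at condition number `3`: `x` is the iterate and `s`
the momentum. -/
def potential (f : E → ℝ) (L : ℝ) (z x s : E) : ℝ :=
  f x - f z + L / 2 * ‖x - z - ((√3 - 1) / (3 * L)) • s‖ ^ 2

/-- Nesterov's estimate: the lower models at y, evaluated at z and at x, are averaged with weights
1/√3 and 1 - 1/√3. The term -‖g y‖²/(6L) anticipates the decrease along the gradient step from y. -/
theorem HasQuadraticBounds.exact_step {f : E → ℝ} {g : E → E} {L : ℝ}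
    (h : HasQuadraticBounds f g L (3 * L)) (hL : 0 < L) (z x s : E) {y : E}
    (hy : y = x - ((2 - √3) / (3 * L)) • s) :
    f y - f z - 1 / (6 * L) * ‖g y‖ ^ 2 +
      L / 2 * ‖x - z - (√3 / (3 * L)) • ((2 - √3) • s + g y)‖ ^ 2 ≤
      (1 - √3 / 3) * potential f L z x s := by
  have hs : √3 ^ 2 = 3 := Real.sq_sqrt (by norm_num)
  have hs1 : √3 ≤ 2 := by nlinarith [Real.sqrt_nonneg 3]
  have hs0 := Real.sqrt_nonneg 3
  have h1 := h.lower y z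
  have h2 := h.lower y x
  set γ := g y
  obtain ⟨a, rfl⟩ : ∃ a, x = z + a := ⟨x - z, by abel⟩
  -- Measuring momentum and gradient in units of 3L removes the denominators, so that the claim
  -- becomes polynomial in √3 and the inner products.
  obtain ⟨p, rfl⟩ : ∃ p, s = (3 * L) • p := ⟨(3 * L)⁻¹ • s, by rw [smul_smul]; field_simp; simp⟩
  obtain ⟨c, hc⟩ : ∃ c, γ = (3 * L) • c := ⟨(3 * L)⁻¹ • γ, by rw [smul_smul]; field_simp; simp⟩
  have hy' : y = z + a - (2 - √3) • p := by
    rw [hy, smul_smul, div_mul_cancel₀ _ (by positivity)]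
  have e1 : z - y = (2 - √3) • p - a := by rw [hy']; abel
  have e2 : z + a - y = (2 - √3) • p := by rw [hy']; abel
  have e3 : z + a - z - (√3 / (3 * L)) • ((2 - √3) • (3 * L) • p + γ)
      = a - (2 * √3 - 3) • p - √3 • c := by
    rw [hc, smul_add, smul_smul, smul_smul, smul_smul, add_sub_cancel_left, ← sub_sub]
    congr 2
    · congr 1; field_simp; linarith
    · field_simp
  have e4 : z + a - z - ((√3 - 1) / (3 * L)) • (3 * L) • p = a - (√3 - 1) • p := by
    rw [smul_smul, div_mul_cancel₀ _ (by positivity), add_sub_cancel_left]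
  rw [potential, e3, e4]
  rw [e1] at h1
  rw [e2] at h2
  rw [hc] at h1 h2 ⊢
  simp only [@norm_sub_sq_real E, inner_sub_left, inner_sub_right, real_inner_smul_left,
    real_inner_smul_right, norm_smul, mul_pow, Real.norm_eq_abs, sq_abs] at h1 h2 ⊢
  rw [real_inner_comm a p] at h1
  rw [real_inner_comm c a, real_inner_comm c p]
  generalize √3 = r at *
  generalize inner ℝ a p = ap at *
  generalize inner ℝ c p = cp at *
  generalize inner ℝ c a = ca at *
  generalize f (z + a) = F at *
  generalize f z = Z at *
  generalize f y = Y at *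
  have hP := sq_nonneg ‖p‖
  generalize ‖p‖ ^ 2 = P at *
  generalize ‖a‖ ^ 2 = A at *
  generalize ‖c‖ ^ 2 = G at *
  have h3 := mul_le_mul_of_nonneg_left h1 (show 0 ≤ r / 3 by positivity)
  have h4 := mul_le_mul_of_nonneg_left h2 (show 0 ≤ 1 - r / 3 by linarith)
  have h5 : 1 / (6 * L) * (3 ^ 2 * L ^ 2 * G) = 3 * L / 2 * G := by field_simp; ring
  -- The slack left by the weighted combination; it is nonnegative exactly because √3 ≥ 12/7.
  have h6 : 0 ≤ (14 / 3 * r - 8) * (L * P) := by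
    have : 12 / 7 ≤ r := by nlinarith
    exact mul_nonneg (by linarith) (by positivity)
  have hm : ∀ t : ℝ, r ^ 2 * t = 3 * t := fun t => by rw [hs]
  rw [h5]
  linarith [hm (L * P), hm (r * (L * P)), hm (L * ap), hm (L * G), hm (L * cp), hm (r * (L * cp)),
    hm (L * ca), hm (L * A)]

/-- The error e = v - g y enters twice: through the function value, with coefficient 1/(6L), and
through the distance term, with 1/(2L) after Young's inequality. -/
theorem HasQuadraticBounds.inexact_step {f : E → ℝ} {g : E → E} {L : ℝ}
    (h : HasQuadraticBounds f g L (3 * L)) (hL : 0 < L) {z : E} (hz : ∀ x, f z ≤ f x)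
    (x s v : E) {y : E} (hy : y = x - ((2 - √3) / (3 * L)) • s) :
    potential f L z (y - (1 / (3 * L)) • v) ((2 - √3) • s + v) ≤
      7 / 10 * potential f L z x s + 2 / (3 * L) * ‖v - g y‖ ^ 2 := by
  have hs : √3 ^ 2 = 3 := Real.sq_sqrt (by norm_num)
  have hs0 := Real.sqrt_nonneg 3
  have hs1 : 8 / 5 ≤ √3 := by nlinarith
  have h1 := h.exact_step hL z x s hy
  have h2 := h.upper y (y - (1 / (3 * L)) • v)
  have h3 := h.norm_sq_le (by positivity) hz y
  have h4 : 0 ≤ potential f L z x s :=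
    add_nonneg (sub_nonneg.2 (hz x)) (by positivity)
  obtain ⟨e, rfl⟩ : ∃ e, v = g y + e := ⟨v - g y, by abel⟩
  set γ := g y
  have e1 : y - (1 / (3 * L)) • (γ + e) - z - ((√3 - 1) / (3 * L)) • ((2 - √3) • s + (γ + e))
      = (x - z - (√3 / (3 * L)) • ((2 - √3) • s + γ)) - (√3 / (3 * L)) • e := by
    rw [hy]
    module
  -- Parameter 1/2: factor 3/2 on the exact part, factor 3 on the error.
  have h5 := norm_sub_sq_le_add_mul (show (0 : ℝ) < 1 / 2 by norm_num)
    (x - z - (√3 / (3 * L)) • ((2 - √3) • s + γ)) ((√3 / (3 * L)) • e)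
  rw [potential, e1]
  set w := x - z - (√3 / (3 * L)) • ((2 - √3) • s + γ)
  rw [sub_sub_cancel_left, norm_neg, inner_neg_right, real_inner_smul_right, norm_smul, mul_pow,
    Real.norm_eq_abs, sq_abs, @norm_add_sq_real E, inner_add_right,
    real_inner_self_eq_norm_sq] at h2
  rw [norm_smul, mul_pow _ ‖e‖, Real.norm_eq_abs, sq_abs, div_pow, hs] at h5
  rw [add_sub_cancel_left]
  generalize potential f L z x s = Φ at *
  -- With step length exactly 1/(3L) the cross term between γ and e cancels.
  have h6 : f (y - (1 / (3 * L)) • (γ + e)) ≤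
      f y - 1 / (6 * L) * ‖γ‖ ^ 2 + 1 / (6 * L) * ‖e‖ ^ 2 := by
    refine h2.trans (le_of_eq ?_)
    field_simp
    ring
  have h7 : L / 2 * ‖w - (√3 / (3 * L)) • e‖ ^ 2 ≤
      3 / 2 * (L / 2 * ‖w‖ ^ 2) + 1 / (2 * L) * ‖e‖ ^ 2 := by
    refine (mul_le_mul_of_nonneg_left h5 (by positivity)).trans (le_of_eq ?_)
    field_simp
    ring
  -- This makes the function part of `exact_step` nonnegative, so it too may be multiplied by 3/2.
  have h8 : 1 / (6 * L) * ‖γ‖ ^ 2 ≤ f y - f z := by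
    refine (mul_le_mul_of_nonneg_left h3 (by positivity)).trans (le_of_eq ?_)
    field_simp
    ring
  have h9 : 1 / (6 * L) * ‖e‖ ^ 2 + 1 / (2 * L) * ‖e‖ ^ 2 = 2 / (3 * L) * ‖e‖ ^ 2 := by
    field_simp
    ring
  -- The bound √3 ≥ 8/5 says precisely that (3/2)(1 - √3/3) ≤ 7/10.
  have h10 : √3 * Φ ≥ 8 / 5 * Φ := mul_le_mul_of_nonneg_right hs1 h4
  linarith

/-- Here the query point is x itself rather than x - ((2 - √3)/(3L)) s, so `inexact_step` does not
apply: the move is roughly 3 - √3 times a gradient step. It is estimated directly, with weights on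
the two errors matching one further contraction by 7/10 of the initialization error. -/
theorem HasQuadraticBounds.first_step {f : E → ℝ} {g : E → E} {L : ℝ}
    (h : HasQuadraticBounds f g L (3 * L)) (hL : 0 < L) {z : E} (hz : ∀ x, f z ≤ f x)
    (x s v : E) :
    potential f L z (x - (1 / (3 * L)) • ((2 - √3) • s + v)) ((2 - √3) • s + v) ≤
      7 / 10 * (9 / 5 * (f x - f z) + L / 4 * ‖x - z‖ ^ 2) +
        7 / (3 * L) * (7 / 10 * ‖s - g x‖ ^ 2 + ‖v - g x‖ ^ 2) := by
  have hs : √3 ^ 2 = 3 := Real.sq_sqrt (by norm_num)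
  have hs0 := Real.sqrt_nonneg 3
  have hs1 : 1732 / 1000 ≤ √3 := by nlinarith
  have hs2 : √3 ≤ 1733 / 1000 := by nlinarith
  set γ := g x with hγ
  have h1 := h.upper x (x - (1 / (3 * L)) • ((2 - √3) • s + v))
  have h2 := h.norm_sq_le (by positivity) hz x
  have h3 := h.lower x z
  obtain ⟨e, rfl⟩ : ∃ e, v = γ + e := ⟨v - γ, by abel⟩
  obtain ⟨d, rfl⟩ : ∃ d, s = γ + d := ⟨s - γ, by abel⟩
  obtain ⟨a, rfl⟩ : ∃ a, x = z + a := ⟨x - z, by abel⟩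
  set u := (2 - √3) • d + e with hu
  have e1 : (2 - √3) • (γ + d) + (γ + e) = (3 - √3) • γ + u := by rw [hu]; module
  have e2 : z + a - (1 / (3 * L)) • ((3 - √3) • γ + u) - z - ((√3 - 1) / (3 * L)) •
      ((3 - √3) • γ + u) = (a - (√3 * (3 - √3) / (3 * L)) • γ) - (√3 / (3 * L)) • u := by
    module
  rw [e1] at h1 ⊢
  rw [potential, e2]
  have h4 := norm_sub_sq_le_add_mul (show (0 : ℝ) < 1 / 4 by norm_num)
    (a - (√3 * (3 - √3) / (3 * L)) • γ) ((√3 / (3 * L)) • u)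
  have e3 : √3 * (3 - √3) / (3 * L) = (√3 - 1) / L := by
    field_simp; linarith
  rw [e3] at h4 ⊢
  have h5 : ‖a - ((√3 - 1) / L) • γ‖ ^ 2 =
      ‖a‖ ^ 2 - 2 * ((√3 - 1) / L) * inner ℝ γ a + (4 - 2 * √3) / L ^ 2 * ‖γ‖ ^ 2 := by
    rw [norm_sub_sq_real, inner_smul_right, norm_smul, mul_pow, Real.norm_eq_abs, sq_abs,
      real_inner_comm, div_pow, show (√3 - 1) ^ 2 = 4 - 2 * √3 by linarith]
    ring
  rw [h5, norm_smul, mul_pow _ ‖u‖, Real.norm_eq_abs, sq_abs, div_pow, hs] at h4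
  have e4 : z - (z + a) = -a := by abel
  rw [← hγ, e4, inner_neg_right, norm_neg] at h3
  have h6 : f (z + a - (1 / (3 * L)) • ((3 - √3) • γ + u)) ≤
      f (z + a) - 1 / (6 * L) * ‖γ‖ ^ 2 + 1 / (6 * L) * ‖(2 - √3) • γ + u‖ ^ 2 := by
    rw [← hγ] at h1
    refine h1.trans (le_of_eq ?_)
    rw [sub_sub_cancel_left, norm_neg, inner_neg_right, real_inner_smul_right, norm_smul, mul_pow,
      Real.norm_eq_abs, sq_abs, norm_add_sq_real ((3 - √3) • γ) u, norm_add_sq_real ((2 - √3) • γ) u,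
      inner_add_right, inner_smul_right, inner_smul_left, inner_smul_left, norm_smul, norm_smul, mul_pow,
      mul_pow, Real.norm_eq_abs, Real.norm_eq_abs, sq_abs, sq_abs, real_inner_self_eq_norm_sq]
    simp only [conj_trivial]
    field_simp
    ring
  have h7 := norm_add_sq_le_two_mul ((2 - √3) • γ) u
  have h8 := norm_add_sq_le_two_mul ((2 - √3) • d) e
  have e5 : (2 - √3) ^ 2 = 7 - 4 * √3 := by linarith
  rw [norm_smul, mul_pow, Real.norm_eq_abs, sq_abs, e5] at h7 h8
  rw [← hu] at h8
  rw [add_sub_cancel_left, add_sub_cancel_left, add_sub_cancel_left]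
  have hG : 1 / (6 * L) * ‖γ‖ ^ 2 ≤ f (z + a) - f z := by
    refine (mul_le_mul_of_nonneg_left h2 (by positivity)).trans (le_of_eq ?_)
    field_simp
    ring
  have hw : L / 2 * ‖a - ((√3 - 1) / L) • γ - (√3 / (3 * L)) • u‖ ^ 2 ≤
      5 / 4 * (L / 2 * ‖a‖ ^ 2) - 5 / 4 * (√3 - 1) * inner ℝ γ a +
        5 / 4 * (12 - 6 * √3) * (1 / (6 * L) * ‖γ‖ ^ 2) + 5 / 6 * (‖u‖ ^ 2 / L) := by
    refine (mul_le_mul_of_nonneg_left h4 (by positivity)).trans (le_of_eq ?_)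
    field_simp
    ring
  have hf := mul_le_mul_of_nonneg_left h7 (show 0 ≤ 1 / (6 * L) by positivity)
  have hU : ‖u‖ ^ 2 / L ≤ 2 * (7 - 4 * √3) * (‖d‖ ^ 2 / L) + 2 * (‖e‖ ^ 2 / L) := by
    refine (div_le_div_of_nonneg_right h8 hL.le).trans (le_of_eq ?_)
    field_simp
  have hf2 : 1 / (6 * L) * (2 * ((7 - 4 * √3) * ‖γ‖ ^ 2) + 2 * ‖u‖ ^ 2) =
      2 * (7 - 4 * √3) * (1 / (6 * L) * ‖γ‖ ^ 2) + 1 / 3 * (‖u‖ ^ 2 / L) := by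
    field_simp
    ring
  have hN : 7 / (3 * L) * (7 / 10 * ‖d‖ ^ 2 + ‖e‖ ^ 2) =
      49 / 30 * (‖d‖ ^ 2 / L) + 7 / 3 * (‖e‖ ^ 2 / L) := by
    field_simp
    ring
  rw [hN]
  -- The lower model at x, evaluated at z, bounds ⟨γ, a⟩ below by the gap plus L‖a‖²/2. This offsets
  -- the growth of the function value and of the distance.
  have h9 := mul_le_mul_of_nonneg_left h3 (show 0 ≤ 5 / 4 * (√3 - 1) by linarith)
  have hd : 0 ≤ ‖d‖ ^ 2 / L := by positivity
  have he : 0 ≤ ‖e‖ ^ 2 / L := by positivity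
  have ha : 0 ≤ L * ‖a‖ ^ 2 := by positivity
  have hG0 : 0 ≤ 1 / (6 * L) * ‖γ‖ ^ 2 := by positivity
  have hgap : 0 ≤ f (z + a) - f z := sub_nonneg.2 (hz _)
  rw [hf2] at hf
  generalize 1 / (6 * L) * ‖γ‖ ^ 2 = G at *
  generalize ‖d‖ ^ 2 / L = D at *
  generalize ‖e‖ ^ 2 / L = V at *
  generalize ‖u‖ ^ 2 / L = U at *
  have c1 := mul_le_mul_of_nonneg_right hs1 hd
  have c2 := mul_le_mul_of_nonneg_right hs1 ha
  -- The net coefficient of ‖γ‖²/(6L) is 28 - (31/2)√3, which is positive, so this term has to be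
  -- charged to the gap.
  have c3 := mul_le_mul_of_nonneg_left hG (show 0 ≤ 28 - 31 / 2 * √3 by linarith)
  have c4 := mul_le_mul_of_nonneg_right hs1 hgap
  linarith

end Optimization

/-! ### Honest averages, the objective and the proximal subproblem -/

theorem honestMean_add_const {V : Type*} [AddCommGroup V] [Module ℝ V] {H : Finset (Fin n)}
    (hH : 0 < (H.card : ℝ)) (w : Fin n → V) (v : V) :
    honestMean H (fun i => w i + v) = honestMean H w + v := by
  rw [honestMean, honestMean, Finset.sum_add_distrib, smul_add, Finset.sum_const,
    ← Nat.cast_smul_eq_nsmul ℝ, smul_smul, inv_mul_cancel₀ hH.ne', one_smul]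

theorem honestMean_congr {V : Type*} [AddCommGroup V] [Module ℝ V] {H : Finset (Fin n)}
    {w w' : Fin n → V} (h : ∀ i ∈ H, w i = w' i) : honestMean H w = honestMean H w' := by
  rw [honestMean, honestMean, Finset.sum_congr rfl h]

theorem honestMean_sub {V : Type*} [AddCommGroup V] [Module ℝ V] {H : Finset (Fin n)}
    (w w' : Fin n → V) :
    honestMean H (fun i => w i - w' i) = honestMean H w - honestMean H w' := by
  rw [honestMean, honestMean, honestMean, Finset.sum_sub_distrib, smul_sub]

theorem norm_honestMean_le {V : Type*} [NormedAddCommGroup V] [NormedSpace ℝ V]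
    {H : Finset (Fin n)} (hH : 0 < (H.card : ℝ)) {w : Fin n → V} {C : ℝ}
    (h : ∀ i ∈ H, ‖w i‖ ≤ C) : ‖honestMean H w‖ ≤ C := by
  rw [honestMean, norm_smul, norm_inv, Real.norm_of_nonneg hH.le, inv_mul_le_iff₀ hH]
  calc ‖∑ i ∈ H, w i‖ ≤ ∑ i ∈ H, ‖w i‖ := norm_sum_le _ _
    _ ≤ ∑ _i ∈ H, C := Finset.sum_le_sum h
    _ = H.card * C := by simp

namespace Problem

variable {p : Problem n d q} {L ζ σ : ℝ}

theorem IsSmoothHeterogeneous.hasGradientAt (h : p.IsSmoothHeterogeneous L ζ) (x : Vec d) :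
    HasGradientAt p.obj (∇ p.obj x) x :=
  (h.contDiff_obj.differentiable one_ne_zero x).hasGradientAt

theorem IsSmoothHeterogeneous.gradient_obj (h : p.IsSmoothHeterogeneous L ζ) (x : Vec d) :
    ∇ p.obj x = honestMean p.H (fun i => ∇ (p.localObj i) x) := by
  refine HasGradientAt.gradient ?_
  rw [hasGradientAt_iff_hasFDerivAt]
  have h1 := (HasFDerivAt.fun_sum fun i hi =>
    ((h.differentiable i hi x).hasGradientAt).hasFDerivAt).const_smul ((p.H.card : ℝ)⁻¹)
  refine h1.congr_fderiv ?_
  simp [honestMean]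

theorem IsSmoothHeterogeneous.lipschitz_gradient (h : p.IsSmoothHeterogeneous L ζ)
    (hH : 0 < (p.H.card : ℝ)) (x y : Vec d) : ‖∇ p.obj x - ∇ p.obj y‖ ≤ L * ‖x - y‖ := by
  rw [h.gradient_obj, h.gradient_obj, ← honestMean_sub]
  exact norm_honestMean_le hH fun i hi => h.smooth i hi x y

theorem IsSmoothHeterogeneous.continuous_gradient (h : p.IsSmoothHeterogeneous L ζ)
    (hL : 0 < L) (hH : 0 < (p.H.card : ℝ)) : Continuous (∇ p.obj) :=
  (LipschitzWith.of_dist_le_mul (K := ⟨L, hL.le⟩) fun x y => by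
    rw [dist_eq_norm, dist_eq_norm]; exact h.lipschitz_gradient hH x y).continuous

theorem IsSmoothHeterogeneous.bddBelow_obj (h : p.IsSmoothHeterogeneous L ζ) :
    BddBelow (Set.range p.obj) := by
  choose! b hb using h.bddBelow
  refine ⟨(p.H.card : ℝ)⁻¹ * ∑ i ∈ p.H, b i, ?_⟩
  rintro _ ⟨x, rfl⟩
  rw [obj, honestMean, smul_eq_mul]
  gcongr with i hi
  exact hb i hi ⟨x, rfl⟩

/-- The objective of the proximal subproblem centred at `c`. -/
def proxObj (p : Problem n d q) (L : ℝ) (c z : Vec d) : ℝ := p.obj z + L * ‖z - c‖ ^ 2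

/-- The gradient of `proxObj`. -/
def proxGrad (p : Problem n d q) (L : ℝ) (c z : Vec d) : Vec d := ∇ p.obj z + (2 * L) • (z - c)

/-- The penalty does not depend on the sample, so against a probability measure it integrates to
itself. -/
theorem surrogate_obj (hD : ∀ i ∈ p.H, IsProbabilityMeasure (p.D i)) (hO : p.IsUnbiasedOracle σ)
    (hH : 0 < (p.H.card : ℝ)) (L : ℝ) (c : Vec d) : (p.surrogate L c).obj = p.proxObj L c := by
  funext z
  rw [obj, proxObj, obj, ← honestMean_add_const hH]
  refine honestMean_congr fun i hi => ?_
  have := hD i hi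
  have h1 := integral_add (hO.integrable i hi z) (integrable_const (μ := p.D i) (L * ‖z - c‖ ^ 2))
  rw [integral_const, probReal_univ, one_smul] at h1
  exact h1

/-- The penalty has curvature exactly 2L in every direction, which shifts the bounds -L and L of the
objective. -/
theorem IsSmoothHeterogeneous.hasQuadraticBounds_proxObj (h : p.IsSmoothHeterogeneous L ζ)
    (hH : 0 < (p.H.card : ℝ)) (c : Vec d) :
    HasQuadraticBounds (p.proxObj L c) (p.proxGrad L c) L (3 * L) := by
  have key : ∀ x y : Vec d, L * ‖y - c‖ ^ 2 =
      L * ‖x - c‖ ^ 2 + inner ℝ ((2 * L) • (x - c)) (y - x) + L * ‖y - x‖ ^ 2 := by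
    intro x y
    rw [show y - c = (x - c) + (y - x) by abel, norm_add_sq_real, real_inner_smul_left]
    ring
  constructor <;> intro x y <;>
    have h1 := abs_le.1 (abs_sub_linear_le_of_lipschitz_gradient h.hasGradientAt
      (h.lipschitz_gradient hH) x y) <;>
    rw [proxObj, proxObj, proxGrad, inner_add_left] <;> linarith [key x y]

theorem IsSmoothHeterogeneous.continuous_proxObj (h : p.IsSmoothHeterogeneous L ζ) :
    Continuous fun v : Vec d × Vec d => p.proxObj L v.1 v.2 := by
  have := h.contDiff_obj.continuous
  unfold proxObj
  fun_prop

end Problem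

/-! ### The mini-batch gradients -/

theorem gradient_add_mul_norm_sub_sq {f : Vec d → ℝ} {y : Vec d} (hf : DifferentiableAt ℝ f y)
    (L : ℝ) (c : Vec d) :
    ∇ (fun z => f z + L * ‖z - c‖ ^ 2) y = ∇ f y + (2 * L) • (y - c) := by
  refine HasGradientAt.gradient ?_
  rw [hasGradientAt_iff_hasFDerivAt]
  have h1 := (((hasFDerivAt_id y).sub_const c).norm_sq).const_mul L
  refine (hf.hasGradientAt.hasFDerivAt.add h1).congr_fderiv ?_
  ext v
  simp
  ring

/-- The penalty gradient is the same for every sample and every node. Positivity of the batch size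
matters: an empty batch averages to 0. -/
theorem miniBatch_surrogate {p : Problem n d q} {σ : ℝ} (hO : p.IsUnbiasedOracle σ) (L : ℝ)
    (c : Vec d) {m : ℕ} (hm : 0 < m) (ξ : ℕ → Vec q) (y : Vec d) :
    miniBatch (p.surrogate L c).F m ξ y = miniBatch p.F m ξ y + (2 * L) • (y - c) := by
  have hm' : (m : ℝ) ≠ 0 := by positivity
  have : ∀ l, ∇ (fun z => (p.surrogate L c).F z (ξ l)) y =
      ∇ (fun z => p.F z (ξ l)) y + (2 * L) • (y - c) := fun l =>
    gradient_add_mul_norm_sub_sq ((hO.contDiff (ξ l)).differentiable one_ne_zero y) L c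
  simp only [miniBatch, this, Finset.sum_add_distrib, Finset.sum_const, Finset.card_range, smul_add]
  rw [← Nat.cast_smul_eq_nsmul ℝ, smul_smul, inv_mul_cancel₀ hm', one_smul]

/-- A bound, in terms of the honest samples alone, on the squared error of the aggregated mini-batch
gradient; `τ` stands for `ρδ`. -/
def batchError (p : Problem n d q) (τ : ℝ) (m : ℕ) (ξ : Fin n → ℕ → Vec q) (y : Vec d) : ℝ :=
  2 * (τ / p.H.card * ∑ i ∈ p.H, ‖miniBatch p.F m (ξ i) y -
      honestMean p.H (fun j => miniBatch p.F m (ξ j) y)‖ ^ 2) +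
    2 * ‖honestMean p.H (fun j => miniBatch p.F m (ξ j) y) - ∇ p.obj y‖ ^ 2

theorem batchError_nonneg (p : Problem n d q) {τ : ℝ} (hτ : 0 ≤ τ) (m : ℕ)
    (ξ : Fin n → ℕ → Vec q) (y : Vec d) : 0 ≤ batchError p τ m ξ y := by
  unfold batchError
  positivity

/-- The shift common to all honest nodes cancels both in the spread of the messages and in the error
of their mean. The bound is therefore free of the centre and of the Byzantine messages. -/
theorem norm_aggregate_sub_proxGrad_sq_le {p : Problem n d q} {σ ρ δ : ℝ}
    (hO : p.IsUnbiasedOracle σ) (hH : 0 < (p.H.card : ℝ)) {A : (Fin n → Vec d) → Vec d}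
    (hA : IsRobustAggregator p.H δ ρ A) (L : ℝ) (c : Vec d) {m : ℕ} (hm : 0 < m)
    (ξ : Fin n → ℕ → Vec q) (y : Vec d) {w : Fin n → Vec d}
    (hw : ∀ i ∈ p.H, w i = miniBatch (p.surrogate L c).F m (ξ i) y) :
    ‖A w - p.proxGrad L c y‖ ^ 2 ≤ batchError p (ρ * δ) m ξ y := by
  have hw' : ∀ i ∈ p.H, w i = miniBatch p.F m (ξ i) y + (2 * L) • (y - c) := fun i hi => by
    rw [hw i hi, miniBatch_surrogate hO L c hm]
  have hmean : honestMean p.H w =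
      honestMean p.H (fun j => miniBatch p.F m (ξ j) y) + (2 * L) • (y - c) := by
    rw [honestMean_congr hw', honestMean_add_const hH]
  have h1 := hA w
  have h2 := norm_add_sq_le_two_mul (A w - honestMean p.H w)
    (honestMean p.H w - p.proxGrad L c y)
  rw [sub_add_sub_cancel] at h2
  have h3 : honestMean p.H w - p.proxGrad L c y =
      honestMean p.H (fun j => miniBatch p.F m (ξ j) y) - ∇ p.obj y := by
    rw [hmean, Problem.proxGrad, add_sub_add_right_eq_sub]
  have h4 : ∑ i ∈ p.H, ‖w i - honestMean p.H w‖ ^ 2 =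
      ∑ i ∈ p.H, ‖miniBatch p.F m (ξ i) y -
        honestMean p.H (fun j => miniBatch p.F m (ξ j) y)‖ ^ 2 := by
    refine Finset.sum_congr rfl fun i hi => ?_
    rw [hmean, hw' i hi, add_sub_add_right_eq_sub]
  rw [h3] at h2
  rw [h4] at h1
  unfold batchError
  linarith

/-! ### One run of Byrd-Nester on a proximal subproblem -/

/-- The parameters of Byrd-Nester for a `3L`-smooth, `L`-strongly convex objective. -/
def proxStep (L : ℝ) : StepParams :=
  { α := 0, β := (√3 - 1) / (√3 + 1), θ := 1, η := 1 / (3 * L) }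

theorem sqrt_three_sub_one_div : (√3 - 1) / (√3 + 1) = 2 - √3 := by
  have hs : √3 ^ 2 = 3 := Real.sq_sqrt (by norm_num)
  have hs0 := Real.sqrt_nonneg 3
  rw [div_eq_iff (by positivity)]
  linarith

/-- The gradient messages of iteration `t + 1` of Byrd-Nester. -/
def gradMessages (p : Problem n d q) (A : (Fin n → Vec d) → Vec d) (c : StepParams) (m₀ m : ℕ)
    (ξ : ℕ → Fin n → ℕ → Vec q) (bG bS : ℕ → Fin n → Vec d) (x₀ : Vec d) (t : ℕ) : Fin n → Vec d :=
  fun i => if i ∈ p.H then miniBatch p.F m (ξ (t + 1) i) (byrdNester p A c m₀ m ξ bG bS x₀ t).y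
    else bG (t + 1) i

section Run

variable (p : Problem n d q) (A : (Fin n → Vec d) → Vec d) (L : ℝ) (m₀ m : ℕ)
  (ξ : ℕ → Fin n → ℕ → Vec q) (bG bS : ℕ → Fin n → Vec d) (x₀ : Vec d)

/-- Since α = 0, the aggregate of the messages `s` is multiplied by 0; these messages matter only in
the initialization. -/
theorem byrdNester_sHat_succ (t : ℕ) :
    (byrdNester p A (proxStep L) m₀ m ξ bG bS x₀ (t + 1)).sHat =
      (2 - √3) • (byrdNester p A (proxStep L) m₀ m ξ bG bS x₀ t).sHat +
        A (gradMessages p A (proxStep L) m₀ m ξ bG bS x₀ t) := by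
  rw [byrdNester]
  simp only [proxStep, sqrt_three_sub_one_div, sub_zero, one_smul, zero_smul, add_zero]
  rfl

theorem byrdNester_x_succ (t : ℕ) :
    (byrdNester p A (proxStep L) m₀ m ξ bG bS x₀ (t + 1)).x =
      (byrdNester p A (proxStep L) m₀ m ξ bG bS x₀ t).x -
        (1 / (3 * L)) • (byrdNester p A (proxStep L) m₀ m ξ bG bS x₀ (t + 1)).sHat := rfl

/-- This puts the query point in the form required by `inexact_step`. It is available only after the
first iteration, since y⁰ = x⁰ regardless of ŝ⁰. -/
theorem byrdNester_y_succ (t : ℕ) :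
    (byrdNester p A (proxStep L) m₀ m ξ bG bS x₀ (t + 1)).y =
      (byrdNester p A (proxStep L) m₀ m ξ bG bS x₀ (t + 1)).x -
        ((2 - √3) / (3 * L)) • (byrdNester p A (proxStep L) m₀ m ξ bG bS x₀ (t + 1)).sHat := by
  have : (byrdNester p A (proxStep L) m₀ m ξ bG bS x₀ (t + 1)).y =
      (byrdNester p A (proxStep L) m₀ m ξ bG bS x₀ (t + 1)).x + (proxStep L).β •
        ((byrdNester p A (proxStep L) m₀ m ξ bG bS x₀ (t + 1)).x -
          (byrdNester p A (proxStep L) m₀ m ξ bG bS x₀ t).x) := rfl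
  rw [this, show (proxStep L).β = 2 - √3 from sqrt_three_sub_one_div]
  nth_rw 2 [byrdNester_x_succ]
  rw [sub_sub_cancel_left, smul_neg, smul_smul, ← sub_eq_add_neg, mul_one_div]

theorem byrdNester_queries (c : StepParams) (t : ℕ) :
    (byrdNester p A c m₀ m ξ bG bS x₀ t).queries = m₀ + m * t := by
  induction t with
  | zero => rfl
  | succ t ih =>
    change (byrdNester p A c m₀ m ξ bG bS x₀ t).queries + m = _
    rw [ih]
    ring

end Run

/-- The accumulated error of `T` iterations of Byrd-Nester with batch size `m`. -/
def runError (p : Problem n d q) (τ L : ℝ) (A : (Fin n → Vec d) → Vec d) (m : ℕ)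
    (ξ : ℕ → Fin n → ℕ → Vec q) (bG bS : ℕ → Fin n → Vec d) (c x₀ : Vec d) (T : ℕ) : ℝ :=
  ∑ t ∈ Finset.range (T + 1), (7 / 10) ^ (T - t) * batchError p τ m (ξ t)
    (byrdNester (p.surrogate L c) A (proxStep L) m m ξ bG bS x₀ (t - 1)).y

theorem sum_range_pow_sub_mul_succ (r : ℝ) (b : ℕ → ℝ) (T : ℕ) :
    ∑ t ∈ Finset.range (T + 1 + 1), r ^ (T + 1 - t) * b t =
      r * ∑ t ∈ Finset.range (T + 1), r ^ (T - t) * b t + b (T + 1) := by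
  rw [Finset.sum_range_succ, Nat.sub_self, pow_zero, one_mul, Finset.mul_sum]
  congr 1
  refine Finset.sum_congr rfl fun t ht => ?_
  rw [Nat.succ_sub (Nat.lt_succ_iff.1 (Finset.mem_range.1 ht)), pow_succ']
  ring

/-- A pathwise bound, valid for every realization of samples and Byzantine messages; probability
enters only through `runError`. -/
theorem byrdNester_gap_le {p : Problem n d q} {L ζ σ ρ δ : ℝ} (hL : 0 < L) (hτ : 0 ≤ ρ * δ)
    (h : p.IsSmoothHeterogeneous L ζ) (hO : p.IsUnbiasedOracle σ) (hH : 0 < (p.H.card : ℝ))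
    {A : (Fin n → Vec d) → Vec d} (hA : IsRobustAggregator p.H δ ρ A) {m : ℕ} (hm : 0 < m)
    (ξ : ℕ → Fin n → ℕ → Vec q) (bG bS : ℕ → Fin n → Vec d) {c z : Vec d}
    (hz : ∀ x, p.proxObj L c z ≤ p.proxObj L c x) (x₀ : Vec d) (T : ℕ) :
    p.proxObj L c (byrdNester (p.surrogate L c) A (proxStep L) m m ξ bG bS x₀ T).x
        - p.proxObj L c z ≤
      (7 / 10) ^ T * (9 / 5 * (p.proxObj L c x₀ - p.proxObj L c z) + L / 4 * ‖x₀ - z‖ ^ 2) +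
        7 / (3 * L) * runError p (ρ * δ) L A m ξ bG bS c x₀ T := by
  have hq := h.hasQuadraticBounds_proxObj hH c
  set f := p.proxObj L c
  set st := byrdNester (p.surrogate L c) A (proxStep L) m m ξ bG bS x₀ with hst
  have hG : ∀ t, ‖A (gradMessages (p.surrogate L c) A (proxStep L) m m ξ bG bS x₀ t) -
      p.proxGrad L c (st t).y‖ ^ 2 ≤ batchError p (ρ * δ) m (ξ (t + 1)) (st t).y := fun t =>
    norm_aggregate_sub_proxGrad_sq_le hO hH hA L c hm _ _ fun i hi => if_pos hi
  rcases T with _ | T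
  · have h1 : 0 ≤ f x₀ - f z := sub_nonneg.2 (hz x₀)
    have h2 : 0 ≤ runError p (ρ * δ) L A m ξ bG bS c x₀ 0 :=
      Finset.sum_nonneg fun t _ => mul_nonneg (by positivity) (batchError_nonneg p hτ _ _ _)
    have h3 : 0 ≤ 7 / (3 * L) * runError p (ρ * δ) L A m ξ bG bS c x₀ 0 := by positivity
    have h4 : 0 ≤ L / 4 * ‖x₀ - z‖ ^ 2 := by positivity
    change f x₀ - f z ≤ _
    rw [pow_zero]
    linarith
  -- The induction needs the whole potential; the gap is only its first summand.
  · refine le_trans (b := potential f L z (st (T + 1)).x (st (T + 1)).sHat)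
      (le_add_of_nonneg_right (by positivity)) ?_
    induction T with
    | zero =>
      rw [hst, byrdNester_x_succ, byrdNester_sHat_succ]
      refine (hq.first_step hL hz x₀ _ _).trans ?_
      have h0 : ‖(st 0).sHat - p.proxGrad L c x₀‖ ^ 2 ≤ batchError p (ρ * δ) m (ξ 0) x₀ :=
        norm_aggregate_sub_proxGrad_sq_le hO hH hA L c hm _ _ fun i hi => if_pos hi
      have h1 := hG 0
      -- By truncated subtraction the query index is 0 for both t = 0 and t = 1: the initialization
      -- and the first iteration both query x₀.
      have h2 : runError p (ρ * δ) L A m ξ bG bS c x₀ (0 + 1) =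
          7 / 10 * batchError p (ρ * δ) m (ξ 0) x₀ + batchError p (ρ * δ) m (ξ 1) x₀ := by
        simp [runError, Finset.sum_range_succ, byrdNester]
      rw [h2, zero_add, pow_one]
      gcongr
      exact h1
    | succ T ih =>
      have e1 : (st (T + 1 + 1)).x = _ := byrdNester_x_succ (p.surrogate L c) A L m m ξ bG bS x₀ (T + 1)
      have e2 : (st (T + 1 + 1)).sHat = _ := byrdNester_sHat_succ (p.surrogate L c) A L m m ξ bG bS x₀ (T + 1)
      have e3 : (st (T + 1)).y = _ := byrdNester_y_succ (p.surrogate L c) A L m m ξ bG bS x₀ T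
      rw [← hst] at e1 e2 e3
      have h1 := hq.inexact_step hL hz (st (T + 1)).x (st (T + 1)).sHat
        (A (gradMessages (p.surrogate L c) A (proxStep L) m m ξ bG bS x₀ (T + 1))) e3
      have e4 : (st (T + 1)).y - (1 / (3 * L)) •
          A (gradMessages (p.surrogate L c) A (proxStep L) m m ξ bG bS x₀ (T + 1)) =
          (st (T + 1 + 1)).x := by
        rw [e1, e2, e3]
        module
      rw [e4, ← e2] at h1
      refine h1.trans ?_
      have h2 := hG (T + 1)
      have h3 : runError p (ρ * δ) L A m ξ bG bS c x₀ (T + 1 + 1) =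
          7 / 10 * runError p (ρ * δ) L A m ξ bG bS c x₀ (T + 1) +
            batchError p (ρ * δ) m (ξ (T + 1 + 1)) (st (T + 1)).y :=
        sum_range_pow_sub_mul_succ _ _ _
      rw [h3, pow_succ (7 / 10 : ℝ)]
      -- The constant 2/3 is relaxed to the 7/3 of the first step, so that one prefactor serves the
      -- whole run.
      have h4 : 2 / (3 * L) * ‖A (gradMessages (p.surrogate L c) A (proxStep L) m m ξ bG bS x₀
          (T + 1)) - p.proxGrad L c (st (T + 1)).y‖ ^ 2 ≤
          7 / (3 * L) * batchError p (ρ * δ) m (ξ (T + 1 + 1)) (st (T + 1)).y := by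
        gcongr
        norm_num
      linarith

/-! ### Measurability of the stochastic gradients -/

/-- Directional derivatives are limits of the jointly measurable difference quotients with step 1/k;
an orthonormal basis assembles the gradient from them. -/
theorem measurable_gradient {α : Type*} [MeasurableSpace α] {F : Vec d → α → ℝ}
    (hF : Measurable fun v : Vec d × α => F v.1 v.2) (hd : ∀ a, Differentiable ℝ fun x => F x a) :
    Measurable fun v : Vec d × α => ∇ (fun z => F z v.2) v.1 := by
  have hcoord : ∀ e : Vec d, Measurable fun v : Vec d × α =>
      fderiv ℝ (fun z => F z v.2) v.1 e := by
    intro e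
    refine measurable_of_tendsto_metrizable (f := fun (k : ℕ) (v : Vec d × α) =>
      (k : ℝ) • (F (v.1 + (k : ℝ)⁻¹ • e) v.2 - F v.1 v.2)) (fun k => ?_) ?_
    · have h1 : Measurable fun v : Vec d × α => F (v.1 + (k : ℝ)⁻¹ • e) v.2 :=
        hF.comp ((measurable_fst.add_const _).prodMk measurable_snd)
      exact (h1.sub hF).const_smul (k : ℝ)
    · rw [tendsto_pi_nhds]
      intro v
      refine ((hd v.2 v.1).hasFDerivAt.lim e ?_)
      simpa using tendsto_natCast_atTop_atTop (R := ℝ)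
  have h : (fun v : Vec d × α => ∇ (fun z => F z v.2) v.1) = fun v =>
      ∑ j, (fderiv ℝ (fun z => F z v.2) v.1 (EuclideanSpace.basisFun (Fin d) ℝ j)) •
        EuclideanSpace.basisFun (Fin d) ℝ j := by
    funext v
    conv_lhs => rw [← (EuclideanSpace.basisFun (Fin d) ℝ).sum_repr (∇ (fun z => F z v.2) v.1)]
    refine Finset.sum_congr rfl fun j _ => ?_
    rw [OrthonormalBasis.repr_apply_apply, real_inner_comm, inner_gradient_left]
  rw [h]
  exact Finset.measurable_sum _ fun j _ => (hcoord _).smul_const _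

theorem measurable_honestMean {α : Type*} [MeasurableSpace α] {H : Finset (Fin n)}
    {w : α → Fin n → Vec d} (hw : ∀ i ∈ H, Measurable fun a => w a i) :
    Measurable fun a => honestMean H (w a) :=
  (Finset.measurable_fun_sum _ hw).const_smul ((H.card : ℝ)⁻¹)

theorem measurable_miniBatch {p : Problem n d q} {σ : ℝ} (hO : p.IsUnbiasedOracle σ)
    {α : Type*} [MeasurableSpace α] {ξ : α → ℕ → Vec q} {y : α → Vec d} (m : ℕ)
    (hξ : ∀ l, Measurable fun a => ξ a l) (hy : Measurable y) :
    Measurable fun a => miniBatch p.F m (ξ a) (y a) := by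
  refine (Finset.measurable_fun_sum _ fun l _ => ?_).const_smul ((m : ℝ)⁻¹)
  exact (measurable_gradient hO.measurable fun ξ =>
    (hO.contDiff ξ).differentiable one_ne_zero).comp (hy.prodMk (hξ l))

theorem measurable_batchError {p : Problem n d q} {σ : ℝ} (hO : p.IsUnbiasedOracle σ)
    (hg : Measurable (∇ p.obj)) (τ : ℝ) (m : ℕ) {α : Type*} [MeasurableSpace α]
    {ξ : α → Fin n → ℕ → Vec q} {y : α → Vec d} (hξ : ∀ i ∈ p.H, ∀ l, Measurable fun a => ξ a i l)
    (hy : Measurable y) : Measurable fun a => batchError p τ m (ξ a) (y a) := by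
  have h1 : ∀ i ∈ p.H, Measurable fun a => miniBatch p.F m (ξ a i) (y a) := fun i hi =>
    measurable_miniBatch hO m (hξ i hi) hy
  have h2 := measurable_honestMean h1
  unfold batchError
  refine Measurable.add (Measurable.const_mul (Measurable.const_mul
    (Finset.measurable_fun_sum _ fun i hi => ?_) _) _) (Measurable.const_mul ?_ _)
  · exact ((h1 i hi).sub h2).norm.pow_const 2
  · exact (h2.sub (hg.comp hy)).norm.pow_const 2

/-- Allows the samples at Byzantine indices, about which no measurability is assumed, to be replaced
by 0. -/
theorem batchError_congr {p : Problem n d q} {τ : ℝ} {m : ℕ} {ξ ξ' : Fin n → ℕ → Vec q}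
    (h : ∀ i ∈ p.H, ξ i = ξ' i) (y : Vec d) : batchError p τ m ξ y = batchError p τ m ξ' y := by
  have h1 : honestMean p.H (fun j => miniBatch p.F m (ξ j) y) =
      honestMean p.H (fun j => miniBatch p.F m (ξ' j) y) :=
    honestMean_congr fun i hi => by rw [h i hi]
  unfold batchError
  rw [h1, Finset.sum_congr rfl fun i hi => by rw [h i hi]]

/-! ### Second moments -/

/-- Centring at the mean reduces the sum of squares by |H| times the squared norm of the mean. -/
theorem sum_norm_sub_honestMean_sq_le {H : Finset (Fin n)} (hH : 0 < (H.card : ℝ))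
    (w : Fin n → Vec d) : ∑ i ∈ H, ‖w i - honestMean H w‖ ^ 2 ≤ ∑ i ∈ H, ‖w i‖ ^ 2 := by
  have h1 : ∑ i ∈ H, w i = (H.card : ℝ) • honestMean H w := by
    rw [honestMean, smul_smul, mul_inv_cancel₀ hH.ne', one_smul]
  simp only [norm_sub_sq_real, Finset.sum_add_distrib, Finset.sum_sub_distrib, ← Finset.mul_sum,
    ← sum_inner, Finset.sum_const, h1, real_inner_smul_left, real_inner_self_eq_norm_sq,
    nsmul_eq_mul]
  have : 0 ≤ (H.card : ℝ) * ‖honestMean H w‖ ^ 2 := by positivity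
  linarith

section SecondMoment

variable {Ω ι : Type*} [MeasurableSpace Ω] {P : Measure Ω}

theorem integrable_norm_sum_sq {s : Finset ι} {X : ι → Ω → Vec d}
    (hX : ∀ i ∈ s, MemLp (X i) 2 P) : Integrable (fun ω => ‖∑ i ∈ s, X i ω‖ ^ 2) P :=
  (memLp_finsetSum s hX).integrable_norm_pow two_ne_zero

/-- Independent centred vectors are orthogonal in L², so the cross terms integrate to zero. -/
theorem integral_norm_sum_sq_le [IsProbabilityMeasure P] {s : Finset ι} {X : ι → Ω → Vec d} {v : ℝ}
    (hX : ∀ i ∈ s, MemLp (X i) 2 P) (h0 : ∀ i ∈ s, ∫ ω, X i ω ∂P = 0)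
    (hv : ∀ i ∈ s, ∫ ω, ‖X i ω‖ ^ 2 ∂P ≤ v) (hind : ∀ i j, i ≠ j → IndepFun (X i) (X j) P) :
    ∫ ω, ‖∑ i ∈ s, X i ω‖ ^ 2 ∂P ≤ s.card * v := by
  classical
  induction s using Finset.induction_on with
  | empty => simp
  | insert a s ha ih =>
    have hXa := hX a (Finset.mem_insert_self a s)
    have hXs : ∀ i ∈ s, MemLp (X i) 2 P := fun i hi => hX i (Finset.mem_insert_of_mem hi)
    have hint : ∀ i ∈ s, Integrable (fun ω => inner ℝ (X a ω) (X i ω)) P := fun i hi =>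
      (hind a i (ne_of_mem_of_not_mem hi ha).symm).integrable_bilin (hXa.integrable one_le_two)
        ((hXs i hi).integrable one_le_two) (innerSL ℝ)
    have hzero : ∀ i ∈ s, ∫ ω, inner ℝ (X a ω) (X i ω) ∂P = 0 := fun i hi => by
      have := (hind a i (ne_of_mem_of_not_mem hi ha).symm).integral_bilin
        (hXa.integrable one_le_two) ((hXs i hi).integrable one_le_two) (innerSL ℝ)
      rw [h0 a (Finset.mem_insert_self a s), map_zero] at this
      exact this
    have e : (fun ω => ‖∑ i ∈ insert a s, X i ω‖ ^ 2) = fun ω =>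
        (‖X a ω‖ ^ 2 + 2 * ∑ i ∈ s, inner ℝ (X a ω) (X i ω)) + ‖∑ i ∈ s, X i ω‖ ^ 2 := by
      funext ω
      rw [Finset.sum_insert ha, norm_add_sq_real, inner_sum]
    have i1 : Integrable (fun ω => ‖X a ω‖ ^ 2) P := hXa.integrable_norm_pow two_ne_zero
    have i2 : Integrable (fun ω => 2 * ∑ i ∈ s, inner ℝ (X a ω) (X i ω)) P :=
      (integrable_finsetSum s hint).const_mul 2
    rw [e, integral_add (by exact i1.add i2) (integrable_norm_sum_sq hXs), integral_add i1 i2,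
      integral_const_mul, integral_finsetSum s hint, Finset.sum_eq_zero hzero,
      Finset.card_insert_of_notMem ha]
    have h1 := ih hXs (fun i hi => h0 i (Finset.mem_insert_of_mem hi))
      (fun i hi => hv i (Finset.mem_insert_of_mem hi))
    have h2 := hv a (Finset.mem_insert_self a s)
    push_cast
    linarith

end SecondMoment

/-! ### The expected error of one aggregation -/

/-- The bound on the second moment of the aggregated mini-batch gradient; `τ` stands for `ρδ` and
`h` for the number of honest nodes. -/
def errorBound (τ ζ σ h : ℝ) (m : ℕ) : ℝ :=
  4 * τ * (ζ ^ 2 + σ ^ 2 / m) + 2 * (σ ^ 2 / (m * h))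

theorem sampleSigma_mono {Ω : Type*} (H : Finset (Fin n)) (ξ : Round → Fin n → ℕ → Ω → Vec q)
    {S S' : Set Round} (h : S ⊆ S') : sampleSigma H ξ S ≤ sampleSigma H ξ S' :=
  biSup_mono h

theorem measurable_sample_of_mem {Ω : Type*} {H : Finset (Fin n)} {ξ : Round → Fin n → ℕ → Ω → Vec q}
    {S : Set Round} {k : Round} (hk : k ∈ S)
    {i : Fin n} (hi : i ∈ H) (l : ℕ) : Measurable[sampleSigma H ξ S] (ξ k i l) := by
  rw [measurable_iff_comap_le]
  exact le_trans (le_trans (le_iSup (fun l => MeasurableSpace.comap (ξ k i l) inferInstance) l)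
    (le_biSup (fun i => ⨆ l, MeasurableSpace.comap (ξ k i l) inferInstance) hi))
    (le_biSup (fun k => ⨆ i ∈ H, ⨆ l, MeasurableSpace.comap (ξ k i l) inferInstance) hk)

section Sampling

variable {Ω : Type*} {𝒰 : MeasurableSpace Ω} [mΩ : MeasurableSpace Ω] {P : Measure Ω}
  {p : Problem n d q} {ξ : Round → Fin n → ℕ → Ω → Vec q}
  {bG bS : Round → Fin n → Ω → Vec d} {L ζ σ τ : ℝ}

theorem IsExecution.isProbabilityMeasure_data [IsProbabilityMeasure P]
    (hE : IsExecution 𝒰 P p ξ bG bS) : ∀ i ∈ p.H, IsProbabilityMeasure (p.D i) := fun i hi => by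
  rw [← hE.law_sample (mkRound 0 0 0) i hi 0]
  exact Measure.isProbabilityMeasure_map (hE.measurable_sample _ i hi 0).aemeasurable

/-- Each deviation from the honest mean splits into the gradient dissimilarity and the centred
noise, at the price of a factor 2. What remains are norms of sums of centred independent vectors:
one sum per node for the spread, one over all nodes for the mean. -/
theorem batchError_le (hτ : 0 ≤ τ) (h : p.IsSmoothHeterogeneous L ζ) (hH : 0 < (p.H.card : ℝ))
    {m : ℕ} (hm : 0 < m) (ξ : Fin n → ℕ → Vec q) (y : Vec d) :
    batchError p τ m ξ y ≤ 4 * τ * ζ ^ 2 +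
      (4 * τ / (p.H.card * m ^ 2) * ∑ i ∈ p.H, ‖∑ l ∈ Finset.range m,
        (∇ (fun z => p.F z (ξ i l)) y - ∇ (p.localObj i) y)‖ ^ 2 +
      2 / (p.H.card * m : ℝ) ^ 2 * ‖∑ j ∈ p.H ×ˢ Finset.range m,
        (∇ (fun z => p.F z (ξ j.1 j.2)) y - ∇ (p.localObj j.1) y)‖ ^ 2) := by
  have hm' : (m : ℝ) ≠ 0 := by positivity
  set N : Fin n → Vec d := fun i => miniBatch p.F m (ξ i) y - ∇ (p.localObj i) y with hN
  have hN' : ∀ i, N i = (m : ℝ)⁻¹ • ∑ l ∈ Finset.range m,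
      (∇ (fun z => p.F z (ξ i l)) y - ∇ (p.localObj i) y) := by
    intro i
    rw [hN, Finset.sum_sub_distrib, smul_sub, Finset.sum_const, Finset.card_range,
      ← Nat.cast_smul_eq_nsmul ℝ, smul_smul, inv_mul_cancel₀ hm', one_smul]
    rfl
  have hmean : honestMean p.H N = honestMean p.H (fun j => miniBatch p.F m (ξ j) y) - ∇ p.obj y := by
    rw [h.gradient_obj, ← honestMean_sub]
  have h1 : ∀ i, miniBatch p.F m (ξ i) y - honestMean p.H (fun j => miniBatch p.F m (ξ j) y) =
      (∇ (p.localObj i) y - ∇ p.obj y) + (N i - honestMean p.H N) := by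
    intro i
    rw [hmean]
    change _ = _ + (miniBatch p.F m (ξ i) y - ∇ (p.localObj i) y - _)
    abel
  have h2 : ∑ i ∈ p.H, ‖miniBatch p.F m (ξ i) y -
      honestMean p.H (fun j => miniBatch p.F m (ξ j) y)‖ ^ 2 ≤
      2 * (p.H.card * ζ ^ 2) + 2 * ∑ i ∈ p.H, ‖N i‖ ^ 2 := by
    calc _ ≤ ∑ i ∈ p.H, (2 * ‖∇ (p.localObj i) y - ∇ p.obj y‖ ^ 2 +
          2 * ‖N i - honestMean p.H N‖ ^ 2) := by
          refine Finset.sum_le_sum fun i _ => ?_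
          rw [h1]
          exact norm_add_sq_le_two_mul _ _
      _ = 2 * ∑ i ∈ p.H, ‖∇ (p.localObj i) y - ∇ p.obj y‖ ^ 2 +
          2 * ∑ i ∈ p.H, ‖N i - honestMean p.H N‖ ^ 2 := by
          rw [Finset.sum_add_distrib, Finset.mul_sum, Finset.mul_sum]
      _ ≤ _ := by
          gcongr ?_ + 2 * ?_
          · have := h.dissimilarity y
            rw [inv_mul_le_iff₀ hH] at this
            gcongr
          · exact sum_norm_sub_honestMean_sq_le hH N
  have h3 : ∑ i ∈ p.H, ‖N i‖ ^ 2 = (m : ℝ)⁻¹ ^ 2 * ∑ i ∈ p.H, ‖∑ l ∈ Finset.range m,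
      (∇ (fun z => p.F z (ξ i l)) y - ∇ (p.localObj i) y)‖ ^ 2 := by
    rw [Finset.mul_sum]
    refine Finset.sum_congr rfl fun i _ => ?_
    rw [hN', norm_smul, mul_pow, Real.norm_eq_abs, sq_abs]
  have h4 : ‖honestMean p.H N‖ ^ 2 = (p.H.card * m : ℝ)⁻¹ ^ 2 *
      ‖∑ j ∈ p.H ×ˢ Finset.range m,
        (∇ (fun z => p.F z (ξ j.1 j.2)) y - ∇ (p.localObj j.1) y)‖ ^ 2 := by
    rw [honestMean, Finset.sum_congr rfl fun i _ => hN' i, ← Finset.smul_sum, smul_smul,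
      norm_smul, mul_pow, Real.norm_eq_abs, sq_abs, Finset.sum_product, mul_inv]
  unfold batchError
  rw [← hmean, h4]
  have h5 := mul_le_mul_of_nonneg_left (h2.trans_eq (by rw [h3]))
    (show 0 ≤ 2 * (τ / p.H.card) by positivity)
  rw [mul_assoc] at h5
  refine (add_le_add_left h5 _).trans (le_of_eq ?_)
  field_simp
  ring

theorem integral_batchError_le [IsProbabilityMeasure P] (hτ : 0 ≤ τ)
    (h : p.IsSmoothHeterogeneous L ζ) (hO : p.IsUnbiasedOracle σ) (hH : 0 < (p.H.card : ℝ))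
    (hE : IsExecution 𝒰 P p ξ bG bS) {m : ℕ} (hm : 0 < m) (k : Round) (y : Vec d) :
    ∫⁻ ω, ENNReal.ofReal (batchError p τ m (fun i l => ξ k i l ω) y) ∂P ≤
      ENNReal.ofReal (errorBound τ ζ σ p.H.card m) := by
  have hm' : (0 : ℝ) < m := by positivity
  let Y : Fin n → Vec q → Vec d := fun i x => ∇ (fun z => p.F z x) y - ∇ (p.localObj i) y
  have hYm : ∀ i, Measurable (Y i) := fun i =>
    ((measurable_gradient hO.measurable fun ξ =>
      (hO.contDiff ξ).differentiable one_ne_zero).comp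
        (measurable_const.prodMk measurable_id)).sub_const _
  have hsm : ∀ i ∈ p.H, ∀ l, AEMeasurable (ξ k i l) P := fun i hi l =>
    (hE.measurable_sample k i hi l).aemeasurable
  have hD := hE.isProbabilityMeasure_data
  have hL2 : ∀ i ∈ p.H, ∀ l, MemLp (fun ω => Y i (ξ k i l ω)) 2 P := by
    intro i hi l
    have h1 : MemLp (Y i) 2 (p.D i) :=
      (memLp_two_iff_integrable_sq_norm (hYm i).aestronglyMeasurable).2 (hO.integrable_sq i hi y)
    rw [← hE.law_sample k i hi l] at h1
    exact h1.comp_of_map (hsm i hi l)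
  have hmean : ∀ i ∈ p.H, ∀ l, ∫ ω, Y i (ξ k i l ω) ∂P = 0 := by
    intro i hi l
    have := hD i hi
    rw [← integral_map (hsm i hi l) (hYm i).aestronglyMeasurable, hE.law_sample k i hi l,
      integral_sub (hO.integrable_grad i hi y) (integrable_const _), hO.unbiased i hi y]
    simp
  have hvar : ∀ i ∈ p.H, ∀ l, ∫ ω, ‖Y i (ξ k i l ω)‖ ^ 2 ∂P ≤ σ ^ 2 := by
    intro i hi l
    rw [← integral_map (f := fun x => ‖Y i x‖ ^ 2) (hsm i hi l)
      ((hYm i).norm.pow_const 2).aestronglyMeasurable, hE.law_sample k i hi l]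
    exact hO.variance i hi y
  have hind : ∀ i (hi : i ∈ p.H) (j) (hj : j ∈ p.H) (l l' : ℕ), (i, l) ≠ (j, l') →
      IndepFun (fun ω => Y i (ξ k i l ω)) (fun ω => Y j (ξ k j l' ω)) P := by
    intro i hi j hj l l' hne
    refine (hE.indep_sample.indepFun (i := (k, ⟨i, hi⟩, l)) (j := (k, ⟨j, hj⟩, l')) ?_).comp
      (hYm i) (hYm j)
    simpa [Prod.ext_iff] using hne
  have i1 : ∀ i ∈ p.H, Integrable (fun ω => ‖∑ l ∈ Finset.range m, Y i (ξ k i l ω)‖ ^ 2) P :=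
    fun i hi => integrable_norm_sum_sq fun l _ => hL2 i hi l
  have v1 : ∀ i ∈ p.H, ∫ ω, ‖∑ l ∈ Finset.range m, Y i (ξ k i l ω)‖ ^ 2 ∂P ≤ m * σ ^ 2 := by
    intro i hi
    have := integral_norm_sum_sq_le (s := Finset.range m) (fun l _ => hL2 i hi l)
      (fun l _ => hmean i hi l) (fun l _ => hvar i hi l)
      (fun l l' hl => hind i hi i hi l l' (by simpa using hl))
    rwa [Finset.card_range] at this
  -- `integral_norm_sum_sq_le` asks for independence over the whole index type, so the index type is
  -- cut down to honest nodes.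
  have e2 : ∀ ω, ∑ j ∈ p.H ×ˢ Finset.range m, Y j.1 (ξ k j.1 j.2 ω) =
      ∑ j ∈ p.H.attach ×ˢ Finset.range m, Y j.1 (ξ k j.1 j.2 ω) := by
    intro ω
    rw [Finset.sum_product, Finset.sum_product]
    exact (Finset.sum_attach p.H fun i => ∑ l ∈ Finset.range m, Y i (ξ k i l ω)).symm
  have i2 : Integrable (fun ω => ‖∑ j ∈ p.H ×ˢ Finset.range m, Y j.1 (ξ k j.1 j.2 ω)‖ ^ 2) P :=
    integrable_norm_sum_sq (X := fun j : Fin n × ℕ => fun ω => Y j.1 (ξ k j.1 j.2 ω))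
      fun j hj => hL2 j.1 (Finset.mem_product.1 hj).1 j.2
  have v2 : ∫ ω, ‖∑ j ∈ p.H ×ˢ Finset.range m, Y j.1 (ξ k j.1 j.2 ω)‖ ^ 2 ∂P ≤
      (p.H.card * m) * σ ^ 2 := by
    simp only [e2]
    have := integral_norm_sum_sq_le (s := p.H.attach ×ˢ Finset.range m)
      (X := fun j ω => Y j.1 (ξ k j.1 j.2 ω))
      (fun j _ => hL2 j.1 j.1.2 j.2) (fun j _ => hmean j.1 j.1.2 j.2)
      (fun j _ => hvar j.1 j.1.2 j.2)
      (fun j j' hj => hind j.1 j.1.2 j'.1 j'.1.2 j.2 j'.2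
        fun he => hj (Prod.ext (Subtype.ext (Prod.ext_iff.1 he).1) (Prod.ext_iff.1 he).2))
    rwa [Finset.card_product, Finset.card_attach, Finset.card_range, Nat.cast_mul] at this
  have i3 := (integrable_finsetSum p.H i1).const_mul (4 * τ / (p.H.card * m ^ 2))
  have i4 := i2.const_mul (2 / (p.H.card * m : ℝ) ^ 2)
  have i5 := (integrable_const (μ := P) (4 * τ * ζ ^ 2)).add (i3.add i4)
  calc _ ≤ ∫⁻ ω, ENNReal.ofReal _ ∂P :=
        lintegral_mono fun ω => ENNReal.ofReal_le_ofReal (batchError_le hτ h hH hm _ y)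
    _ = ENNReal.ofReal _ := (ofReal_integral_eq_lintegral_ofReal i5
        (Filter.Eventually.of_forall fun ω => by
          simp only [Pi.add_apply, Pi.zero_apply]; positivity)).symm
    _ ≤ _ := by
      refine ENNReal.ofReal_le_ofReal ?_
      rw [integral_add' (integrable_const _) (i3.add i4), integral_add' i3 i4, integral_const,
        integral_const_mul (4 * τ / (p.H.card * (m : ℝ) ^ 2)),
        integral_const_mul (2 / (p.H.card * m : ℝ) ^ 2), integral_finsetSum _ i1, probReal_univ,
        one_smul,
        errorBound]
      have v3 : ∑ i ∈ p.H, ∫ ω, ‖∑ l ∈ Finset.range m, Y i (ξ k i l ω)‖ ^ 2 ∂P ≤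
          p.H.card * (m * σ ^ 2) := by
        refine (Finset.sum_le_sum v1).trans_eq ?_
        simp
      have w1 := mul_le_mul_of_nonneg_left v3
        (show 0 ≤ 4 * τ / (p.H.card * (m : ℝ) ^ 2) by positivity)
      have w2 := mul_le_mul_of_nonneg_left v2
        (show 0 ≤ 2 / (p.H.card * m : ℝ) ^ 2 by positivity)
      have w3 : 4 * τ / (p.H.card * (m : ℝ) ^ 2) * (p.H.card * (m * σ ^ 2)) =
          4 * τ * (σ ^ 2 / m) := by
        field_simp
      have w4 : 2 / (p.H.card * m : ℝ) ^ 2 * ((p.H.card * m) * σ ^ 2) =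
          2 * (σ ^ 2 / (m * p.H.card)) := by
        field_simp
      linarith

/-! ### Independence of the samples of a round from the past -/

/-- The sets u ∩ a form a π-system generating the join, and P(u ∩ a ∩ b) = P(u) P(a ∩ b) = P(u) P(a)
P(b) = P(u ∩ a) P(b). -/
theorem indep_sup_left [IsProbabilityMeasure P] {m₀ m₁ m₂ : MeasurableSpace Ω} (h₀ : m₀ ≤ mΩ)
    (h₁ : m₁ ≤ mΩ) (h₂ : m₂ ≤ mΩ) (h₁₂ : Indep m₁ m₂ P) (h : Indep m₀ (m₁ ⊔ m₂) P) :
    Indep (m₀ ⊔ m₁) m₂ P := by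
  let π : Set (Set Ω) :=
    {s | ∃ u a, MeasurableSet[m₀] u ∧ MeasurableSet[m₁] a ∧ s = u ∩ a}
  refine IndepSets.indep (p1 := π) (p2 := {s | MeasurableSet[m₂] s}) (sup_le h₀ h₁) h₂ ?_
    (@MeasurableSpace.isPiSystem_measurableSet Ω m₂) ?_
    (@MeasurableSpace.generateFrom_measurableSet Ω m₂).symm ?_
  · rintro _ ⟨u, a, hu, ha, rfl⟩ _ ⟨u', a', hu', ha', rfl⟩ -
    exact ⟨u ∩ u', a ∩ a', @MeasurableSet.inter _ m₀ _ _ hu hu',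
      @MeasurableSet.inter _ m₁ _ _ ha ha', Set.inter_inter_inter_comm _ _ _ _⟩
  · refine le_antisymm (sup_le (fun u hu => ?_) fun a ha => ?_)
      (MeasurableSpace.generateFrom_le ?_)
    · exact MeasurableSpace.measurableSet_generateFrom
        ⟨u, Set.univ, hu, @MeasurableSet.univ _ m₁, (Set.inter_univ u).symm⟩
    · exact MeasurableSpace.measurableSet_generateFrom
        ⟨Set.univ, a, @MeasurableSet.univ _ m₀, ha, (Set.univ_inter a).symm⟩
    · rintro _ ⟨u, a, hu, ha, rfl⟩
      exact @MeasurableSet.inter _ (m₀ ⊔ m₁) _ _ ((le_sup_left : m₀ ≤ m₀ ⊔ m₁) _ hu)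
        ((le_sup_right : m₁ ≤ m₀ ⊔ m₁) _ ha)
  · rw [IndepSets_iff]
    rintro _ b ⟨u, a, hu, ha, rfl⟩ hb
    rw [Indep_iff] at h h₁₂
    have ha' : MeasurableSet[m₁ ⊔ m₂] a := (le_sup_left : m₁ ≤ m₁ ⊔ m₂) _ ha
    have hb' : MeasurableSet[m₁ ⊔ m₂] b := (le_sup_right : m₂ ≤ m₁ ⊔ m₂) _ hb
    rw [Set.inter_assoc, h u _ hu (@MeasurableSet.inter _ (m₁ ⊔ m₂) _ _ ha' hb'), h₁₂ a b ha hb,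
      h u a hu ha', mul_assoc]

theorem IsExecution.sampleSigma_le (hE : IsExecution 𝒰 P p ξ bG bS) (S : Set Round) :
    sampleSigma p.H ξ S ≤ mΩ :=
  iSup₂_le fun k _ => iSup₂_le fun i hi => iSup_le fun l => (hE.measurable_sample k i hi l).comap_le

theorem IsExecution.past_le (hE : IsExecution 𝒰 P p ξ bG bS) (S : Set Round) :
    𝒰 ⊔ sampleSigma p.H ξ S ≤ mΩ :=
  sup_le hE.private_le (hE.sampleSigma_le S)

/-- Adding the private randomness to the past does not spoil its independence of fresh samples,
because that randomness is independent of all samples jointly. -/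
theorem IsExecution.indep_past [IsProbabilityMeasure P] (hE : IsExecution 𝒰 P p ξ bG bS)
    {S S' : Set Round} (hS : Disjoint S S') :
    Indep (𝒰 ⊔ sampleSigma p.H ξ S) (sampleSigma p.H ξ S') P := by
  refine indep_sup_left hE.private_le (hE.sampleSigma_le S) (hE.sampleSigma_le S') ?_
    (indep_of_indep_of_le_right hE.private_indep (sup_le
      (sampleSigma_mono _ _ (Set.subset_univ _)) (sampleSigma_mono _ _ (Set.subset_univ _))))
  have key := indep_iSup_of_disjoint
    (m := fun j : Round × {i // i ∈ p.H} × ℕ =>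
      MeasurableSpace.comap (ξ j.1 j.2.1.1 j.2.2) inferInstance)
    (S := Prod.fst ⁻¹' S) (T := Prod.fst ⁻¹' S')
    (fun j => (hE.measurable_sample j.1 j.2.1.1 j.2.1.2 j.2.2).comap_le)
    ((iIndepFun_iff_iIndep _ _ _).1 hE.indep_sample) (hS.preimage _)
  have hle : ∀ S : Set Round, sampleSigma p.H ξ S ≤
      ⨆ j ∈ (Prod.fst ⁻¹' S : Set (Round × {i // i ∈ p.H} × ℕ)),
        MeasurableSpace.comap (ξ j.1 j.2.1.1 j.2.2) inferInstance := fun S =>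
    iSup₂_le fun k hk => iSup₂_le fun i hi => iSup_le fun l =>
      le_biSup (fun j : Round × {i // i ∈ p.H} × ℕ =>
        MeasurableSpace.comap (ξ j.1 j.2.1.1 j.2.2) inferInstance)
        (show ((k, ⟨i, hi⟩, l) : Round × {i // i ∈ p.H} × ℕ) ∈ Prod.fst ⁻¹' S from hk)
  exact indep_of_indep_of_le_left (indep_of_indep_of_le_right key (hle S')) (hle S)

/-- Freezing: the query point and the weight are fixed by the past, so their joint law with the
fresh samples is a product, and the bound for a fixed point applies inside the outer integral. The
weight serves to handle a random number of iterations. -/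
theorem IsExecution.lintegral_mul_batchError_le [IsProbabilityMeasure P] (hτ : 0 ≤ τ)
    (h : p.IsSmoothHeterogeneous L ζ) (hO : p.IsUnbiasedOracle σ) (hH : 0 < (p.H.card : ℝ))
    (hg : Measurable (∇ p.obj)) (hE : IsExecution 𝒰 P p ξ bG bS) {m : ℕ} (hm : 0 < m) (k : Round)
    {w : Ω → ENNReal} {y : Ω → Vec d}
    (hw : Measurable[𝒰 ⊔ sampleSigma p.H ξ (Set.Iio k)] w)
    (hy : Measurable[𝒰 ⊔ sampleSigma p.H ξ (Set.Iio k)] y) :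
    ∫⁻ ω, w ω * ENNReal.ofReal (batchError p τ m (fun i l => ξ k i l ω) (y ω)) ∂P ≤
      ENNReal.ofReal (errorBound τ ζ σ p.H.card m) * ∫⁻ ω, w ω ∂P := by
  classical
  -- Only the honest samples of round `k` are collected into one random element; `ext` fills the
  -- other indices with 0.
  let S : Ω → ({i // i ∈ p.H} × ℕ → Vec q) := fun ω j => ξ k j.1 j.2 ω
  let ext : ({i // i ∈ p.H} × ℕ → Vec q) → Fin n → ℕ → Vec q := fun s i l =>
    if hi : i ∈ p.H then s (⟨i, hi⟩, l) else 0
  have hext : ∀ ω y, batchError p τ m (fun i l => ξ k i l ω) y = batchError p τ m (ext (S ω)) y :=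
    fun ω y => batchError_congr (fun i hi => by funext l; simp [ext, S, hi]) y
  have hSσ : Measurable[sampleSigma p.H ξ {k}] S :=
    @measurable_pi_lambda _ _ _ (sampleSigma p.H ξ {k}) _ _ fun j =>
      measurable_sample_of_mem (Set.mem_singleton k) j.1.2 j.2
  have hS : Measurable S := hSσ.mono (hE.sampleSigma_le _) le_rfl
  have hwm : Measurable w := hw.mono (hE.past_le _) le_rfl
  have hym : Measurable y := hy.mono (hE.past_le _) le_rfl
  have hind : IndepFun (fun ω => (w ω, y ω)) S P := by
    rw [IndepFun_iff_Indep]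
    refine indep_of_indep_of_le_left (indep_of_indep_of_le_right
      (hE.indep_past (S := Set.Iio k) (S' := {k}) (by simp)) hSσ.comap_le) ?_
    exact (hw.prodMk hy).comap_le
  have hmap := hind.map_prod_eq_prod_map_map (hwm.prodMk hym).aemeasurable hS.aemeasurable
  have hBy : ∀ y, Measurable fun s => ENNReal.ofReal (batchError p τ m (ext s) y) := by
    intro y
    refine (measurable_batchError hO hg τ m (fun i hi l => ?_) measurable_const).ennreal_ofReal
    simp only [ext, hi, dite_true]
    exact measurable_pi_apply _
  have hBm : Measurable fun v : (ENNReal × Vec d) × ({i // i ∈ p.H} × ℕ → Vec q) =>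
      ENNReal.ofReal (batchError p τ m (ext v.2) v.1.2) := by
    refine (measurable_batchError hO hg τ m (fun i hi l => ?_)
      (measurable_snd.comp measurable_fst)).ennreal_ofReal
    simp only [ext, hi, dite_true]
    exact (measurable_pi_apply _).comp measurable_snd
  have hGm : Measurable fun v : (ENNReal × Vec d) × ({i // i ∈ p.H} × ℕ → Vec q) =>
      v.1.1 * ENNReal.ofReal (batchError p τ m (ext v.2) v.1.2) :=
    (measurable_fst.comp measurable_fst).mul hBm
  have hinner : ∀ y, ∫⁻ s, ENNReal.ofReal (batchError p τ m (ext s) y) ∂(P.map S) ≤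
      ENNReal.ofReal (errorBound τ ζ σ p.H.card m) := by
    intro y
    rw [lintegral_map (hBy y) hS]
    simp only [← hext]
    exact integral_batchError_le hτ h hO hH hE hm k y
  have : IsProbabilityMeasure (P.map S) := Measure.isProbabilityMeasure_map hS.aemeasurable
  calc _ = ∫⁻ v, v.1.1 * ENNReal.ofReal (batchError p τ m (ext v.2) v.1.2)
          ∂(P.map fun ω => ((w ω, y ω), S ω)) := by
        rw [lintegral_map hGm ((hwm.prodMk hym).prodMk hS)]
        simp only [hext]
    _ = ∫⁻ u, ∫⁻ s, u.1 * ENNReal.ofReal (batchError p τ m (ext s) u.2) ∂(P.map S)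
          ∂(P.map fun ω => (w ω, y ω)) := by
        rw [hmap, lintegral_prod _ hGm.aemeasurable]
    _ ≤ ∫⁻ u, u.1 * ENNReal.ofReal (errorBound τ ζ σ p.H.card m) ∂(P.map fun ω => (w ω, y ω)) := by
        refine lintegral_mono fun u => ?_
        rw [lintegral_const_mul _ (hBy u.2)]
        gcongr
        exact hinner u.2
    _ = _ := by
        rw [lintegral_map (measurable_fst.mul_const _) (hwm.prodMk hym)]
        simp only
        rw [lintegral_mul_const _ hwm, mul_comm]

end Sampling

/-! ### The proximal map -/

namespace Problem

/-- A minimizer of `proxObj p L c`. -/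
def prox (p : Problem n d q) (L : ℝ) (c : Vec d) : Vec d :=
  Classical.epsilon fun z => ∀ x, p.proxObj L c z ≤ p.proxObj L c x

/-- The suboptimality of `z` in the proximal subproblem centred at `c`. -/
def proxGap (p : Problem n d q) (L : ℝ) (c z : Vec d) : ℝ :=
  p.proxObj L c z - p.proxObj L c (p.prox L c)

variable {p : Problem n d q} {L ζ σ : ℝ}

theorem IsSmoothHeterogeneous.prox_isMin (h : p.IsSmoothHeterogeneous L ζ) (hL : 0 < L)
    (hH : 0 < (p.H.card : ℝ)) (c : Vec d) (x : Vec d) :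
    p.proxObj L c (p.prox L c) ≤ p.proxObj L c x :=
  Classical.epsilon_spec (p := fun z => ∀ x, p.proxObj L c z ≤ p.proxObj L c x)
    ((h.hasQuadraticBounds_proxObj hH c).exists_isMin hL
      (h.continuous_proxObj.comp (continuous_const.prodMk continuous_id))) x

theorem IsSmoothHeterogeneous.proxGap_nonneg (h : p.IsSmoothHeterogeneous L ζ) (hL : 0 < L)
    (hH : 0 < (p.H.card : ℝ)) (c x : Vec d) : 0 ≤ p.proxGap L c x :=
  sub_nonneg.2 (h.prox_isMin hL hH c x)

theorem IsSmoothHeterogeneous.le_proxGap (h : p.IsSmoothHeterogeneous L ζ) (hL : 0 < L)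
    (hH : 0 < (p.H.card : ℝ)) (c x : Vec d) :
    L / 2 * ‖x - p.prox L c‖ ^ 2 ≤ p.proxGap L c x :=
  (h.hasQuadraticBounds_proxObj hH c).le_sub_of_isMin (by positivity) (h.prox_isMin hL hH c) x

theorem IsSmoothHeterogeneous.proxGap_le (h : p.IsSmoothHeterogeneous L ζ) (hL : 0 < L)
    (hH : 0 < (p.H.card : ℝ)) (c x : Vec d) :
    p.proxGap L c x ≤ 3 * L / 2 * ‖x - p.prox L c‖ ^ 2 :=
  (h.hasQuadraticBounds_proxObj hH c).sub_le_of_isMin (by positivity) (h.prox_isMin hL hH c) x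

/-- Strong convexity makes the minimizer unique, so the infimum distance is the distance to one
point. -/
theorem IsSmoothHeterogeneous.distArgmin_proxObj (h : p.IsSmoothHeterogeneous L ζ) (hL : 0 < L)
    (hH : 0 < (p.H.card : ℝ)) (c x : Vec d) :
    distArgmin (p.proxObj L c) x = ‖x - p.prox L c‖ := by
  have : {w | IsMinOn (p.proxObj L c) Set.univ w} = {p.prox L c} := by
    ext w
    simp only [Set.mem_ofPred_eq, Set.mem_singleton_iff, isMinOn_univ_iff]
    refine ⟨fun hw => ?_, fun hw => hw ▸ h.prox_isMin hL hH c⟩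
    have h1 := h.le_proxGap hL hH c w
    have h2 : p.proxGap L c w ≤ 0 := sub_nonpos.2 (hw _)
    have h3 : ‖w - p.prox L c‖ ^ 2 ≤ 0 := by
      by_contra! h4
      have : 0 < L / 2 * ‖w - p.prox L c‖ ^ 2 := by positivity
      linarith
    have h5 : ‖w - p.prox L c‖ = 0 := by simpa using le_antisymm h3 (sq_nonneg _)
    exact sub_eq_zero.1 (norm_eq_zero.1 h5)
  rw [distArgmin, this, Metric.infDist_singleton, dist_eq_norm]

/-- Adding the strong convexity inequalities of the two subproblems cancels the values of the
objective and leaves ‖z - z'‖² ≤ 2⟨z - z', c - c'⟩. The resulting continuity gives measurability of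
the random stage lengths. -/
theorem IsSmoothHeterogeneous.norm_prox_sub_prox_le (h : p.IsSmoothHeterogeneous L ζ)
    (hL : 0 < L) (hH : 0 < (p.H.card : ℝ)) (c c' : Vec d) :
    ‖p.prox L c - p.prox L c'‖ ≤ 2 * ‖c - c'‖ := by
  have h1 := h.le_proxGap hL hH c (p.prox L c')
  have h2 := h.le_proxGap hL hH c' (p.prox L c)
  rw [norm_sub_rev] at h1
  simp only [proxGap, proxObj] at h1 h2
  set z := p.prox L c
  set z' := p.prox L c'
  have e : ‖z' - c‖ ^ 2 - ‖z - c‖ ^ 2 + ‖z - c'‖ ^ 2 - ‖z' - c'‖ ^ 2 =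
      2 * inner ℝ (z - z') (c - c') := by
    simp only [norm_sub_sq_real, inner_sub_left, inner_sub_right]
    ring
  have h3 : L * ‖z - z'‖ ^ 2 ≤ L * (2 * inner ℝ (z - z') (c - c')) := by
    rw [← e]
    linarith
  have h4 := le_of_mul_le_mul_left h3 hL
  have h5 := real_inner_le_norm (z - z') (c - c')
  by_contra! h6
  nlinarith [norm_nonneg (c - c'), norm_nonneg (z - z')]

theorem IsSmoothHeterogeneous.continuous_prox (h : p.IsSmoothHeterogeneous L ζ) (hL : 0 < L)
    (hH : 0 < (p.H.card : ℝ)) : Continuous (p.prox L) :=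
  (LipschitzWith.of_dist_le_mul (K := 2) fun x y => by
    rw [dist_eq_norm, dist_eq_norm]; exact h.norm_prox_sub_prox_le hL hH x y).continuous

theorem IsSmoothHeterogeneous.continuous_proxGap (h : p.IsSmoothHeterogeneous L ζ) (hL : 0 < L)
    (hH : 0 < (p.H.card : ℝ)) : Continuous fun v : Vec d × Vec d => p.proxGap L v.1 v.2 :=
  h.continuous_proxObj.sub
    (h.continuous_proxObj.comp (continuous_fst.prodMk ((h.continuous_prox hL hH).comp continuous_fst)))

end Problem

/-! ### Measurability of the iterates -/

/-- The standing assumptions: the problem, the oracle, the aggregator and the execution. -/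
structure Setting {Ω : Type*} (𝒰 : MeasurableSpace Ω) [MeasurableSpace Ω] (P : Measure Ω)
    (p : Problem n d q) (A : (Fin n → Vec d) → Vec d) (ξ : Round → Fin n → ℕ → Ω → Vec q)
    (bG bS : Round → Fin n → Ω → Vec d) (L ζ σ ρ δ : ℝ) : Prop where
  n_pos : 0 < n
  L_pos : 0 < L
  rho_nonneg : 0 ≤ ρ
  delta_nonneg : 0 ≤ δ
  delta_lt : δ < 1 / 2
  card_ge : (1 - δ) * n ≤ (p.H.card : ℝ)
  smooth : p.IsSmoothHeterogeneous L ζ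
  oracle : p.IsUnbiasedOracle σ
  measurable_agg : Measurable A
  robust : IsRobustAggregator p.H δ ρ A
  exec : IsExecution 𝒰 P p ξ bG bS

theorem measurable_apply_nat {α β : Type*} [MeasurableSpace α] [MeasurableSpace β]
    {X : α → ℕ → β} {T : α → ℕ} (hX : ∀ t, Measurable fun a => X a t) (hT : Measurable T) :
    Measurable fun a => X a (T a) :=
  (measurable_from_prod_countable_right (f := fun v : ℕ × α => X v.2 v.1) hX).comp
    (hT.prodMk measurable_id)

section Measurability

variable {α : Type*} [MeasurableSpace α] {p : Problem n d q} {A : (Fin n → Vec d) → Vec d}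
  {L ζ σ : ℝ}

/-- The σ-algebra on the parameter space is arbitrary and only inputs up to round `t` are
constrained, so the lemma gives adaptedness to the past as well as plain measurability. -/
theorem measurable_byrdNester (hO : p.IsUnbiasedOracle σ) (hA : Measurable A) {m : ℕ} (hm : 0 < m)
    {ξ : α → ℕ → Fin n → ℕ → Vec q} {bG bS : α → ℕ → Fin n → Vec d} {c x₀ : α → Vec d}
    (hc : Measurable c) (hx₀ : Measurable x₀) (t : ℕ)
    (hξ : ∀ s ≤ t, ∀ i ∈ p.H, ∀ l, Measurable fun a => ξ a s i l)
    (hG : ∀ s ≤ t, ∀ i ∉ p.H, Measurable fun a => bG a s i)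
    (hS : ∀ s ≤ t, ∀ i ∉ p.H, Measurable fun a => bS a s i) :
    (Measurable fun a => (byrdNester (p.surrogate L (c a)) A (proxStep L) m m (ξ a) (bG a) (bS a)
      (x₀ a) t).x) ∧
    (Measurable fun a => (byrdNester (p.surrogate L (c a)) A (proxStep L) m m (ξ a) (bG a) (bS a)
      (x₀ a) t).y) ∧
    (Measurable fun a => (byrdNester (p.surrogate L (c a)) A (proxStep L) m m (ξ a) (bG a) (bS a)
      (x₀ a) t).sHat) := by
  have hmsg : ∀ (y : α → Vec d) (b : α → Fin n → Vec d) (s : ℕ), s ≤ t → Measurable y →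
      (∀ i ∉ p.H, Measurable fun a => b a i) →
      Measurable fun a => A fun i => if i ∈ p.H then
        miniBatch (p.surrogate L (c a)).F m (ξ a s i) (y a) else b a i := by
    intro y b s hs hy hb
    refine hA.comp (measurable_pi_lambda _ fun i => ?_)
    by_cases hi : i ∈ p.H
    · simp only [hi, if_true, miniBatch_surrogate hO L _ hm]
      exact (measurable_miniBatch hO m (hξ s hs i hi) hy).add ((hy.sub hc).const_smul (2 * L))
    · simpa only [hi, if_false] using hb i hi
  induction t with
  | zero => exact ⟨hx₀, hx₀, hmsg x₀ (fun a => bS a 0) 0 le_rfl hx₀ (hS 0 le_rfl)⟩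
  | succ t ih =>
    obtain ⟨ix, iy, is⟩ := ih (fun s hs => hξ s (hs.trans t.le_succ))
      (fun s hs => hG s (hs.trans t.le_succ)) (fun s hs => hS s (hs.trans t.le_succ))
      (fun y b s hs => hmsg y b s (hs.trans t.le_succ))
    have h1 := (is.const_smul (2 - √3)).add
      (hmsg _ (fun a => bG a (t + 1)) (t + 1) le_rfl iy (hG (t + 1) le_rfl))
    have h2 : Measurable fun a => (byrdNester (p.surrogate L (c a)) A (proxStep L) m m (ξ a) (bG a)
        (bS a) (x₀ a) (t + 1)).sHat := by
      simp only [byrdNester_sHat_succ]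
      exact h1
    have h3 : Measurable fun a => (byrdNester (p.surrogate L (c a)) A (proxStep L) m m (ξ a) (bG a)
        (bS a) (x₀ a) (t + 1)).x := by
      simp only [byrdNester_x_succ]
      exact ix.sub (h2.const_smul (1 / (3 * L)))
    refine ⟨h3, ?_, h2⟩
    simp only [byrdNester_y_succ]
    exact h3.sub (h2.const_smul ((2 - √3) / (3 * L)))

theorem measurable_length (r : RestartParams) (k : ℕ) : Measurable fun R : ℝ => r.length n R k := by
  unfold RestartParams.length RestartParams.firstLength
  split_ifs
  · exact (((((measurable_id.pow_const 2).const_mul _).div_const _).log).const_mul _).nat_ceil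
  · exact ((((((measurable_id.pow_const 2).const_mul _).div_const _).log).const_mul _).nat_ceil).min
      (((((measurable_id.pow_const 2).const_mul _).div_const _).log).const_mul _).nat_ceil
  · exact measurable_const

variable (hL : 0 < L) (h : p.IsSmoothHeterogeneous L ζ) (hO : p.IsUnbiasedOracle σ)
  (hH : 0 < (p.H.card : ℝ)) (hD : ∀ i ∈ p.H, IsProbabilityMeasure (p.D i)) (hA : Measurable A)
  (r : RestartParams)

include hL h hO hH hD in
theorem measurable_stageLength {c : α → Vec d} (hc : Measurable c) (k : ℕ) :
    Measurable fun a => r.length n (distArgmin (p.surrogate L (c a)).obj (c a)) k := by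
  simp only [Problem.surrogate_obj hD hO hH, h.distArgmin_proxObj hL hH]
  exact (measurable_length r k).comp
    (hc.sub ((h.continuous_prox hL hH).measurable.comp hc)).norm

include hL h hO hH hD hA in
theorem measurable_byrdReNester {ξ : α → ℕ → ℕ → Fin n → ℕ → Vec q}
    {bG bS : α → ℕ → ℕ → Fin n → Vec d} {c : α → Vec d} (hc : Measurable c) (k : ℕ)
    (hξ : ∀ s ≤ k, ∀ t, ∀ i ∈ p.H, ∀ l, Measurable fun a => ξ a s t i l)
    (hG : ∀ s ≤ k, ∀ t, ∀ i ∉ p.H, Measurable fun a => bG a s t i)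
    (hS : ∀ s ≤ k, ∀ t, ∀ i ∉ p.H, Measurable fun a => bS a s t i) :
    Measurable fun a => byrdReNester (p.surrogate L (c a)) A (proxStep L) r (ξ a) (bG a) (bS a)
      (c a) k := by
  induction k with
  | zero => exact hc.prodMk measurable_const
  | succ k ih =>
    have ih := ih (fun s hs => hξ s (hs.trans k.le_succ)) (fun s hs => hG s (hs.trans k.le_succ))
      (fun s hs => hS s (hs.trans k.le_succ))
    have hT := measurable_stageLength hL h hO hH hD r hc (k + 1)
    simp only [byrdReNester, byrdNester_queries]
    refine Measurable.prodMk ?_ (ih.snd.add ((measurable_from_nat (f := fun T => 2 ^ k + 2 ^ k * T)).comp hT))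
    exact measurable_apply_nat (X := fun a t => (byrdNester (p.surrogate L (c a)) A (proxStep L)
        (2 ^ k) (2 ^ k) (ξ a (k + 1)) (bG a (k + 1)) (bS a (k + 1)) _ t).x)
      (fun t => (measurable_byrdNester hO hA (by positivity) hc ih.fst t
        (fun s _ => hξ (k + 1) le_rfl s) (fun s _ => hG (k + 1) le_rfl s)
        (fun s _ => hS (k + 1) le_rfl s)).1) hT

include hL h hO hH hD hA in
theorem measurable_proxPoint {ξ : α → ℕ → ℕ → ℕ → Fin n → ℕ → Vec q}
    {bG bS : α → ℕ → ℕ → ℕ → Fin n → Vec d} (x₀ : Vec d) (γ : ℕ)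
    (hξ : ∀ g ≤ γ, ∀ s t, ∀ i ∈ p.H, ∀ l, Measurable fun a => ξ a g s t i l)
    (hG : ∀ g ≤ γ, ∀ s t, ∀ i ∉ p.H, Measurable fun a => bG a g s t i)
    (hS : ∀ g ≤ γ, ∀ s t, ∀ i ∉ p.H, Measurable fun a => bS a g s t i) :
    Measurable fun a => proxPoint p A (proxStep L) r L (ξ a) (bG a) (bS a) x₀ γ := by
  induction γ with
  | zero => exact measurable_const
  | succ γ ih =>
    have ih := ih (fun s hs => hξ s (hs.trans γ.le_succ)) (fun s hs => hG s (hs.trans γ.le_succ))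
      (fun s hs => hS s (hs.trans γ.le_succ))
    have h1 := measurable_byrdReNester hL h hO hH hD hA r ih.fst (r.stages n)
      (fun s _ => hξ (γ + 1) le_rfl s) (fun s _ => hG (γ + 1) le_rfl s)
      (fun s _ => hS (γ + 1) le_rfl s)
    exact h1.fst.prodMk (ih.snd.add h1.snd)

end Measurability

/-! ### One stage in expectation -/

theorem mkRound_lt_of_call {γ γ' : ℕ} (h : γ < γ') (s t s' t' : ℕ) :
    mkRound γ s t < mkRound γ' s' t' :=
  Prod.Lex.toLex_lt_toLex.2 (Or.inl h)

theorem mkRound_lt_of_stage (γ : ℕ) {s s' : ℕ} (h : s < s') (t t' : ℕ) :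
    mkRound γ s t < mkRound γ s' t' :=
  Prod.Lex.toLex_lt_toLex.2 (Or.inr ⟨rfl, Prod.Lex.toLex_lt_toLex.2 (Or.inl h)⟩)

theorem mkRound_lt_of_round (γ s : ℕ) {t t' : ℕ} (h : t < t') :
    mkRound γ s t < mkRound γ s t' :=
  Prod.Lex.toLex_lt_toLex.2 (Or.inr ⟨rfl, Prod.Lex.toLex_lt_toLex.2 (Or.inr ⟨rfl, h⟩)⟩)

theorem sum_range_pow_sub_le (T : ℕ) :
    ∑ t ∈ Finset.range (T + 1), (7 / 10 : ℝ) ^ (T - t) ≤ 10 / 3 := by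
  have h1 := Finset.sum_range_reflect (fun j => (7 / 10 : ℝ) ^ j) (T + 1)
  have h2 : ∀ N : ℕ, ∑ j ∈ Finset.range N, (7 / 10 : ℝ) ^ j ≤ 10 / 3 := by
    intro N
    rw [geom_sum_eq (by norm_num)]
    have : (0 : ℝ) < (7 / 10) ^ N := by positivity
    rw [div_le_iff_of_neg (by norm_num)]
    linarith
  simp only [Nat.add_sub_cancel] at h1
  rw [h1]
  exact h2 _

/-- The Lyapunov function at the start of Byrd-Nester. -/
def startPotential (p : Problem n d q) (L : ℝ) (c x : Vec d) : ℝ :=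
  9 / 5 * p.proxGap L c x + L / 4 * ‖x - p.prox L c‖ ^ 2

theorem measurable_sample_past {Ω : Type*} {𝒰 : MeasurableSpace Ω} {H : Finset (Fin n)}
    {ξ : Round → Fin n → ℕ → Ω → Vec q} {K : Set Round} {k : Round} (hk : k ∈ K) :
    ∀ i ∈ H, ∀ l, Measurable[𝒰 ⊔ sampleSigma H ξ K] (ξ k i l) := fun _ hi l =>
  (measurable_sample_of_mem hk hi l).mono le_sup_right le_rfl

namespace Setting

variable {Ω : Type*} {𝒰 : MeasurableSpace Ω} [mΩ : MeasurableSpace Ω] {P : Measure Ω}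
  {p : Problem n d q} {A : (Fin n → Vec d) → Vec d} {ξ : Round → Fin n → ℕ → Ω → Vec q}
  {bG bS : Round → Fin n → Ω → Vec d} {L ζ σ ρ δ : ℝ}

theorem card_pos (S : Setting 𝒰 P p A ξ bG bS L ζ σ ρ δ) : 0 < (p.H.card : ℝ) := by
  have h1 : (0 : ℝ) < n := by exact_mod_cast S.n_pos
  have h2 := S.delta_lt
  exact lt_of_lt_of_le (mul_pos (by linarith) h1) S.card_ge

theorem measurable_bG (S : Setting 𝒰 P p A ξ bG bS L ζ σ ρ δ) {K : Set Round} {k : Round}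
    (hk : Set.Iic k ⊆ K) : ∀ i ∉ p.H, Measurable[𝒰 ⊔ sampleSigma p.H ξ K] (bG k i) := fun i hi =>
  (S.exec.adapted_G k i hi).mono (sup_le_sup_left (sampleSigma_mono _ _ hk) _) le_rfl

theorem measurable_bS (S : Setting 𝒰 P p A ξ bG bS L ζ σ ρ δ) {K : Set Round} {k : Round}
    (hk : Set.Iic k ⊆ K) : ∀ i ∉ p.H, Measurable[𝒰 ⊔ sampleSigma p.H ξ K] (bS k i) := fun i hi =>
  (S.exec.adapted_S k i hi).mono (sup_le_sup_left (sampleSigma_mono _ _ hk) _) le_rfl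

/-- The number of iterations is random but known when the stage starts, so it can be moved into
weights that are measurable with respect to the past of each round. -/
theorem lintegral_runError_le [IsProbabilityMeasure P] (S : Setting 𝒰 P p A ξ bG bS L ζ σ ρ δ)
    (γ s : ℕ) {m : ℕ} (hm : 0 < m) {c x₀ : Ω → Vec d} {T : Ω → ℕ}
    (hc : Measurable[𝒰 ⊔ sampleSigma p.H ξ (Set.Iio (mkRound γ s 0))] c)
    (hx₀ : Measurable[𝒰 ⊔ sampleSigma p.H ξ (Set.Iio (mkRound γ s 0))] x₀)
    (hT : Measurable[𝒰 ⊔ sampleSigma p.H ξ (Set.Iio (mkRound γ s 0))] T) :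
    ∫⁻ ω, ENNReal.ofReal (runError p (ρ * δ) L A m (fun t i l => ξ (mkRound γ s t) i l ω)
      (fun t i => bG (mkRound γ s t) i ω) (fun t i => bS (mkRound γ s t) i ω) (c ω) (x₀ ω) (T ω)) ∂P
      ≤ ENNReal.ofReal (10 / 3 * errorBound (ρ * δ) ζ σ p.H.card m) := by
  have hτ : 0 ≤ ρ * δ := mul_nonneg S.rho_nonneg S.delta_nonneg
  have hg := (S.smooth.continuous_gradient S.L_pos S.card_pos).measurable
  set V := errorBound (ρ * δ) ζ σ p.H.card m
  set y : ℕ → Ω → Vec d := fun t ω => (byrdNester (p.surrogate L (c ω)) A (proxStep L) m m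
    (fun t i l => ξ (mkRound γ s t) i l ω) (fun t i => bG (mkRound γ s t) i ω)
    (fun t i => bS (mkRound γ s t) i ω) (x₀ ω) t).y with hy
  set b : ℕ → Ω → ENNReal := fun t ω => ENNReal.ofReal (batchError p (ρ * δ) m
    (fun i l => ξ (mkRound γ s t) i l ω) (y (t - 1) ω)) with hb
  -- Weights vanishing beyond `T ω` turn the sum of random length into a series, to which Tonelli's
  -- theorem applies.
  set w : ℕ → Ω → ENNReal := fun t ω =>
    if t ∈ Finset.range (T ω + 1) then ENNReal.ofReal ((7 / 10) ^ (T ω - t)) else 0 with hw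
  have hle : ∀ t, 𝒰 ⊔ sampleSigma p.H ξ (Set.Iio (mkRound γ s 0)) ≤
      𝒰 ⊔ sampleSigma p.H ξ (Set.Iio (mkRound γ s t)) := fun t => by
    refine sup_le_sup_left (sampleSigma_mono _ _ (Set.Iio_subset_Iio ?_)) _
    rcases Nat.eq_zero_or_pos t with rfl | ht
    · exact le_rfl
    · exact (mkRound_lt_of_round γ s ht).le
  have hym : ∀ t, Measurable[𝒰 ⊔ sampleSigma p.H ξ (Set.Iio (mkRound γ s t))] (y (t - 1)) := by
    intro t
    rcases t with _ | t
    · exact hx₀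
    · have hlt : ∀ j ≤ t, mkRound γ s j < mkRound γ s (t + 1) := fun j hj =>
        mkRound_lt_of_round γ s (Nat.lt_succ_of_le hj)
      exact (@measurable_byrdNester n d q Ω
        (𝒰 ⊔ sampleSigma p.H ξ (Set.Iio (mkRound γ s (t + 1)))) p A L σ S.oracle
        S.measurable_agg m hm _ _ _ c x₀ (hc.mono (hle _) le_rfl) (hx₀.mono (hle _) le_rfl) t
        (fun j hj => measurable_sample_past (hlt j hj))
        (fun j hj => S.measurable_bG (Set.Iic_subset_Iio.2 (hlt j hj)))
        (fun j hj => S.measurable_bS (Set.Iic_subset_Iio.2 (hlt j hj)))).2.1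
  have hwm : ∀ t, Measurable[𝒰 ⊔ sampleSigma p.H ξ (Set.Iio (mkRound γ s t))] (w t) := fun t =>
    (measurable_from_nat (f := fun T => if t ∈ Finset.range (T + 1) then
      ENNReal.ofReal ((7 / 10) ^ (T - t)) else 0)).comp (hT.mono (hle t) le_rfl)
  have hbm : ∀ t, Measurable (b t) := fun t =>
    (measurable_batchError S.oracle hg _ m (fun i hi l => S.exec.measurable_sample _ i hi l)
      ((hym t).mono (S.exec.past_le _) le_rfl)).ennreal_ofReal
  have hwm' : ∀ t, Measurable (w t) := fun t => (hwm t).mono (S.exec.past_le _) le_rfl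
  have e : ∀ ω, ENNReal.ofReal (runError p (ρ * δ) L A m (fun t i l => ξ (mkRound γ s t) i l ω)
      (fun t i => bG (mkRound γ s t) i ω) (fun t i => bS (mkRound γ s t) i ω) (c ω) (x₀ ω) (T ω)) =
      ∑' t, w t ω * b t ω := by
    intro ω
    rw [runError, ENNReal.ofReal_sum_of_nonneg fun t _ =>
      mul_nonneg (by positivity) (batchError_nonneg p hτ _ _ _),
      tsum_eq_sum (s := Finset.range (T ω + 1)) fun t ht => by simp only [hw, if_neg ht, zero_mul]]
    refine Finset.sum_congr rfl fun t ht => ?_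
    rw [ENNReal.ofReal_mul (by positivity)]
    simp only [hw, if_pos ht, hb, hy]
  calc _ = ∫⁻ ω, ∑' t, w t ω * b t ω ∂P := by simp only [e]
    _ = ∑' t, ∫⁻ ω, w t ω * b t ω ∂P :=
        lintegral_tsum fun t => ((hwm' t).mul (hbm t)).aemeasurable
    _ ≤ ∑' t, ENNReal.ofReal V * ∫⁻ ω, w t ω ∂P := by
        refine ENNReal.tsum_le_tsum fun t => ?_
        exact S.exec.lintegral_mul_batchError_le hτ S.smooth S.oracle S.card_pos hg hm _ (hwm t)
          (hym t)
    _ = ENNReal.ofReal V * ∫⁻ ω, ∑' t, w t ω ∂P := by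
        rw [ENNReal.tsum_mul_left, lintegral_tsum fun t => (hwm' t).aemeasurable]
    _ ≤ ENNReal.ofReal V * ∫⁻ _, ENNReal.ofReal (10 / 3) ∂P := by
        gcongr with ω
        rw [tsum_eq_sum (s := Finset.range (T ω + 1)) fun t ht => by simp only [hw, if_neg ht],
          Finset.sum_congr (g := fun t => ENNReal.ofReal ((7 / 10) ^ (T ω - t))) rfl
            fun t ht => by simp only [hw, if_pos ht],
          ← ENNReal.ofReal_sum_of_nonneg fun t _ => pow_nonneg (by norm_num) _]
        exact ENNReal.ofReal_le_ofReal (sum_range_pow_sub_le _)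
    _ = _ := by
        rw [lintegral_const, measure_univ, mul_one, mul_comm, ← ENNReal.ofReal_mul (by norm_num)]

set_option maxHeartbeats 400000 in
theorem lintegral_proxGap_byrdNester_le [IsProbabilityMeasure P]
    (S : Setting 𝒰 P p A ξ bG bS L ζ σ ρ δ)
    (γ s : ℕ) {m : ℕ} (hm : 0 < m) {c x₀ : Ω → Vec d} {T : Ω → ℕ}
    (hc : Measurable[𝒰 ⊔ sampleSigma p.H ξ (Set.Iio (mkRound γ s 0))] c)
    (hx₀ : Measurable[𝒰 ⊔ sampleSigma p.H ξ (Set.Iio (mkRound γ s 0))] x₀)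
    (hT : Measurable[𝒰 ⊔ sampleSigma p.H ξ (Set.Iio (mkRound γ s 0))] T) :
    ∫⁻ ω, ENNReal.ofReal (p.proxGap L (c ω) (byrdNester (p.surrogate L (c ω)) A (proxStep L) m m
      (fun t i l => ξ (mkRound γ s t) i l ω) (fun t i => bG (mkRound γ s t) i ω)
      (fun t i => bS (mkRound γ s t) i ω) (x₀ ω) (T ω)).x) ∂P ≤
    ∫⁻ ω, ENNReal.ofReal ((7 / 10) ^ T ω * startPotential p L (c ω) (x₀ ω)) ∂P +
      ENNReal.ofReal (70 / (9 * L) * errorBound (ρ * δ) ζ σ p.H.card m) := by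
  have hL := S.L_pos
  have hτ : 0 ≤ ρ * δ := mul_nonneg S.rho_nonneg S.delta_nonneg
  have hcm := hc.mono (S.exec.past_le _) le_rfl
  have hxm := hx₀.mono (S.exec.past_le _) le_rfl
  have hTm := hT.mono (S.exec.past_le _) le_rfl
  have hpm : Measurable fun ω => ENNReal.ofReal
      ((7 / 10) ^ T ω * startPotential p L (c ω) (x₀ ω)) := by
    refine ((measurable_from_nat (f := fun T => (7 / 10 : ℝ) ^ T)).comp hTm |>.mul ?_).ennreal_ofReal
    unfold startPotential
    refine Measurable.add (Measurable.const_mul ?_ _) (Measurable.const_mul ?_ _)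
    · exact (S.smooth.continuous_proxGap hL S.card_pos).measurable.comp (hcm.prodMk hxm)
    · exact (hxm.sub
        ((S.smooth.continuous_prox hL S.card_pos).measurable.comp hcm)).norm.pow_const 2
  have hstep : ∀ ω, ENNReal.ofReal (p.proxGap L (c ω) (byrdNester (p.surrogate L (c ω)) A
      (proxStep L) m m (fun t i l => ξ (mkRound γ s t) i l ω) (fun t i => bG (mkRound γ s t) i ω)
      (fun t i => bS (mkRound γ s t) i ω) (x₀ ω) (T ω)).x) ≤
      ENNReal.ofReal ((7 / 10) ^ T ω * startPotential p L (c ω) (x₀ ω)) +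
      ENNReal.ofReal (7 / (3 * L)) * ENNReal.ofReal (runError p (ρ * δ) L A m
        (fun t i l => ξ (mkRound γ s t) i l ω) (fun t i => bG (mkRound γ s t) i ω)
        (fun t i => bS (mkRound γ s t) i ω) (c ω) (x₀ ω) (T ω)) := by
    intro ω
    rw [← ENNReal.ofReal_mul (by positivity)]
    refine (ENNReal.ofReal_le_ofReal ?_).trans ENNReal.ofReal_add_le
    exact byrdNester_gap_le hL hτ S.smooth S.oracle S.card_pos S.robust hm _ _ _
      (S.smooth.prox_isMin hL S.card_pos (c ω)) (x₀ ω) (T ω)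
  refine (lintegral_mono hstep).trans ?_
  rw [lintegral_add_left hpm, lintegral_const_mul' _ _ ENNReal.ofReal_ne_top]
  refine add_le_add_right ?_ _
  -- The constant 70/9 is 7/3 times the geometric sum 10/3.
  refine (mul_le_mul_right (S.lintegral_runError_le γ s hm hc hx₀ hT) _).trans_eq ?_
  rw [← ENNReal.ofReal_mul (by positivity)]
  congr 1
  field_simp
  ring

end Setting

/-! ### Byrd-reNester in expectation -/

/-- The schedule of Byrd-reNester on a proximal subproblem. -/
def proxRestart (L ε ρ δ σ : ℝ) : RestartParams :=
  { M := 3 * L, μ := L, ε := √(3 / 20) * ε, ρ := ρ, δ := δ, σ := σ }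

theorem proxRestart_eps_sq (L ε ρ δ σ : ℝ) :
    (proxRestart L ε ρ δ σ).ε ^ 2 = 3 / 20 * ε ^ 2 := by
  rw [proxRestart, mul_pow, Real.sq_sqrt (by norm_num)]

theorem sqrt_three_mul_div {L : ℝ} (hL : 0 < L) : √(3 * L / L) = √3 := by
  rw [mul_div_assoc, div_self hL.ne', mul_one]

/-- The schedule assumes the rate exp(-1/(2√3)) per iteration, which is slower than the proved rate
7/10. -/
theorem seven_tenths_pow_mul_le {a B : ℝ} (ha : 0 ≤ a) (hB : 0 < B) :
    (7 / 10) ^ ⌈2 * √3 * Real.log (a / B)⌉₊ * a ≤ B := by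
  have hs0 : 0 < √3 := by positivity
  have hs : √3 ^ 2 = 3 := Real.sq_sqrt (by norm_num)
  rcases ha.eq_or_lt with rfl | ha
  · simpa using hB.le
  set T := ⌈2 * √3 * Real.log (a / B)⌉₊
  have h1 : 2 * √3 * Real.log (a / B) ≤ T := Nat.le_ceil _
  have h2 : (7 / 10 : ℝ) ≤ Real.exp (-(1 / (2 * √3))) := by
    refine le_trans ?_ (Real.add_one_le_exp _)
    have : 1 / (2 * √3) ≤ 3 / 10 := by
      rw [div_le_iff₀ (by positivity)]
      nlinarith
    linarith
  have h3 : Real.log (a / B) ≤ T / (2 * √3) := by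
    rw [le_div_iff₀ (by positivity)]
    linarith
  have h4 : a / B ≤ Real.exp (T / (2 * √3)) := (Real.log_le_iff_le_exp (by positivity)).1 h3
  rw [div_le_iff₀ hB] at h4
  calc (7 / 10) ^ T * a ≤ Real.exp (-(1 / (2 * √3))) ^ T * (Real.exp (T / (2 * √3)) * B) := by
        gcongr
    _ = B := by
        rw [← Real.exp_nat_mul, ← mul_assoc, ← Real.exp_add]
        have : (T : ℝ) * -(1 / (2 * √3)) + T / (2 * √3) = 0 := by ring
        rw [this, Real.exp_zero, one_mul]

/-- Each entry of the minimum in the schedule reaches one of the two targets, and the maximum covers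
both choices. The second target is (ε')²/(4M) = (3/20)ε²/(12L). -/
theorem seven_tenths_pow_firstLength_mul_le {L ε ρ δ σ : ℝ} (hL : 0 < L) (hε : 0 < ε)
    (he : 0 ≤ (proxRestart L ε ρ δ σ).epsOneSq n) (R : ℝ) :
    (7 / 10) ^ (proxRestart L ε ρ δ σ).firstLength n R * (3 * L * R ^ 2) ≤
      max ((proxRestart L ε ρ δ σ).epsOneSq n / 2) (ε ^ 2 / (80 * L)) := by
  set r := proxRestart L ε ρ δ σ with hr
  set e := r.epsOneSq n with hedef
  have hε2 : r.ε ^ 2 = 3 / 20 * ε ^ 2 := proxRestart_eps_sq L ε ρ δ σ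
  have hsq : √(r.M / r.μ) = √3 := sqrt_three_mul_div hL
  have h2 := seven_tenths_pow_mul_le (a := 4 * (3 * L) ^ 2 * R ^ 2) (B := 3 / 20 * ε ^ 2)
    (by positivity) (by positivity)
  have hb : (7 / 10) ^ ⌈2 * √3 * Real.log (4 * (3 * L) ^ 2 * R ^ 2 / (3 / 20 * ε ^ 2))⌉₊ *
      (3 * L * R ^ 2) ≤ ε ^ 2 / (80 * L) := by
    rw [le_div_iff₀ (by positivity)]
    linarith
  have hM : r.M = 3 * L := rfl
  simp only [RestartParams.firstLength, hsq, hε2, ← hedef]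
  simp only [hM]
  split_ifs with h0
  · exact hb.trans (le_max_right _ _)
  · have he' : 0 < e := lt_of_le_of_ne he (Ne.symm h0)
    have h1 := seven_tenths_pow_mul_le (a := 2 * (3 * L) * R ^ 2) (B := e) (by positivity) he'
    rcases min_choice ⌈2 * √3 * Real.log (2 * (3 * L) * R ^ 2 / e)⌉₊
      ⌈2 * √3 * Real.log (4 * (3 * L) ^ 2 * R ^ 2 / (3 / 20 * ε ^ 2))⌉₊ with h | h <;> rw [h]
    · refine le_trans ?_ (le_max_left _ _)
      linarith
    · exact hb.trans (le_max_right _ _)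

theorem seven_le_length {L ε ρ δ σ : ℝ} (hL : 0 < L) (R : ℝ) {k : ℕ} (hk : k ≠ 1) :
    7 ≤ (proxRestart L ε ρ δ σ).length n R k := by
  have hsq : √((proxRestart L ε ρ δ σ).M / (proxRestart L ε ρ δ σ).μ) = √3 :=
    sqrt_three_mul_div hL
  rw [RestartParams.length, if_neg hk, hsq]
  have h1 : (2 : ℝ) * √3 * Real.log 8 ≤ ⌈2 * √3 * Real.log 8⌉₊ := Nat.le_ceil _
  have h2 : Real.log 8 = 3 * Real.log 2 := by
    rw [show (8 : ℝ) = 2 ^ 3 by norm_num, Real.log_pow]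
    norm_num
  have h3 := Real.log_two_gt_d9
  have hs : √3 ^ 2 = 3 := Real.sq_sqrt (by norm_num)
  have h4 : 17 / 10 ≤ √3 := by nlinarith [Real.sqrt_nonneg 3]
  have h5 : (7 : ℝ) ≤ ⌈2 * √3 * Real.log 8⌉₊ := by
    refine le_trans ?_ h1
    rw [h2]
    nlinarith
  exact_mod_cast h5

namespace Setting

variable {Ω : Type*} {𝒰 : MeasurableSpace Ω} [mΩ : MeasurableSpace Ω] {P : Measure Ω}
  {p : Problem n d q} {A : (Fin n → Vec d) → Vec d} {ξ : Round → Fin n → ℕ → Ω → Vec q}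
  {bG bS : Round → Fin n → Ω → Vec d} {L ζ σ ρ δ : ℝ}

theorem epsOneSq_nonneg (S : Setting 𝒰 P p A ξ bG bS L ζ σ ρ δ) (ε : ℝ) :
    0 ≤ (proxRestart L ε ρ δ σ).epsOneSq n := by
  have h1 := S.rho_nonneg
  have h2 := S.delta_nonneg
  have h3 : 0 ≤ 1 - δ := by linarith [S.delta_lt]
  have h4 := S.L_pos
  simp only [RestartParams.epsOneSq, proxRestart]
  positivity

/-- With batch 2^k, the noise level is comparable to ε₁²/2^(k+1). The constants 48 and 3/2 leave 64
and 3 as fixed points of the restart recursion g ↦ g/4 + error. -/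
theorem errorBound_le (S : Setting 𝒰 P p A ξ bG bS L ζ σ ρ δ) (ε : ℝ) (k : ℕ) :
    70 / (9 * L) * errorBound (ρ * δ) ζ σ p.H.card (2 ^ k) ≤
      48 * (ρ * δ * ζ ^ 2 / L) + 3 / 2 * ((proxRestart L ε ρ δ σ).epsOneSq n / 2 ^ (k + 1)) := by
  have hL := S.L_pos
  have hτ : 0 ≤ ρ * δ := mul_nonneg S.rho_nonneg S.delta_nonneg
  have hn : (0 : ℝ) < (1 - δ) * n :=
    mul_pos (by linarith [S.delta_lt]) (by exact_mod_cast S.n_pos)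
  set m : ℝ := 2 ^ k
  have hm : 0 < m := by positivity
  set u : ℝ := 1 / ((1 - δ) * n) with hu
  have hu0 : 0 ≤ u := by positivity
  have hσ : 0 ≤ σ ^ 2 / m := by positivity
  have h1 : σ ^ 2 / (m * p.H.card) ≤ σ ^ 2 / m * u := by
    rw [hu, ← div_div, div_eq_mul_one_div (σ ^ 2 / m)]
    gcongr
    exact S.card_ge
  have h2 : (proxRestart L ε ρ δ σ).epsOneSq n / 2 ^ (k + 1) =
      16 / L * ((3 * (ρ * δ) * (1 + u) + u) * (σ ^ 2 / m)) := by
    simp only [RestartParams.epsOneSq, proxRestart, ← hu, pow_succ, m]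
    field_simp
    ring
  have h3 : errorBound (ρ * δ) ζ σ p.H.card (2 ^ k) =
      4 * (ρ * δ) * (ζ ^ 2 + σ ^ 2 / m) + 2 * (σ ^ 2 / (m * p.H.card)) := by
    simp [errorBound, m]
  rw [h2, h3]
  have h4 : 0 ≤ ρ * δ * (σ ^ 2 / m) := by positivity
  have h5 : 0 ≤ ρ * δ * (u * (σ ^ 2 / m)) := by positivity
  have h6 : 0 ≤ ρ * δ * ζ ^ 2 := by positivity
  have h7 : 0 ≤ σ ^ 2 / m * u := by positivity
  calc _ ≤ 70 / (9 * L) * (4 * (ρ * δ) * (ζ ^ 2 + σ ^ 2 / m) + 2 * (σ ^ 2 / m * u)) := by gcongr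
    _ = 1 / L * (280 / 9 * (ρ * δ * ζ ^ 2) + 280 / 9 * (ρ * δ * (σ ^ 2 / m)) +
        140 / 9 * (σ ^ 2 / m * u)) := by field_simp; ring
    _ ≤ 1 / L * (48 * (ρ * δ * ζ ^ 2) + 24 * ((3 * (ρ * δ) * (1 + u) + u) * (σ ^ 2 / m))) := by
        gcongr ?_ * ?_
        linarith
    _ = _ := by ring

theorem startPotential_nonneg (S : Setting 𝒰 P p A ξ bG bS L ζ σ ρ δ) (c x : Vec d) :
    0 ≤ startPotential p L c x := by
  have h1 := S.smooth.proxGap_nonneg S.L_pos S.card_pos c x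
  have h2 := S.L_pos
  rw [startPotential]
  positivity

theorem startPotential_le_gap (S : Setting 𝒰 P p A ξ bG bS L ζ σ ρ δ) (c x : Vec d) :
    startPotential p L c x ≤ 23 / 10 * p.proxGap L c x := by
  have := S.smooth.le_proxGap S.L_pos S.card_pos c x
  rw [startPotential]
  linarith

theorem startPotential_le_dist (S : Setting 𝒰 P p A ξ bG bS L ζ σ ρ δ) (c x : Vec d) :
    startPotential p L c x ≤ 3 * L * ‖x - p.prox L c‖ ^ 2 := by
  have := S.smooth.proxGap_le S.L_pos S.card_pos c x
  have h2 : 0 ≤ L * ‖x - p.prox L c‖ ^ 2 := by have := S.L_pos; positivity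
  rw [startPotential]
  linarith

theorem length_stage (S : Setting 𝒰 P p A ξ bG bS L ζ σ ρ δ) [IsProbabilityMeasure P]
    (r : RestartParams) (c : Vec d) (k : ℕ) :
    r.length n (distArgmin (p.surrogate L c).obj c) k = r.length n ‖c - p.prox L c‖ k := by
  rw [Problem.surrogate_obj S.exec.isProbabilityMeasure_data S.oracle S.card_pos,
    S.smooth.distArgmin_proxObj S.L_pos S.card_pos]

/-- The run of Byrd-reNester in call `γ`, on the surrogate centred at `c`, after `k` stages. -/
abbrev restartRun (p : Problem n d q) (A : (Fin n → Vec d) → Vec d) (L : ℝ) (r : RestartParams)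
    (ξ : Round → Fin n → ℕ → Ω → Vec q) (bG bS : Round → Fin n → Ω → Vec d) (γ : ℕ) (c : Vec d)
    (k : ℕ) (ω : Ω) : Vec d × ℕ :=
  byrdReNester (p.surrogate L c) A (proxStep L) r (fun s t i l => ξ (mkRound γ s t) i l ω)
    (fun s t i => bG (mkRound γ s t) i ω) (fun s t i => bS (mkRound γ s t) i ω) c k

variable [IsProbabilityMeasure P]

theorem measurable_restartRun (S : Setting 𝒰 P p A ξ bG bS L ζ σ ρ δ) (r : RestartParams)
    {γ k : ℕ} {c : Ω → Vec d} {K : Set Round} (hc : Measurable[𝒰 ⊔ sampleSigma p.H ξ K] c)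
    (hK : ∀ s ≤ k, ∀ t, Set.Iic (mkRound γ s t) ⊆ K) :
    Measurable[𝒰 ⊔ sampleSigma p.H ξ K] fun ω => restartRun p A L r ξ bG bS γ (c ω) k ω :=
  @measurable_byrdReNester n d q Ω (𝒰 ⊔ sampleSigma p.H ξ K) p A L ζ σ S.L_pos S.smooth S.oracle
    S.card_pos S.exec.isProbabilityMeasure_data S.measurable_agg r _ _ _ c hc k
    (fun s hs t => measurable_sample_past (hK s hs t Set.self_mem_Iic))
    (fun s hs t => S.measurable_bG (hK s hs t)) (fun s hs t => S.measurable_bS (hK s hs t))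

/-- The centre and the result of the previous stages belong to the past of round 0 of the new stage,
so the one-run estimate applies with a random start and a random length. -/
theorem lintegral_proxGap_stage_le (S : Setting 𝒰 P p A ξ bG bS L ζ σ ρ δ) (ε : ℝ) (γ k : ℕ)
    {c : Ω → Vec d}
    (hc : Measurable[𝒰 ⊔ sampleSigma p.H ξ (Set.Iio (mkRound γ 0 0))] c) :
    ∫⁻ ω, ENNReal.ofReal (p.proxGap L (c ω)
      (restartRun p A L (proxRestart L ε ρ δ σ) ξ bG bS γ (c ω) (k + 1) ω).1) ∂P ≤
    ∫⁻ ω, ENNReal.ofReal ((7 / 10) ^ (proxRestart L ε ρ δ σ).length n ‖c ω - p.prox L (c ω)‖ (k + 1)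
      * startPotential p L (c ω)
        (restartRun p A L (proxRestart L ε ρ δ σ) ξ bG bS γ (c ω) k ω).1) ∂P +
      ENNReal.ofReal (48 * (ρ * δ * ζ ^ 2 / L) +
        3 / 2 * ((proxRestart L ε ρ δ σ).epsOneSq n / 2 ^ (k + 1))) := by
  set r := proxRestart L ε ρ δ σ
  have hle : 𝒰 ⊔ sampleSigma p.H ξ (Set.Iio (mkRound γ 0 0)) ≤
      𝒰 ⊔ sampleSigma p.H ξ (Set.Iio (mkRound γ (k + 1) 0)) :=
    sup_le_sup_left (sampleSigma_mono _ _
      (Set.Iio_subset_Iio (mkRound_lt_of_stage γ k.succ_pos 0 0).le)) _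
  have hc' := hc.mono hle le_rfl
  have hz := S.measurable_restartRun r (k := k) hc' fun s hs t =>
    Set.Iic_subset_Iio.2 (mkRound_lt_of_stage γ (Nat.lt_succ_of_le hs) t 0)
  have hT := @measurable_stageLength n d q Ω
    (𝒰 ⊔ sampleSigma p.H ξ (Set.Iio (mkRound γ (k + 1) 0))) p L ζ σ S.L_pos S.smooth S.oracle
    S.card_pos S.exec.isProbabilityMeasure_data r c hc' (k + 1)
  have h1 := S.lintegral_proxGap_byrdNester_le γ (k + 1) (m := 2 ^ k) (by positivity) hc'
    (@Measurable.fst _ _ _ (𝒰 ⊔ sampleSigma p.H ξ (Set.Iio (mkRound γ (k + 1) 0))) _ _ _ hz) hT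
  simp only [S.length_stage] at h1
  refine le_trans (le_of_eq ?_) (h1.trans
    (add_le_add_right (ENNReal.ofReal_le_ofReal (S.errorBound_le ε k)) _))
  simp only [restartRun, byrdReNester, S.length_stage]

/-- Either the noise scale e is large against the target E₀, and the doubling batches bring it down,
or a single stage already suffices. -/
theorem lintegral_proxGap_restartRun_le (S : Setting 𝒰 P p A ξ bG bS L ζ σ ρ δ) {ε : ℝ}
    (hε : 0 < ε) (γ : ℕ) {c : Ω → Vec d}
    (hc : Measurable[𝒰 ⊔ sampleSigma p.H ξ (Set.Iio (mkRound γ 0 0))] c) :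
    ∫⁻ ω, ENNReal.ofReal (p.proxGap L (c ω) (restartRun p A L (proxRestart L ε ρ δ σ) ξ bG bS γ
      (c ω) ((proxRestart L ε ρ δ σ).stages n) ω).1) ∂P ≤
      ENNReal.ofReal (3 * ε ^ 2 / (80 * L) + 64 * (ρ * δ * ζ ^ 2 / L)) := by
  have hL := S.L_pos
  set r := proxRestart L ε ρ δ σ with hr
  set e := r.epsOneSq n with he
  set Z := ρ * δ * ζ ^ 2 / L with hZ
  set E₀ := ε ^ 2 / (80 * L) with hE₀
  have he0 : 0 ≤ e := S.epsOneSq_nonneg ε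
  have hZ0 : 0 ≤ Z := div_nonneg
    (mul_nonneg (mul_nonneg S.rho_nonneg S.delta_nonneg) (sq_nonneg _)) hL.le
  have hE₀0 : 0 < E₀ := by positivity
  have hgoal : 3 * ε ^ 2 / (80 * L) = 3 * E₀ := by rw [hE₀]; ring
  rw [hgoal]
  have h1 : ∫⁻ ω, ENNReal.ofReal (p.proxGap L (c ω)
      (restartRun p A L r ξ bG bS γ (c ω) 1 ω).1) ∂P ≤
      ENNReal.ofReal (max (e / 2) E₀ + (48 * Z + 3 / 4 * e)) := by
    rw [ENNReal.ofReal_add (by positivity) (by positivity)]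
    refine (S.lintegral_proxGap_stage_le ε γ 0 hc).trans
      (add_le_add ?_ (ENNReal.ofReal_le_ofReal (by rw [zero_add, pow_one]; linarith)))
    refine (lintegral_mono (g := fun _ => ENNReal.ofReal (max (e / 2) E₀))
      fun ω => ENNReal.ofReal_le_ofReal ?_).trans_eq ?_
    · refine le_trans ?_ (seven_tenths_pow_firstLength_mul_le hL hε he0 ‖c ω - p.prox L (c ω)‖)
      exact mul_le_mul_of_nonneg_left (S.startPotential_le_dist (c ω) (c ω)) (by positivity)
    · rw [lintegral_const, measure_univ, mul_one]
  have hlog : 4 * r.M * e / r.ε ^ 2 = e / E₀ := by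
    rw [hr, proxRestart_eps_sq, hE₀]
    change 4 * (3 * L) * e / _ = _
    field_simp
    ring
  rcases le_or_gt E₀ (e / 2) with hcase | hcase
  -- The invariant reproduces itself: a quarter of the old bound contributes (3/2)e/2^(k+2) and 16Z,
  -- the new error another (3/2)e/2^(k+2) and 48Z.
  · have hk : ∀ k : ℕ, ∫⁻ ω, ENNReal.ofReal (p.proxGap L (c ω)
        (restartRun p A L r ξ bG bS γ (c ω) (k + 1) ω).1) ∂P ≤
        ENNReal.ofReal (3 * (e / 2 ^ (k + 1)) + 64 * Z) := by
      intro k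
      induction k with
      | zero =>
        refine h1.trans (ENNReal.ofReal_le_ofReal ?_)
        rw [max_eq_left hcase, zero_add, pow_one]
        linarith
      | succ k ih =>
        have h2 : ∫⁻ ω, ENNReal.ofReal ((7 / 10) ^ r.length n ‖c ω - p.prox L (c ω)‖ (k + 1 + 1)
            * startPotential p L (c ω) (restartRun p A L r ξ bG bS γ (c ω) (k + 1) ω).1) ∂P ≤
            ENNReal.ofReal (1 / 4 * (3 * (e / 2 ^ (k + 1)) + 64 * Z)) := by
          rw [ENNReal.ofReal_mul (by norm_num)]
          refine le_trans ?_ (mul_le_mul_right ih _)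
          rw [← lintegral_const_mul' _ _ ENNReal.ofReal_ne_top]
          refine lintegral_mono fun ω => ?_
          rw [← ENNReal.ofReal_mul (by norm_num)]
          refine ENNReal.ofReal_le_ofReal ?_
          have hg := S.smooth.proxGap_nonneg hL S.card_pos (c ω)
            (restartRun p A L r ξ bG bS γ (c ω) (k + 1) ω).1
          have hp := S.startPotential_le_gap (c ω)
            (restartRun p A L r ξ bG bS γ (c ω) (k + 1) ω).1
          -- Seven iterations are enough for the quarter, since (23/10)(7/10)^7 < 1/4.
          have h7 : (7 / 10 : ℝ) ^ r.length n ‖c ω - p.prox L (c ω)‖ (k + 1 + 1) ≤ (7 / 10) ^ 7 :=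
            pow_le_pow_of_le_one (by norm_num) (by norm_num) (seven_le_length hL _ (by omega))
          have hp0 := S.startPotential_nonneg (c ω)
            (restartRun p A L r ξ bG bS γ (c ω) (k + 1) ω).1
          calc _ ≤ (7 / 10 : ℝ) ^ 7 * (23 / 10 * p.proxGap L (c ω)
                (restartRun p A L r ξ bG bS γ (c ω) (k + 1) ω).1) := by gcongr
            _ ≤ _ := by linarith
        refine (S.lintegral_proxGap_stage_le ε γ (k + 1) hc).trans ?_
        refine (add_le_add_left h2 _).trans_eq ?_
        rw [← ENNReal.ofReal_add (by positivity) (by positivity)]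
        congr 1
        rw [← hr, ← he, ← hZ, pow_succ _ (k + 1)]
        ring
    obtain ⟨k, hk'⟩ : ∃ k, r.stages n = k + 1 :=
      ⟨r.stages n - 1, (Nat.succ_pred_eq_of_pos (lt_of_lt_of_le one_pos (le_max_right _ _))).symm⟩
    rw [hk']
    refine (hk k).trans (ENNReal.ofReal_le_ofReal ?_)
    have he' : 0 < e := by linarith
    have h3 : Real.logb 2 (e / E₀) ≤ (k + 1 : ℕ) := by
      rw [← hk', ← hlog]
      refine (Nat.le_ceil _).trans ?_
      exact_mod_cast le_max_left _ _
    rw [Real.logb_le_iff_le_rpow one_lt_two (by positivity), Real.rpow_natCast,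
      div_le_iff₀ hE₀0] at h3
    have h4 : e / 2 ^ (k + 1) ≤ E₀ := by
      rw [div_le_iff₀ (by positivity)]
      linarith
    linarith
  -- Here e/E₀ < 2, so the logarithm is at most 1. The value e = 0 is included, since `Real.logb`
  -- sends 0 to 0.
  · have h3 : r.stages n = 1 := by
      rw [RestartParams.stages, ← he, hlog]
      refine max_eq_right (Nat.ceil_le.2 ?_)
      rcases he0.eq_or_lt with h0 | h0
      · rw [← h0]
        simp
      · rw [Real.logb_le_iff_le_rpow one_lt_two (by positivity), div_le_iff₀ hE₀0, Nat.cast_one,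
          Real.rpow_one]
        linarith
    rw [h3]
    refine h1.trans (ENNReal.ofReal_le_ofReal ?_)
    rw [max_eq_right hcase.le]
    linarith

end Setting

/-! ### The proximal point method in expectation -/

theorem integrable_and_integral_le_of_lintegral_le {Ω : Type*} [MeasurableSpace Ω] {P : Measure Ω}
    {X : Ω → ℝ} (hX : Measurable X) (h0 : ∀ ω, 0 ≤ X ω) {B : ℝ} (hB : 0 ≤ B)
    (h : ∫⁻ ω, ENNReal.ofReal (X ω) ∂P ≤ ENNReal.ofReal B) :
    Integrable X P ∧ ∫ ω, X ω ∂P ≤ B := by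
  have hint : Integrable X P := ⟨hX.aestronglyMeasurable, by
    rw [hasFiniteIntegral_iff_ofReal (Filter.Eventually.of_forall h0)]
    exact h.trans_lt ENNReal.ofReal_lt_top⟩
  refine ⟨hint, ?_⟩
  rw [← ENNReal.ofReal_le_ofReal_iff hB,
    ofReal_integral_eq_lintegral_ofReal hint (Filter.Eventually.of_forall h0)]
  exact h

/-- Jensen's inequality by integrating X ≤ X²/(2√B) + √B/2, which also yields integrability. -/
theorem integrable_and_integral_le_sqrt {Ω : Type*} [MeasurableSpace Ω] {P : Measure Ω}
    [IsProbabilityMeasure P] {X : Ω → ℝ} (hX : Measurable X) (h0 : ∀ ω, 0 ≤ X ω) {B : ℝ}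
    (hB : 0 < B) (h : ∫⁻ ω, ENNReal.ofReal (X ω ^ 2) ∂P ≤ ENNReal.ofReal B) :
    Integrable X P ∧ ∫ ω, X ω ∂P ≤ √B := by
  obtain ⟨hint, hle⟩ := integrable_and_integral_le_of_lintegral_le (hX.pow_const 2)
    (fun ω => sq_nonneg _) hB.le h
  have hs : 0 < √B := Real.sqrt_pos.2 hB
  have hsq : √B ^ 2 = B := Real.sq_sqrt hB.le
  have hpt : ∀ ω, X ω ≤ (2 * √B)⁻¹ * X ω ^ 2 + √B / 2 := by
    intro ω
    have h1 : 0 ≤ (2 * √B)⁻¹ * (X ω - √B) ^ 2 := by positivity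
    have h2 : (2 * √B)⁻¹ * (X ω - √B) ^ 2 = (2 * √B)⁻¹ * X ω ^ 2 + √B / 2 - X ω := by
      field_simp
      ring
    linarith
  have hi : Integrable (fun ω => (2 * √B)⁻¹ * X ω ^ 2 + √B / 2) P :=
    (hint.const_mul _).add (integrable_const _)
  have hXi : Integrable X P := hi.mono' hX.aestronglyMeasurable
    (Filter.Eventually.of_forall fun ω => by
      rw [Real.norm_of_nonneg (h0 ω)]
      exact hpt ω)
  refine ⟨hXi, (integral_mono hXi hi hpt).trans ?_⟩
  rw [integral_add (hint.const_mul _) (integrable_const _), integral_const_mul, integral_const,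
    probReal_univ, one_smul]
  calc (2 * √B)⁻¹ * ∫ ω, X ω ^ 2 ∂P + √B / 2 ≤ (2 * √B)⁻¹ * B + √B / 2 := by gcongr
    _ = √B := by
      nth_rw 2 [← hsq]
      field_simp
      ring

theorem uniformOn_Icc_singleton {Γ γ : ℕ} (hγ : γ ∈ Finset.Icc 1 Γ) :
    uniformOn (Set.Icc 1 Γ) {γ} = ((Γ : ℕ) : ENNReal)⁻¹ := by
  have h1 : (Set.Icc 1 Γ : Set ℕ) ∩ {γ} = {γ} := by
    rw [Set.inter_eq_right, Set.singleton_subset_iff]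
    exact Finset.mem_Icc.1 hγ
  rw [uniformOn, cond_apply (by measurability), h1, Measure.count_singleton, mul_one,
    ← Finset.coe_Icc, Measure.count_apply_finset]
  simp

/-- Splitting over the values of the index, independence factors each term into probability 1/Γ
times an integral. -/
theorem lintegral_uniform_index_eq {Ω : Type*} {m : MeasurableSpace Ω} [mΩ : MeasurableSpace Ω]
    {P : Measure Ω} [IsProbabilityMeasure P] (hm : m ≤ mΩ) {Γ : ℕ}
    {γ' : Ω → ℕ} (hγ : Measurable γ') (hlaw : P.map γ' = uniformOn (Set.Icc 1 Γ))
    (hind : Indep (MeasurableSpace.comap γ' inferInstance) m P) {X : ℕ → Ω → ENNReal}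
    (hX : ∀ γ, Measurable[m] (X γ)) :
    ∫⁻ ω, X (γ' ω) ω ∂P = (Γ : ENNReal)⁻¹ * ∑ γ ∈ Finset.Icc 1 Γ, ∫⁻ ω, X γ ω ∂P := by
  have hmem : ∀ᵐ ω ∂P, γ' ω ∈ Finset.Icc 1 Γ := by
    have h1 : ∀ᵐ k ∂(P.map γ'), k ∈ Finset.Icc 1 Γ := by
      rw [hlaw, ae_iff, uniformOn, cond_apply (by measurability)]
      have : (Set.Icc 1 Γ : Set ℕ) ∩ {a | a ∉ Finset.Icc 1 Γ} = ∅ := by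
        ext k
        simp
      rw [this]
      simp
    exact ae_of_ae_map hγ.aemeasurable h1
  have hpre : ∀ γ, MeasurableSet[MeasurableSpace.comap γ' inferInstance] (γ' ⁻¹' {γ}) := fun γ =>
    ⟨{γ}, measurableSet_singleton γ, rfl⟩
  have e : ∀ᵐ ω ∂P, X (γ' ω) ω =
      ∑ γ ∈ Finset.Icc 1 Γ, (γ' ⁻¹' {γ}).indicator (fun _ => (1 : ENNReal)) ω * X γ ω := by
    filter_upwards [hmem] with ω hω
    rw [Finset.sum_eq_single_of_mem _ hω fun γ _ hne => by
      rw [Set.indicator_of_notMem (by simpa using hne.symm), zero_mul]]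
    simp
  have hfac : ∀ γ ∈ Finset.Icc 1 Γ,
      ∫⁻ ω, (γ' ⁻¹' {γ}).indicator (fun _ => (1 : ENNReal)) ω * X γ ω ∂P =
        (Γ : ENNReal)⁻¹ * ∫⁻ ω, X γ ω ∂P := by
    intro γ hγmem
    rw [lintegral_mul_eq_lintegral_mul_lintegral_of_independent_measurableSpace
      (f := (γ' ⁻¹' {γ}).indicator fun _ => (1 : ENNReal)) hγ.comap_le hm hind
      (measurable_const.indicator (hpre γ)) (hX γ),
      lintegral_indicator (hγ (measurableSet_singleton γ)), lintegral_const, one_mul,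
      Measure.restrict_apply_univ, ← Measure.map_apply hγ (measurableSet_singleton γ), hlaw,
      uniformOn_Icc_singleton hγmem]
  rw [lintegral_congr_ae e, lintegral_finsetSum, Finset.mul_sum]
  · exact Finset.sum_congr rfl hfac
  · intro γ _
    exact (measurable_const.indicator (hγ (measurableSet_singleton γ))).mul ((hX γ).mono hm le_rfl)

namespace Problem

variable {p : Problem n d q} {L ζ : ℝ}

/-- The suboptimality of `x` for the objective. -/
def objGap (p : Problem n d q) (x : Vec d) : ℝ := p.obj x - ⨅ x, p.obj x

theorem IsSmoothHeterogeneous.objGap_nonneg (h : p.IsSmoothHeterogeneous L ζ) (x : Vec d) :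
    0 ≤ p.objGap x :=
  sub_nonneg.2 (ciInf_le h.bddBelow_obj x)

theorem IsSmoothHeterogeneous.measurable_objGap (h : p.IsSmoothHeterogeneous L ζ) :
    Measurable p.objGap :=
  (h.contDiff_obj.continuous.sub continuous_const).measurable

theorem IsSmoothHeterogeneous.proxGap_self_le (h : p.IsSmoothHeterogeneous L ζ) (hL : 0 < L)
    (c : Vec d) : p.proxGap L c c ≤ p.objGap c := by
  have h1 := ciInf_le h.bddBelow_obj (p.prox L c)
  have h2 : 0 ≤ L * ‖p.prox L c - c‖ ^ 2 := by positivity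
  simp only [proxGap, proxObj, objGap, sub_self, norm_zero]
  linarith

/-- The penalty vanishes at the centre, so the surrogate minimum is at most the objective there. -/
theorem IsSmoothHeterogeneous.objGap_add_le (h : p.IsSmoothHeterogeneous L ζ) (hL : 0 < L)
    (hH : 0 < (p.H.card : ℝ)) (c z : Vec d) :
    p.objGap z + L * ‖z - c‖ ^ 2 ≤ p.objGap c + p.proxGap L c z := by
  have h1 := h.prox_isMin hL hH c c
  simp only [proxGap, objGap]
  simp only [proxObj, sub_self, norm_zero] at h1 ⊢
  linarith

/-- The gradient of the objective differs from that of the surrogate by 2L(z - c), and the surrogate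
gradient is small when its gap is. -/
theorem IsSmoothHeterogeneous.norm_gradient_sq_le (h : p.IsSmoothHeterogeneous L ζ) (hL : 0 < L)
    (hH : 0 < (p.H.card : ℝ)) (c z : Vec d) :
    ‖∇ p.obj z‖ ^ 2 ≤ 12 * L * p.proxGap L c z + 8 * L * (L * ‖z - c‖ ^ 2) := by
  have h1 := (h.hasQuadraticBounds_proxObj hH c).norm_sq_le (by positivity) (h.prox_isMin hL hH c) z
  have h2 := norm_add_sq_le_two_mul (p.proxGrad L c z) (-((2 * L) • (z - c)))
  rw [norm_neg, norm_smul, mul_pow, Real.norm_eq_abs, sq_abs] at h2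
  rw [show p.proxGrad L c z + -((2 * L) • (z - c)) = ∇ p.obj z by rw [proxGrad]; abel] at h2
  rw [proxGap]
  linarith

end Problem

namespace Setting

variable {Ω : Type*} {𝒰 : MeasurableSpace Ω} [mΩ : MeasurableSpace Ω] {P : Measure Ω}
  {p : Problem n d q} {A : (Fin n → Vec d) → Vec d} {ξ : Round → Fin n → ℕ → Ω → Vec q}
  {bG bS : Round → Fin n → Ω → Vec d} {L ζ σ ρ δ : ℝ}

/-- The bound on the expected suboptimality after one call of Byrd-reNester. -/
def callGap (L ζ ρ δ ε : ℝ) : ℝ := 3 * ε ^ 2 / (80 * L) + 64 * (ρ * δ * ζ ^ 2 / L)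

theorem callGap_nonneg (S : Setting 𝒰 P p A ξ bG bS L ζ σ ρ δ) (ε : ℝ) :
    0 ≤ callGap L ζ ρ δ ε := by
  have h1 := S.L_pos
  have h2 := S.rho_nonneg
  have h3 := S.delta_nonneg
  unfold callGap
  positivity

variable [IsProbabilityMeasure P]

theorem measurable_proxProcess_prod (S : Setting 𝒰 P p A ξ bG bS L ζ σ ρ δ) (r : RestartParams)
    (x₀ : Vec d) {γ : ℕ} {K : Set Round} (hK : ∀ g ≤ γ, ∀ s t, Set.Iic (mkRound g s t) ⊆ K) :
    Measurable[𝒰 ⊔ sampleSigma p.H ξ K] (proxProcess p A (proxStep L) r L ξ bG bS x₀ γ) :=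
  @measurable_proxPoint n d q Ω (𝒰 ⊔ sampleSigma p.H ξ K) p A L ζ σ S.L_pos S.smooth S.oracle
    S.card_pos S.exec.isProbabilityMeasure_data S.measurable_agg r _ _ _ x₀ γ
    (fun g hg s t => measurable_sample_past (hK g hg s t Set.self_mem_Iic))
    (fun g hg s t => S.measurable_bG (hK g hg s t)) (fun g hg s t => S.measurable_bS (hK g hg s t))

theorem measurable_proxProcess_fst (S : Setting 𝒰 P p A ξ bG bS L ζ σ ρ δ) (r : RestartParams)
    (x₀ : Vec d) (γ : ℕ) :
    Measurable[𝒰 ⊔ sampleSigma p.H ξ (Set.Iio (mkRound (γ + 1) 0 0))]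
      fun ω => (proxProcess p A (proxStep L) r L ξ bG bS x₀ γ ω).1 :=
  @Measurable.fst _ _ _ (𝒰 ⊔ sampleSigma p.H ξ (Set.Iio (mkRound (γ + 1) 0 0))) _ _ _
    (S.measurable_proxProcess_prod r x₀ fun _ hg s t =>
      Set.Iic_subset_Iio.2 (mkRound_lt_of_call (Nat.lt_succ_of_le hg) s t 0 0))

theorem lintegral_proxGap_call_le (S : Setting 𝒰 P p A ξ bG bS L ζ σ ρ δ) {ε : ℝ} (hε : 0 < ε)
    (x₀ : Vec d) (γ : ℕ) :
    ∫⁻ ω, ENNReal.ofReal (p.proxGap L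
      (proxProcess p A (proxStep L) (proxRestart L ε ρ δ σ) L ξ bG bS x₀ γ ω).1
      (proxProcess p A (proxStep L) (proxRestart L ε ρ δ σ) L ξ bG bS x₀ (γ + 1) ω).1) ∂P ≤
      ENNReal.ofReal (callGap L ζ ρ δ ε) :=
  S.lintegral_proxGap_restartRun_le hε (γ + 1) (S.measurable_proxProcess_fst _ x₀ γ)

/-- Telescoping keeps both terms: the sum of squared moves serves the gradient bound, the final gap
serves the query count. -/
theorem lintegral_objGap_add_sum_le (S : Setting 𝒰 P p A ξ bG bS L ζ σ ρ δ) {ε : ℝ} (hε : 0 < ε)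
    (x₀ : Vec d) (N : ℕ) :
    ∫⁻ ω, ENNReal.ofReal (p.objGap
      (proxProcess p A (proxStep L) (proxRestart L ε ρ δ σ) L ξ bG bS x₀ N ω).1) ∂P +
    ∑ γ ∈ Finset.range N, ∫⁻ ω, ENNReal.ofReal (L * ‖
      (proxProcess p A (proxStep L) (proxRestart L ε ρ δ σ) L ξ bG bS x₀ (γ + 1) ω).1 -
      (proxProcess p A (proxStep L) (proxRestart L ε ρ δ σ) L ξ bG bS x₀ γ ω).1‖ ^ 2) ∂P ≤
      ENNReal.ofReal (p.objGap x₀ + N * callGap L ζ ρ δ ε) := by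
  set κ := proxProcess p A (proxStep L) (proxRestart L ε ρ δ σ) L ξ bG bS x₀
  have hm : ∀ γ, Measurable fun ω => (κ γ ω).1 := fun γ =>
    (S.measurable_proxProcess_fst _ x₀ γ).mono (S.exec.past_le _) le_rfl
  have hg0 := S.callGap_nonneg ε
  have hd0 := S.smooth.objGap_nonneg
  have hL := S.L_pos
  have hdm : ∀ γ, Measurable fun ω => ENNReal.ofReal (p.objGap (κ γ ω).1) := fun γ =>
    (S.smooth.measurable_objGap.comp (hm γ)).ennreal_ofReal
  induction N with
  | zero =>
    have : ∀ ω, (κ 0 ω).1 = x₀ := fun ω => rfl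
    simp [this]
  | succ N ih =>
    have hstep : ∫⁻ ω, ENNReal.ofReal (p.objGap (κ (N + 1) ω).1) ∂P +
        ∫⁻ ω, ENNReal.ofReal (L * ‖(κ (N + 1) ω).1 - (κ N ω).1‖ ^ 2) ∂P ≤
        ∫⁻ ω, ENNReal.ofReal (p.objGap (κ N ω).1) ∂P + ENNReal.ofReal (callGap L ζ ρ δ ε) := by
      refine le_trans ?_ (add_le_add_right (S.lintegral_proxGap_call_le hε x₀ N) _)
      rw [← lintegral_add_left (hdm (N + 1)), ← lintegral_add_left (hdm N)]
      refine lintegral_mono fun ω => ?_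
      rw [← ENNReal.ofReal_add (hd0 _) (by positivity),
        ← ENNReal.ofReal_add (hd0 _) (S.smooth.proxGap_nonneg hL S.card_pos _ _)]
      exact ENNReal.ofReal_le_ofReal (S.smooth.objGap_add_le hL S.card_pos _ _)
    rw [Finset.sum_range_succ, add_comm (Finset.sum _ _), ← add_assoc]
    refine (add_le_add_left hstep _).trans ?_
    rw [add_right_comm]
    refine (add_le_add_left ih _).trans_eq ?_
    rw [← ENNReal.ofReal_add (add_nonneg (hd0 _) (by positivity)) hg0]
    congr 1
    push_cast
    ring

theorem sum_lintegral_norm_gradient_sq_le (S : Setting 𝒰 P p A ξ bG bS L ζ σ ρ δ) {ε : ℝ}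
    (hε : 0 < ε) (x₀ : Vec d) (N : ℕ) :
    ∑ γ ∈ Finset.range N, ∫⁻ ω, ENNReal.ofReal (‖∇ p.obj
      (proxProcess p A (proxStep L) (proxRestart L ε ρ δ σ) L ξ bG bS x₀ (γ + 1) ω).1‖ ^ 2) ∂P ≤
      ENNReal.ofReal (N * (20 * L * callGap L ζ ρ δ ε) + 8 * L * p.objGap x₀) := by
  have hmain := S.lintegral_objGap_add_sum_le hε x₀ N
  set κ := proxProcess p A (proxStep L) (proxRestart L ε ρ δ σ) L ξ bG bS x₀ with hκ
  have hm : ∀ γ, Measurable fun ω => (κ γ ω).1 := fun γ =>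
    (S.measurable_proxProcess_fst _ x₀ γ).mono (S.exec.past_le _) le_rfl
  have hg0 := S.callGap_nonneg ε
  have hd0 := S.smooth.objGap_nonneg
  have hL := S.L_pos
  have h1 : ∀ γ, ∫⁻ ω, ENNReal.ofReal (‖∇ p.obj (κ (γ + 1) ω).1‖ ^ 2) ∂P ≤
      ENNReal.ofReal (12 * L * callGap L ζ ρ δ ε) + ENNReal.ofReal (8 * L) *
        ∫⁻ ω, ENNReal.ofReal (L * ‖(κ (γ + 1) ω).1 - (κ γ ω).1‖ ^ 2) ∂P := by
    intro γ
    have h2 : Measurable fun ω => ENNReal.ofReal (L * ‖(κ (γ + 1) ω).1 - (κ γ ω).1‖ ^ 2) :=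
      (((hm (γ + 1)).sub (hm γ)).norm.pow_const 2 |>.const_mul L).ennreal_ofReal
    rw [ENNReal.ofReal_mul (by positivity)]
    refine le_trans ?_ (add_le_add_left (mul_le_mul_right (S.lintegral_proxGap_call_le hε x₀ γ) _) _)
    rw [← hκ, ← lintegral_const_mul' _ _ ENNReal.ofReal_ne_top, ← lintegral_const_mul _ h2,
      ← lintegral_add_right _ (h2.const_mul _)]
    refine lintegral_mono fun ω => ?_
    have h3 := S.smooth.proxGap_nonneg hL S.card_pos (κ γ ω).1 (κ (γ + 1) ω).1
    rw [← ENNReal.ofReal_mul (by positivity), ← ENNReal.ofReal_mul (by positivity),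
      ← ENNReal.ofReal_add (by positivity) (by positivity)]
    exact ENNReal.ofReal_le_ofReal (S.smooth.norm_gradient_sq_le hL S.card_pos _ _)
  refine (Finset.sum_le_sum fun γ _ => h1 γ).trans ?_
  rw [Finset.sum_add_distrib, Finset.sum_const, Finset.card_range, nsmul_eq_mul, ← Finset.mul_sum]
  refine (add_le_add_right (mul_le_mul_right (le_add_self.trans hmain) _) _).trans_eq ?_
  rw [← ENNReal.ofReal_natCast, ← ENNReal.ofReal_mul (by positivity),
    ← ENNReal.ofReal_mul (by positivity), ← ENNReal.ofReal_add (by positivity)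
      (mul_nonneg (by positivity) (add_nonneg (hd0 _) (by positivity)))]
  congr 1
  ring

theorem integral_norm_gradient_output_le (S : Setting 𝒰 P p A ξ bG bS L ζ σ ρ δ) (hζ : 0 ≤ ζ)
    {ε : ℝ} (hε : 0 < ε) (x₀ : Vec d) {Γ : ℕ} (hΔ : 0 < p.objGap x₀)
    (hΓ : Γ = ⌈32 * L * p.objGap x₀ / ε ^ 2⌉₊) {γ' : Ω → ℕ} (hγ : Measurable γ')
    (hlaw : P.map γ' = uniformOn (Set.Icc 1 Γ))
    (hind : Indep (MeasurableSpace.comap γ' inferInstance)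
      (𝒰 ⊔ sampleSigma p.H ξ Set.univ) P) :
    Integrable (fun ω => ‖∇ p.obj (proxProcess p A (proxStep L) (proxRestart L ε ρ δ σ) L ξ bG bS x₀
      (γ' ω) ω).1‖) P ∧
    ∫ ω, ‖∇ p.obj (proxProcess p A (proxStep L) (proxRestart L ε ρ δ σ) L ξ bG bS x₀
      (γ' ω) ω).1‖ ∂P ≤ 16 * √5 * √ρ * √δ * ζ + ε := by
  have hL := S.L_pos
  have hsum := S.sum_lintegral_norm_gradient_sq_le hε x₀ Γ
  set κ := proxProcess p A (proxStep L) (proxRestart L ε ρ δ σ) L ξ bG bS x₀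
  have hgrad := (S.smooth.continuous_gradient hL S.card_pos).measurable
  have hκm : ∀ γ, Measurable[𝒰 ⊔ sampleSigma p.H ξ Set.univ] fun ω => ‖∇ p.obj (κ γ ω).1‖ :=
    fun γ => (measurable_norm.comp hgrad).comp ((S.measurable_proxProcess_fst _ x₀ γ).mono
      (sup_le_sup_left (sampleSigma_mono _ _ (Set.subset_univ _)) _) le_rfl)
  have hXm : Measurable fun ω => ‖∇ p.obj (κ (γ' ω) ω).1‖ :=
    measurable_apply_nat (X := fun ω γ => ‖∇ p.obj (κ γ ω).1‖)
      (fun γ => (hκm γ).mono (S.exec.past_le _) le_rfl) hγ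
  have hΓpos : 0 < Γ := by
    rw [hΓ]
    exact Nat.ceil_pos.2 (by positivity)
  have hΓ' : (0 : ℝ) < Γ := by exact_mod_cast hΓpos
  have hΓle : 8 * L * p.objGap x₀ ≤ Γ * (ε ^ 2 / 4) := by
    have h1 : 32 * L * p.objGap x₀ / ε ^ 2 ≤ Γ := by rw [hΓ]; exact Nat.le_ceil _
    rw [div_le_iff₀ (by positivity)] at h1
    linarith
  have hρδ : 0 ≤ ρ * δ * ζ ^ 2 :=
    mul_nonneg (mul_nonneg S.rho_nonneg S.delta_nonneg) (sq_nonneg _)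
  have hB : 0 < 1280 * (ρ * δ * ζ ^ 2) + ε ^ 2 := by positivity
  obtain ⟨h1, h2⟩ := integrable_and_integral_le_sqrt (P := P) hXm (fun ω => norm_nonneg _) hB (by
    rw [lintegral_uniform_index_eq (X := fun γ ω => ENNReal.ofReal (‖∇ p.obj (κ γ ω).1‖ ^ 2))
      (S.exec.past_le _) hγ hlaw hind
      fun γ => ((measurable_id.pow_const 2).ennreal_ofReal).comp (hκm γ)]
    have hshift : ∑ γ ∈ Finset.Icc 1 Γ, ∫⁻ ω, ENNReal.ofReal (‖∇ p.obj (κ γ ω).1‖ ^ 2) ∂P =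
        ∑ γ ∈ Finset.range Γ, ∫⁻ ω, ENNReal.ofReal (‖∇ p.obj (κ (γ + 1) ω).1‖ ^ 2) ∂P := by
      rw [Finset.range_eq_Ico, Finset.sum_Ico_add' (fun γ =>
        ∫⁻ ω, ENNReal.ofReal (‖∇ p.obj (κ γ ω).1‖ ^ 2) ∂P) 0 Γ 1]
      rfl
    rw [hshift]
    refine (mul_le_mul_right (hsum.trans (ENNReal.ofReal_le_ofReal (q :=
      Γ * (1280 * (ρ * δ * ζ ^ 2) + ε ^ 2)) ?_)) _).trans_eq ?_
    -- The call accuracy uses up 3/4 of ε²; the choice of Γ leaves at most 1/4 for 8LΔ/Γ. The rest,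
    -- 1280 = 16² · 5, gives the constant 16√5.
    · have : 20 * L * callGap L ζ ρ δ ε = 3 / 4 * ε ^ 2 + 1280 * (ρ * δ * ζ ^ 2) := by
        rw [callGap]
        field_simp
        ring
      rw [this]
      linarith
    · rw [ENNReal.ofReal_mul hΓ'.le, ENNReal.ofReal_natCast, ← mul_assoc,
        ENNReal.inv_mul_cancel (by exact_mod_cast hΓpos.ne') (ENNReal.natCast_ne_top _), one_mul])
  refine ⟨h1, h2.trans (Real.sqrt_le_iff.2 ⟨by positivity, ?_⟩)⟩
  have e1 : (16 * √5 * √ρ * √δ * ζ) ^ 2 = 1280 * (ρ * δ * ζ ^ 2) := by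
    simp only [mul_pow, Real.sq_sqrt S.rho_nonneg, Real.sq_sqrt S.delta_nonneg,
      Real.sq_sqrt (show (0 : ℝ) ≤ 5 by norm_num)]
    ring
  have e2 : 0 ≤ 16 * √5 * √ρ * √δ * ζ * ε := by positivity
  rw [add_sq, e1]
  linarith

end Setting

/-! ### The number of oracle queries -/

/-- The number of oracle queries in the first `k` stages of Byrd-reNester at distance `R` from the
minimizer. -/
def restartCost (r : RestartParams) (n : ℕ) (R : ℝ) (k : ℕ) : ℕ :=
  ∑ j ∈ Finset.range k, 2 ^ j * (1 + r.length n R (j + 1))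

theorem byrdReNester_queries (p : Problem n d q) (A : (Fin n → Vec d) → Vec d) (c : StepParams)
    (r : RestartParams) (ξ : ℕ → ℕ → Fin n → ℕ → Vec q) (bG bS : ℕ → ℕ → Fin n → Vec d)
    (z₀ : Vec d) (k : ℕ) :
    (byrdReNester p A c r ξ bG bS z₀ k).2 = restartCost r n (distArgmin p.obj z₀) k := by
  induction k with
  | zero => rfl
  | succ k ih =>
    rw [restartCost, Finset.sum_range_succ, ← restartCost, ← ih]
    simp only [byrdReNester, byrdNester_queries]
    ring

theorem length_le_eight {L ε ρ δ σ : ℝ} (hL : 0 < L) (R : ℝ) {k : ℕ} (hk : k ≠ 1) :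
    (proxRestart L ε ρ δ σ).length n R k ≤ 8 := by
  have hsq : √((proxRestart L ε ρ δ σ).M / (proxRestart L ε ρ δ σ).μ) = √3 :=
    sqrt_three_mul_div hL
  rw [RestartParams.length, if_neg hk, hsq, Nat.ceil_le]
  have h2 : Real.log 8 = 3 * Real.log 2 := by
    rw [show (8 : ℝ) = 2 ^ 3 by norm_num, Real.log_pow]
    norm_num
  have h3 := Real.log_two_lt_d9
  have h0 := Real.log_two_gt_d9
  have hs : √3 ^ 2 = 3 := Real.sq_sqrt (by norm_num)
  have h4 : √3 ≤ 174 / 100 := by nlinarith [Real.sqrt_nonneg 3]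
  rw [h2]
  push_cast
  nlinarith [Real.sqrt_nonneg 3]

/-- The tangent line of the logarithm at a lies above it. Being affine in u, the bound survives
expectation over a random distance. -/
theorem log_le_log_add_div {u a : ℝ} (hu : 0 ≤ u) (ha : 1 ≤ a) :
    Real.log u ≤ Real.log a + u / a := by
  have ha0 : 0 < a := by linarith
  rcases hu.eq_or_lt with rfl | hu
  · rw [Real.log_zero, zero_div, add_zero]
    exact Real.log_nonneg ha
  · have h1 := Real.log_le_sub_one_of_pos (div_pos hu ha0)
    rw [Real.log_div hu.ne' ha0.ne'] at h1
    linarith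

/-- Only the second entry of the minimum is used; a is a free parameter, chosen later to dominate
the expectation of the argument of the logarithm. -/
theorem firstLength_le {L ε ρ δ σ : ℝ} (hL : 0 < L) (R : ℝ) {a : ℝ} (ha : 1 ≤ a) :
    ((proxRestart L ε ρ δ σ).firstLength n R : ℝ) ≤
      1 + 4 * (Real.log a + 240 * L ^ 2 * R ^ 2 / ε ^ 2 / a) := by
  set r := proxRestart L ε ρ δ σ
  have hsq : √(r.M / r.μ) = √3 := sqrt_three_mul_div hL
  have hs : √3 ^ 2 = 3 := Real.sq_sqrt (by norm_num)
  have hs1 : √3 ≤ 2 := by nlinarith [Real.sqrt_nonneg 3]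
  have hε2 : r.ε ^ 2 = 3 / 20 * ε ^ 2 := proxRestart_eps_sq L ε ρ δ σ
  have hle : r.firstLength n R ≤
      ⌈2 * √(r.M / r.μ) * Real.log (4 * r.M ^ 2 * R ^ 2 / r.ε ^ 2)⌉₊ := by
    unfold RestartParams.firstLength
    split_ifs
    · exact le_rfl
    · exact min_le_right _ _
  have hu : 4 * r.M ^ 2 * R ^ 2 / r.ε ^ 2 = 240 * L ^ 2 * R ^ 2 / ε ^ 2 := by
    rw [hε2]
    change 4 * (3 * L) ^ 2 * R ^ 2 / (3 / 20 * ε ^ 2) = _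
    rw [div_mul_eq_div_div]
    ring
  rw [hu, hsq] at hle
  set u := 240 * L ^ 2 * R ^ 2 / ε ^ 2
  have hu0 : 0 ≤ u := by positivity
  have h1 := log_le_log_add_div hu0 ha
  have h2 : 0 ≤ Real.log a + u / a :=
    add_nonneg (Real.log_nonneg ha) (div_nonneg hu0 (by linarith))
  have hle' : (r.firstLength n R : ℝ) ≤ ⌈2 * √3 * Real.log u⌉₊ := by exact_mod_cast hle
  refine hle'.trans ?_
  rcases le_or_gt (2 * √3 * Real.log u) 0 with hneg | hpos
  · rw [Nat.ceil_eq_zero.2 hneg]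
    push_cast
    linarith
  · refine (Nat.ceil_lt_add_one hpos.le).le.trans ?_
    have h3 : 2 * √3 * Real.log u ≤ 2 * √3 * (Real.log a + u / a) := by gcongr
    have h4 : 2 * √3 * (Real.log a + u / a) ≤ 4 * (Real.log a + u / a) := by
      gcongr
      linarith
    linarith

/-- Subtracting 2 removes the cost of the mandatory single stage, so the bound vanishes with the
noise. -/
theorem two_pow_stages_sub_two_le {L ε ρ δ σ : ℝ} (hL : 0 < L) (hε : 0 < ε)
    (he : 0 ≤ (proxRestart L ε ρ δ σ).epsOneSq n) :
    (2 : ℝ) ^ (proxRestart L ε ρ δ σ).stages n - 2 ≤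
      160 * L * (proxRestart L ε ρ δ σ).epsOneSq n / ε ^ 2 := by
  set r := proxRestart L ε ρ δ σ with hr
  set e := r.epsOneSq n with hedef
  have hlog : 4 * r.M * e / r.ε ^ 2 = 80 * L * e / ε ^ 2 := by
    rw [hr, proxRestart_eps_sq]
    change 4 * (3 * L) * e / _ = _
    field_simp
    ring
  have h0 : 0 ≤ 160 * L * e / ε ^ 2 := by positivity
  rw [RestartParams.stages, ← hedef, hlog]
  set v := 80 * L * e / ε ^ 2 with hv
  rcases le_or_gt ⌈Real.logb 2 v⌉₊ 1 with h1 | h1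
  · rw [max_eq_right h1]
    linarith
  · rw [max_eq_left h1.le]
    have h2 : 1 < Real.logb 2 v := by
      have := Nat.lt_ceil.1 h1
      simpa using this
    have hv0 : 0 < v := by
      rcases (show 0 ≤ v by positivity).eq_or_lt with h3 | h3
      · rw [← h3, Real.logb_zero] at h2
        linarith
      · exact h3
    have h3 := Nat.ceil_lt_add_one (show 0 ≤ Real.logb 2 v by linarith)
    have h4 : (2 : ℝ) ^ ⌈Real.logb 2 v⌉₊ ≤ 2 * v := by
      calc (2 : ℝ) ^ ⌈Real.logb 2 v⌉₊ = (2 : ℝ) ^ (⌈Real.logb 2 v⌉₊ : ℝ) :=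
            (Real.rpow_natCast _ _).symm
        _ ≤ (2 : ℝ) ^ (Real.logb 2 v + 1) := Real.rpow_le_rpow_of_exponent_le one_le_two h3.le
        _ = 2 * v := by
          rw [Real.rpow_add two_pos, Real.rpow_logb two_pos (by norm_num) hv0, Real.rpow_one,
            mul_comm]
    have h5 : 2 * v = 160 * L * e / ε ^ 2 := by rw [hv]; ring
    linarith

/-- The first stage has batch size 1. Each later stage costs at most 1 + 8 batches, and the doubling
batch sizes sum to 2^P - 2. -/
theorem restartCost_le {L ε ρ δ σ : ℝ} (hL : 0 < L) (hε : 0 < ε)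
    (he : 0 ≤ (proxRestart L ε ρ δ σ).epsOneSq n) (R : ℝ) :
    (restartCost (proxRestart L ε ρ δ σ) n R ((proxRestart L ε ρ δ σ).stages n) : ℝ) ≤
      1 + (proxRestart L ε ρ δ σ).firstLength n R +
        1440 * L * (proxRestart L ε ρ δ σ).epsOneSq n / ε ^ 2 := by
  have h1 := two_pow_stages_sub_two_le hL hε he
  set r := proxRestart L ε ρ δ σ
  obtain ⟨k, hk⟩ : ∃ k, r.stages n = k + 1 :=
    ⟨r.stages n - 1, (Nat.succ_pred_eq_of_pos (lt_of_lt_of_le one_pos (le_max_right _ _))).symm⟩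
  rw [hk] at h1 ⊢
  have h2 : restartCost r n R (k + 1) ≤ (1 + r.firstLength n R) +
      ∑ j ∈ Finset.range k, 2 ^ (j + 1) * 9 := by
    rw [restartCost, Finset.sum_range_succ', add_comm]
    refine add_le_add (le_of_eq ?_) (Finset.sum_le_sum fun j _ => ?_)
    · simp [RestartParams.length]
    · have : r.length n R (j + 1 + 1) ≤ 8 := length_le_eight hL R (by omega)
      gcongr
      change 1 + r.length n R (j + 1 + 1) ≤ 9
      omega
  have h3 : ((∑ j ∈ Finset.range k, 2 ^ (j + 1) * 9 : ℕ) : ℝ) = 9 * (2 ^ (k + 1) - 2) := by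
    push_cast
    rw [← Finset.sum_mul]
    simp only [pow_succ]
    rw [← Finset.sum_mul, geom_sum_eq (by norm_num)]
    ring
  have h4 : (restartCost r n R (k + 1) : ℝ) ≤ (1 + r.firstLength n R) + 9 * (2 ^ (k + 1) - 2) := by
    rw [← h3]
    exact_mod_cast h2
  have h5 : 1440 * L * r.epsOneSq n / ε ^ 2 = 9 * (160 * L * r.epsOneSq n / ε ^ 2) := by ring
  linarith

namespace Setting

variable {Ω : Type*} {𝒰 : MeasurableSpace Ω} [mΩ : MeasurableSpace Ω] {P : Measure Ω}
  {p : Problem n d q} {A : (Fin n → Vec d) → Vec d} {ξ : Round → Fin n → ℕ → Ω → Vec q}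
  {bG bS : Round → Fin n → Ω → Vec d} {L ζ σ ρ δ : ℝ}

/-- Since (1 - δ)n ≥ 1/2, the factor 1 + 1/((1 - δ)n) is at most 3. -/
theorem epsOneSq_mul_le (S : Setting 𝒰 P p A ξ bG bS L ζ σ ρ δ) (ε : ℝ) :
    L * (proxRestart L ε ρ δ σ).epsOneSq n ≤
      288 * (ρ * δ * σ ^ 2 + σ ^ 2 / ((1 - δ) * n)) := by
  have hL := S.L_pos
  have hn : (1 : ℝ) ≤ n := by exact_mod_cast S.n_pos
  have hδ := S.delta_lt
  have hpos : 1 / 2 ≤ (1 - δ) * n := by nlinarith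
  set u : ℝ := 1 / ((1 - δ) * n) with hu
  have hu0 : 0 ≤ u := by positivity
  have hu2 : u ≤ 2 := by
    rw [hu, div_le_iff₀ (by linarith)]
    linarith
  have e1 : L * (proxRestart L ε ρ δ σ).epsOneSq n =
      32 * ((3 * ρ * δ * (1 + u) + u) * σ ^ 2) := by
    simp only [RestartParams.epsOneSq, proxRestart, ← hu]
    field_simp
  have e2 : σ ^ 2 / ((1 - δ) * n) = u * σ ^ 2 := by rw [hu]; ring
  have h1 : 0 ≤ ρ * δ * σ ^ 2 :=
    mul_nonneg (mul_nonneg S.rho_nonneg S.delta_nonneg) (sq_nonneg _)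
  have h2 : 0 ≤ u * σ ^ 2 := by positivity
  rw [e1, e2]
  nlinarith [mul_le_mul_of_nonneg_left hu2 h1]

variable [IsProbabilityMeasure P]

theorem proxProcess_queries (S : Setting 𝒰 P p A ξ bG bS L ζ σ ρ δ) (r : RestartParams)
    (x₀ : Vec d) (N : ℕ) (ω : Ω) :
    (proxProcess p A (proxStep L) r L ξ bG bS x₀ N ω).2 = ∑ γ ∈ Finset.range N,
      restartCost r n ‖(proxProcess p A (proxStep L) r L ξ bG bS x₀ γ ω).1 -
        p.prox L (proxProcess p A (proxStep L) r L ξ bG bS x₀ γ ω).1‖ (r.stages n) := by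
  induction N with
  | zero => rfl
  | succ N ih =>
    rw [Finset.sum_range_succ, ← ih, ← S.smooth.distArgmin_proxObj S.L_pos S.card_pos,
      ← Problem.surrogate_obj S.exec.isProbabilityMeasure_data S.oracle S.card_pos]
    exact congrArg ((proxProcess p A (proxStep L) r L ξ bG bS x₀ N ω).2 + ·)
      (byrdReNester_queries _ _ _ _ _ _ _ _ _)

/-- By strong convexity R² is at most 2/L times the objective gap at the centre, whose expectation
stays bounded through all calls. The condition on a makes the resulting term at most 4 per call. -/
theorem integral_queries_le (S : Setting 𝒰 P p A ξ bG bS L ζ σ ρ δ) {ε : ℝ} (hε : 0 < ε)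
    (x₀ : Vec d) (N : ℕ) {a : ℝ} (ha : 1 ≤ a)
    (haN : 480 * L / ε ^ 2 * (p.objGap x₀ + N * callGap L ζ ρ δ ε) ≤ a) :
    Integrable (fun ω => ((proxProcess p A (proxStep L) (proxRestart L ε ρ δ σ) L ξ bG bS x₀ N
      ω).2 : ℝ)) P ∧
    ∫ ω, ((proxProcess p A (proxStep L) (proxRestart L ε ρ δ σ) L ξ bG bS x₀ N ω).2 : ℝ) ∂P ≤
      N * (6 + 4 * Real.log a + 1440 * L * (proxRestart L ε ρ δ σ).epsOneSq n / ε ^ 2) := by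
  have hL := S.L_pos
  have hmain := S.lintegral_objGap_add_sum_le hε x₀
  have hq := S.proxProcess_queries (proxRestart L ε ρ δ σ) x₀ N
  have he := S.epsOneSq_nonneg ε
  have hg0 := S.callGap_nonneg ε
  have hd0 := S.smooth.objGap_nonneg
  set r := proxRestart L ε ρ δ σ with hr
  set κ := proxProcess p A (proxStep L) r L ξ bG bS x₀ with hκ
  set e := r.epsOneSq n
  have hm : Measurable fun ω => ((κ N ω).2 : ℝ) :=
    measurable_from_nat.comp ((S.measurable_proxProcess_prod r x₀ fun _ _ _ _ =>
      Set.subset_univ _).mono (S.exec.past_le _) le_rfl).snd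
  have hla := Real.log_nonneg ha
  have ha0 : 0 < a := by linarith
  set b := 2 + 4 * Real.log a + 1440 * L * e / ε ^ 2 with hb
  have hb0 : 0 ≤ b := by positivity
  set v := 4 * (480 * L / ε ^ 2 / a) with hv
  have hv0 : 0 ≤ v := by positivity
  have hpt : ∀ ω, ((κ N ω).2 : ℝ) ≤
      ∑ γ ∈ Finset.range N, (b + v * p.objGap (κ γ ω).1) := by
    intro ω
    rw [hq, Nat.cast_sum]
    refine Finset.sum_le_sum fun γ _ => ?_
    set c := (κ γ ω).1
    have h1 := restartCost_le hL hε he ‖c - p.prox L c‖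
    have h2 := firstLength_le (n := n) (ε := ε) (ρ := ρ) (δ := δ) (σ := σ) hL ‖c - p.prox L c‖ ha
    have h3 := (S.smooth.le_proxGap hL S.card_pos c c).trans (S.smooth.proxGap_self_le hL c)
    have h4 : 240 * L ^ 2 * ‖c - p.prox L c‖ ^ 2 / ε ^ 2 / a ≤
        480 * L / ε ^ 2 / a * p.objGap c := by
      calc _ = 480 * L / ε ^ 2 / a * (L / 2 * ‖c - p.prox L c‖ ^ 2) := by ring
        _ ≤ _ := by gcongr
    rw [hb, hv]
    linarith
  refine integrable_and_integral_le_of_lintegral_le hm (fun ω => Nat.cast_nonneg _) (by positivity)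
    ?_
  have hcall : ∀ γ ∈ Finset.range N, ∫⁻ ω, ENNReal.ofReal (b + v * p.objGap (κ γ ω).1) ∂P ≤
      ENNReal.ofReal (b + 4) := by
    intro γ hγ
    have h1 : ∫⁻ ω, ENNReal.ofReal (p.objGap (κ γ ω).1) ∂P ≤
        ENNReal.ofReal (p.objGap x₀ + N * callGap L ζ ρ δ ε) := by
      refine (le_self_add.trans (hmain γ)).trans (ENNReal.ofReal_le_ofReal ?_)
      gcongr
      exact (Finset.mem_range.1 hγ).le
    calc _ = ENNReal.ofReal b + ENNReal.ofReal v * ∫⁻ ω, ENNReal.ofReal (p.objGap (κ γ ω).1) ∂P := by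
          rw [← lintegral_const_mul' _ _ ENNReal.ofReal_ne_top]
          have : ∀ ω, ENNReal.ofReal (b + v * p.objGap (κ γ ω).1) = ENNReal.ofReal b +
              ENNReal.ofReal v * ENNReal.ofReal (p.objGap (κ γ ω).1) := fun ω => by
            rw [ENNReal.ofReal_add hb0 (mul_nonneg hv0 (hd0 _)), ENNReal.ofReal_mul hv0]
          simp only [this]
          rw [lintegral_add_left measurable_const, lintegral_const, measure_univ, mul_one]
      _ ≤ ENNReal.ofReal b + ENNReal.ofReal v *
          ENNReal.ofReal (p.objGap x₀ + N * callGap L ζ ρ δ ε) := by gcongr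
      _ ≤ _ := by
          rw [← ENNReal.ofReal_mul hv0, ← ENNReal.ofReal_add hb0
            (mul_nonneg hv0 (add_nonneg (hd0 _) (by positivity)))]
          refine ENNReal.ofReal_le_ofReal (add_le_add_right ?_ b)
          calc v * (p.objGap x₀ + N * callGap L ζ ρ δ ε)
              = 4 * ((480 * L / ε ^ 2 * (p.objGap x₀ + N * callGap L ζ ρ δ ε)) / a) := by
                rw [hv]; ring
            _ ≤ 4 * 1 := by
                gcongr
                exact (div_le_one ha0).2 haN
            _ = 4 := mul_one 4
  calc _ ≤ ∫⁻ ω, ∑ γ ∈ Finset.range N, ENNReal.ofReal (b + v * p.objGap (κ γ ω).1) ∂P := by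
        refine lintegral_mono fun ω => ?_
        rw [← ENNReal.ofReal_sum_of_nonneg fun γ _ => add_nonneg hb0 (mul_nonneg hv0 (hd0 _))]
        exact ENNReal.ofReal_le_ofReal (hpt ω)
    _ = ∑ γ ∈ Finset.range N, ∫⁻ ω, ENNReal.ofReal (b + v * p.objGap (κ γ ω).1) ∂P := by
        refine lintegral_finsetSum _ fun γ _ => ?_
        have h1 : Measurable fun ω => (κ γ ω).1 :=
          (S.measurable_proxProcess_fst _ x₀ γ).mono (S.exec.past_le _) le_rfl
        exact (((S.smooth.measurable_objGap.comp h1).const_mul v).const_add b).ennreal_ofReal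
    _ ≤ ∑ _γ ∈ Finset.range N, ENNReal.ofReal (b + 4) := Finset.sum_le_sum hcall
    _ = _ := by
        rw [Finset.sum_const, Finset.card_range, nsmul_eq_mul, ← ENNReal.ofReal_natCast,
          ← ENNReal.ofReal_mul (Nat.cast_nonneg _)]
        congr 1
        rw [hb]
        ring

theorem integral_queries_le_rate (S : Setting 𝒰 P p A ξ bG bS L ζ σ ρ δ) {ε : ℝ} (hε : 0 < ε)
    (x₀ : Vec d) {Γ : ℕ} (hΓ : Γ = ⌈32 * L * p.objGap x₀ / ε ^ 2⌉₊)
    (h1 : ε ≤ L * p.objGap x₀) (h2 : 2 * ε ^ 2 ≤ L * p.objGap x₀) :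
    Integrable (fun ω => ((proxProcess p A (proxStep L) (proxRestart L ε ρ δ σ) L ξ bG bS x₀ Γ
      ω).2 : ℝ)) P ∧
    ∫ ω, ((proxProcess p A (proxStep L) (proxRestart L ε ρ δ σ) L ξ bG bS x₀ Γ ω).2 : ℝ) ∂P ≤
      20000000 * (L * p.objGap x₀ * ρ * δ * σ ^ 2 / ε ^ 4
        + L * p.objGap x₀ * σ ^ 2 / ((1 - δ) * n * ε ^ 4)
        + L * p.objGap x₀ / ε ^ 2 * Real.log (L * p.objGap x₀ * (1 + ρ * δ * ζ ^ 2) / ε ^ 2)) := by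
  have hL := S.L_pos
  set Δ := p.objGap x₀
  set X := L * Δ / ε ^ 2 with hX
  set τ := ρ * δ * ζ ^ 2 with hτdef
  have hτ : 0 ≤ τ := mul_nonneg (mul_nonneg S.rho_nonneg S.delta_nonneg) (sq_nonneg _)
  have hX2 : 2 ≤ X := by
    rw [hX, le_div_iff₀ (by positivity)]
    exact h2
  -- This is the only use of ε ≤ LΔ: it absorbs the stray factor 1/ε² of ρδζ² into a power of X. The
  -- condition 2ε² ≤ LΔ gives X ≥ 2, so that constants are absorbed by log W.
  have hXε : 1 / ε ≤ X := by
    rw [hX, div_le_div_iff₀ hε (by positivity)]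
    nlinarith
  have hW : L * Δ * (1 + τ) / ε ^ 2 = X * (1 + τ) := by rw [hX]; ring
  set W := X * (1 + τ) with hWdef
  have hW2 : 2 ≤ W := by nlinarith
  have hΓle : (Γ : ℝ) ≤ 33 * X := by
    have h3 := Nat.ceil_lt_add_one (show 0 ≤ 32 * X by linarith)
    have h4 : 32 * L * Δ / ε ^ 2 = 32 * X := by rw [hX]; ring
    rw [hΓ, h4]
    linarith
  have hinv : 1 / ε ^ 2 ≤ X ^ 2 := by
    have := pow_le_pow_left₀ (by positivity) hXε 2
    rwa [div_pow, one_pow] at this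
  -- A power of W is a suitable a because only its logarithm enters the cost; 2^20 exceeds the
  -- leading constant 480 · 33 · 64.
  have haN : 480 * L / ε ^ 2 * (Δ + Γ * callGap L ζ ρ δ ε) ≤ 2 ^ 20 * W ^ 3 := by
    have e1 : 480 * L / ε ^ 2 * (Δ + Γ * callGap L ζ ρ δ ε) =
        480 * (X + Γ * (3 / 80 + 64 * (τ * (1 / ε ^ 2)))) := by
      rw [callGap, ← hτdef, hX]
      field_simp
    have e2 : τ * (1 / ε ^ 2) ≤ τ * X ^ 2 := by gcongr
    have e3 : 480 * (X + Γ * (3 / 80 + 64 * (τ * (1 / ε ^ 2)))) ≤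
        480 * (X + 33 * X * (3 / 80 + 64 * (τ * X ^ 2))) := by gcongr
    have e4 : X ≤ X ^ 3 := by nlinarith
    have e5 : X ^ 3 * (1 + τ) ≤ W ^ 3 := by
      rw [hWdef, mul_pow]
      gcongr
      nlinarith [sq_nonneg τ]
    have e6 : 0 ≤ X ^ 3 * τ := by positivity
    rw [e1]
    refine e3.trans ?_
    nlinarith
  have ha : 1 ≤ (2 : ℝ) ^ 20 * W ^ 3 := by
    have : 1 ≤ W ^ 3 := one_le_pow₀ (by linarith)
    nlinarith
  obtain ⟨hint, hle⟩ := S.integral_queries_le hε x₀ Γ ha haN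
  refine ⟨hint, hle.trans ?_⟩
  have hlog2 := Real.log_two_gt_d9
  have hlogW : Real.log 2 ≤ Real.log W := Real.log_le_log two_pos hW2
  have hloga : Real.log (2 ^ 20 * W ^ 3) ≤ 23 * Real.log W := by
    rw [Real.log_mul (by positivity) (by positivity), Real.log_pow, Real.log_pow]
    push_cast
    linarith
  have he := S.epsOneSq_mul_le ε
  have he0 := S.epsOneSq_nonneg ε
  set e := (proxRestart L ε ρ δ σ).epsOneSq n
  have h5 : 1440 * L * e / ε ^ 2 ≤
      414720 * ((ρ * δ * σ ^ 2 + σ ^ 2 / ((1 - δ) * n)) / ε ^ 2) := by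
    calc 1440 * L * e / ε ^ 2 = 1440 * (L * e) / ε ^ 2 := by ring
      _ ≤ 1440 * (288 * (ρ * δ * σ ^ 2 + σ ^ 2 / ((1 - δ) * n))) / ε ^ 2 := by gcongr
      _ = _ := by ring
  set s := (ρ * δ * σ ^ 2 + σ ^ 2 / ((1 - δ) * n)) / ε ^ 2 with hs
  have hs0 : 0 ≤ s := by
    have hρ := S.rho_nonneg
    have hδ := S.delta_nonneg
    have : 0 ≤ 1 - δ := by linarith [S.delta_lt]
    positivity
  have hterms : L * Δ * ρ * δ * σ ^ 2 / ε ^ 4 + L * Δ * σ ^ 2 / ((1 - δ) * n * ε ^ 4) = X * s := by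
    have hD : 0 < (1 - δ) * n :=
      mul_pos (by linarith [S.delta_lt]) (Nat.cast_pos.2 S.n_pos)
    rw [hX, hs]
    generalize (1 - δ) * n = D at hD
    field_simp
  rw [hterms, hW]
  have hbr : 6 + 4 * Real.log (2 ^ 20 * W ^ 3) + 1440 * L * e / ε ^ 2 ≤
      102 * Real.log W + 414720 * s := by
    have h6 : 6 ≤ 10 * Real.log W := by linarith
    calc _ ≤ 10 * Real.log W + 4 * (23 * Real.log W) + 414720 * s := by gcongr
      _ = _ := by ring
  have hbr0 : 0 ≤ 102 * Real.log W + 414720 * s := by linarith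
  calc _ ≤ (Γ : ℝ) * (102 * Real.log W + 414720 * s) := by gcongr
    _ ≤ 33 * X * (102 * Real.log W + 414720 * s) := by gcongr
    _ = 3366 * (X * Real.log W) + 13685760 * (X * s) := by ring
    _ ≤ _ := by
      have h6 : 0 ≤ X * Real.log W := mul_nonneg (by linarith) (by linarith)
      have h7 : 0 ≤ X * s := mul_nonneg (by linarith) hs0
      linarith

end Setting

end ByzantineRobust

end

/-! ### The accuracy and the query complexity together -/

theorem theorem5 :
    ∃ C : ℝ, 0 < C ∧
      ∀ (n d q : ℕ) (L ζ σ ρ δ δmax ε : ℝ),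
        0 < n → 0 < L → 0 ≤ ζ → 0 ≤ σ → 0 ≤ ρ → 0 ≤ δ → δ ≤ δmax → δmax < 1 / 2 → 0 < ε →
      -- the problem, with at least `(1 - δ) n` honest nodes, the oracle and the aggregator
      ∀ (p : ByzantineRobust.Problem n d q),
        (1 - δ) * n ≤ (p.H.card : ℝ) → p.IsSmoothHeterogeneous L ζ → p.IsUnbiasedOracle σ →
      ∀ (A : (Fin n → ByzantineRobust.Vec d) → ByzantineRobust.Vec d),
        Measurable A → ByzantineRobust.IsRobustAggregator p.H δ ρ A →
      -- samples and Byzantine messages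
      ∀ (Ω : Type*) (𝒰 : MeasurableSpace Ω) (_ : MeasurableSpace Ω) (P : Measure Ω) (_ : IsProbabilityMeasure P)
        (ξ : ByzantineRobust.Round → Fin n → ℕ → Ω → ByzantineRobust.Vec q)
        (bG bS : ByzantineRobust.Round → Fin n → Ω → ByzantineRobust.Vec d),
        ByzantineRobust.IsExecution 𝒰 P p ξ bG bS →
      -- initial point and parameters; the surrogates are `3L`-smooth and `L`-strongly convex
      ∀ (x₀ : ByzantineRobust.Vec d) (Δ : ℝ) (Γ : ℕ) (c : ByzantineRobust.StepParams)
        (r : ByzantineRobust.RestartParams),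
        Δ = p.obj x₀ - ⨅ x, p.obj x → 0 < Δ → Γ = ⌈32 * L * Δ / ε ^ 2⌉₊ →
        c = { α := 0, β := (√3 - 1) / (√3 + 1), θ := 1, η := 1 / (3 * L) } →
        r = { M := 3 * L, μ := L, ε := √(3 / 20) * ε, ρ := ρ, δ := δ, σ := σ } →
      -- the output index, uniform on `1, …, Γ` and independent of the run
      ∀ (γ' : Ω → ℕ), Measurable γ' → P.map γ' = uniformOn (Set.Icc 1 Γ) →
        Indep (MeasurableSpace.comap γ' inferInstance)
          (𝒰 ⊔ ByzantineRobust.sampleSigma p.H ξ Set.univ) P →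
      (Integrable (fun ω => ‖∇ p.obj
            (ByzantineRobust.proxProcess p A c r L ξ bG bS x₀ (γ' ω) ω).1‖) P ∧
        ∫ ω, ‖∇ p.obj (ByzantineRobust.proxProcess p A c r L ξ bG bS x₀ (γ' ω) ω).1‖ ∂P
          ≤ 16 * √5 * √ρ * √δ * ζ + ε) ∧
      (ε ≤ L * Δ → 2 * ε ^ 2 ≤ L * Δ →
        Integrable (fun ω =>
          ((ByzantineRobust.proxProcess p A c r L ξ bG bS x₀ Γ ω).2 : ℝ)) P ∧
        ∫ ω, ((ByzantineRobust.proxProcess p A c r L ξ bG bS x₀ Γ ω).2 : ℝ) ∂P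
          ≤ C * (L * Δ * ρ * δ * σ ^ 2 / ε ^ 4 + L * Δ * σ ^ 2 / ((1 - δ) * n * ε ^ 4)
              + L * Δ / ε ^ 2 * Real.log (L * Δ * (1 + ρ * δ * ζ ^ 2) / ε ^ 2))) := by
  refine ⟨20000000, by norm_num, ?_⟩
  intro n d q L ζ σ ρ δ δmax ε hn hL hζ hσ hρ hδ hδm hδmax hε p hcard hsmooth horacle A hA hrob
    Ω 𝒰 mΩ P hP ξ bG bS hexec x₀ Δ Γ c r hΔ hΔ0 hΓ hc hr γ' hγ hlaw hind
  subst hΔ hc hr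
  have S : ByzantineRobust.Setting 𝒰 P p A ξ bG bS L ζ σ ρ δ :=
    { n_pos := hn
      L_pos := hL
      rho_nonneg := hρ
      delta_nonneg := hδ
      delta_lt := hδm.trans_lt hδmax
      card_ge := hcard
      smooth := hsmooth
      oracle := horacle
      measurable_agg := hA
      robust := hrob
      exec := hexec }
  exact ⟨S.integral_norm_gradient_output_le hζ hε x₀ hΔ0 hΓ hγ hlaw hind,
    S.integral_queries_le_rate hε x₀ hΓ⟩
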